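/- For $n\ge 0$ let $\mathfrak C_n$ be the complex $*$-algebra generated by self-adjoint indeterminates $\chi_1,\dots,\chi_n$ with $\chi_j^2=1$ and $\chi_j\chi_k=-\chi_k\chi_j$ for $j\ne k$; for $S=\{k_1<\dots<k_q\}$ put $\chi^S=\chi_{k_1}\cdots\chi_{k_q}$ (these $2^n$ monomials form a basis). A degree-$2k$ pseudoexpectation is a linear functional $\widetilde{\mathbf E}:\mathfrak C_n\to\mathbb C$ with $\widetilde{\mathbf E}[1]=1$, $\widetilde{\mathbf E}[x^*]=\overline{\widetilde{\mathbf E}[x]}$ for all $x$, and $\widetilde{\mathbf E}[g^*g]\ge 0$ for all $g$ of degree at most $k$; a state satisfies this for all $g$. For self-adjoint $h$ of degree at most $2k$, $\mathrm{SOS}_{2k}(h)$ is the maximum of $\widetilde{\mathbf E}[h]$ over degree-$2k$ pseudoexpectations, and $\mathrm{Opt}(h)$ is the maximum of $\varrho(h)$ over states $\varrho$. A Hamiltonian drawn from the degree-$4$ SYK model is $$h=\binom n4^{-1/2}\sum_{S\subseteq[n],\,|S|=4}J_S\,\chi^S$$ with independent standard Gaussian $J_S$. Theorem. (a) For every $n$,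 $k$ and every self-adjoint $h\in\mathfrak C_n$ of degree at most $2k$, both maxima exist and $\mathrm{Opt}(h)\le\mathrm{SOS}_{2k}(h)$; that is, the relaxation always certifies an upper bound. (b) The degree-$8$ SOS relaxation is solvable in deterministic $\mathrm{poly}(n)$ time: for every $c$ there are a deterministic (logarithmic-cost random access machine) algorithm and a $d$ such that, for every $n$, given $n$ and rational coefficients $(a_S)_{|S|=4}$ whose numerators and denominators are at most $(n+2)^c$ in absolute value, the algorithm outputs within time $(n+2)^d$ a rational number that differs from $\mathrm{SOS}_8\bigl(\sum_S a_S\chi^S\bigr)$ by at most $(n+2)^{-c}$. (c) For every $n\ge 12$ and $h$ drawn from the degree-$4$ SYK model, $\mathrm{SOS}_8(h)$ is integrable and $\mathbf E[\mathrm{SOS}_8(h)]\le\sqrt{1+\sqrt6}\,\sqrt n$. (d) With probability tending to $1$ as $n\to\infty$, $\mathrm{SOS}_8(h)\le\sqrt{1+\sqrt6}\,\sqrt n$, so that the degree-$8$ relaxation certifies $\mathrm{Opt}(h)\le\sqrt{1+\sqrt6}\,\sqrt n$. (e) There is a constant $C$ such that, with probability tending to $1$ as $n\to\infty$, $\mathrm{SOS}_6(h)\le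 C\sqrt n$, so that even the degree-$6$ relaxation certifies $\mathrm{Opt}(h)\le O(\sqrt n)$. -/

import Mathlib

open MeasureTheory ProbabilityTheory Filter Topology
open scoped symmDiff ComplexOrder ComplexConjugate

namespace Majorana

/-! ### The Clifford algebra of `n` anticommuting self-adjoint involutions

It is realised on its basis of ordered monomials: an element is the family of its coefficients
`x S`, and the monomials of `S` and `T` multiply to `sgn S T` times the monomial of `S ∆ T`. -/

/-- The sign produced by sorting the ordered monomial of `S` followed by that of `T`: one factor
`-1` for every pair `i ∈ S`, `j ∈ T` with `j < i`. -/
def sgn {n : ℕ} (S T : Finset (Fin n)) : ℂ := ∏ i ∈ S, ∏ j ∈ T, if j < i then -1 else 1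

/-- The complex `*`-algebra generated by self-adjoint, pairwise anticommuting indeterminates
`χ_0, …, χ_{n-1}` that square to `1`. -/
def Cliff (n : ℕ) : Type := Finset (Fin n) → ℂ

namespace Cliff

variable {n : ℕ}

noncomputable instance : AddCommGroup (Cliff n) :=
  inferInstanceAs (AddCommGroup (Finset (Fin n) → ℂ))

noncomputable instance : Module ℂ (Cliff n) :=
  inferInstanceAs (Module ℂ (Finset (Fin n) → ℂ))

/-- The ordered monomial of `S`, as an element of the basis. -/
noncomputable def basisElt (S : Finset (Fin n)) : Cliff n := fun T => if T = S then 1 else 0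

noncomputable instance : One (Cliff n) := ⟨basisElt ∅⟩

noncomputable instance : Mul (Cliff n) :=
  ⟨fun x y U => ∑ S : Finset (Fin n), sgn S (S ∆ U) * (x S * y (S ∆ U))⟩

/-- The adjoint conjugates coefficients and reverses monomials; reversing the monomial of `S`
costs the sign `sgn S S`, which is `(-1) ^ (|S| choose 2)`. -/
noncomputable instance : Star (Cliff n) := ⟨fun x S => sgn S S * conj (x S)⟩

theorem ext {x y : Cliff n} (h : ∀ S, x S = y S) : x = y := funext h

theorem add_apply (x y : Cliff n) (S : Finset (Fin n)) : (x + y) S = x S + y S := rfl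

theorem zero_apply (S : Finset (Fin n)) : (0 : Cliff n) S = 0 := rfl

theorem smul_apply (c : ℂ) (x : Cliff n) (S : Finset (Fin n)) : (c • x) S = c * x S := rfl

theorem one_apply (S : Finset (Fin n)) : (1 : Cliff n) S = if S = ∅ then 1 else 0 := rfl

theorem mul_apply (x y : Cliff n) (U : Finset (Fin n)) :
    (x * y) U = ∑ S : Finset (Fin n), sgn S (S ∆ U) * (x S * y (S ∆ U)) := rfl

theorem star_apply (x : Cliff n) (S : Finset (Fin n)) : star x S = sgn S S * conj (x S) := rfl

theorem sum_apply {ι : Type*} (s : Finset ι) (f : ι → Cliff n) (S : Finset (Fin n)) :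
    (∑ i ∈ s, f i) S = ∑ i ∈ s, f i S := by
  classical
  induction s using Finset.induction_on with
  | empty => rfl
  | insert a s ha ih => rw [Finset.sum_insert ha, Finset.sum_insert ha, add_apply, ih]

theorem prod_symmDiff (f : Fin n → ℂ) (hf : ∀ i, f i * f i = 1) (S T : Finset (Fin n)) :
    ∏ i ∈ S ∆ T, f i = (∏ i ∈ S, f i) * ∏ i ∈ T, f i := by
  have key : ∀ A : Finset (Fin n), ∏ i ∈ A, f i = ∏ i, if i ∈ A then f i else 1 := by
    intro A
    rw [Finset.prod_ite_mem, Finset.univ_inter]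
  rw [key, key S, key T, ← Finset.prod_mul_distrib]
  refine Finset.prod_congr rfl fun i _ => ?_
  have := hf i
  by_cases h1 : i ∈ S <;> by_cases h2 : i ∈ T <;> simp [Finset.mem_symmDiff, h1, h2, this]

theorem sgn_sq (S T : Finset (Fin n)) : sgn S T * sgn S T = 1 := by
  unfold sgn
  rw [← Finset.prod_mul_distrib]
  refine Finset.prod_eq_one fun i _ => ?_
  rw [← Finset.prod_mul_distrib]
  refine Finset.prod_eq_one fun j _ => ?_
  split_ifs <;> norm_num

theorem sgn_conj (S T : Finset (Fin n)) : conj (sgn S T) = sgn S T := by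
  unfold sgn
  rw [map_prod]
  refine Finset.prod_congr rfl fun i _ => ?_
  rw [map_prod]
  refine Finset.prod_congr rfl fun j _ => ?_
  split_ifs <;> simp

theorem sgn_symmDiff_left (S S' T : Finset (Fin n)) : sgn (S ∆ S') T = sgn S T * sgn S' T := by
  unfold sgn
  apply prod_symmDiff
  intro i
  rw [← Finset.prod_mul_distrib]
  refine Finset.prod_eq_one fun j _ => ?_
  split_ifs <;> norm_num

theorem sgn_symmDiff_right (S T T' : Finset (Fin n)) : sgn S (T ∆ T') = sgn S T * sgn S T' := by
  unfold sgn
  rw [← Finset.prod_mul_distrib]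
  refine Finset.prod_congr rfl fun i _ => ?_
  apply prod_symmDiff
  intro j
  split_ifs <;> norm_num

theorem sgn_empty_left (T : Finset (Fin n)) : sgn ∅ T = 1 := rfl

theorem sgn_empty_right (S : Finset (Fin n)) : sgn S ∅ = 1 := by simp [sgn]

/-- Left translation by a set, as a permutation of all sets. -/
def shift (S : Finset (Fin n)) : Equiv.Perm (Finset (Fin n)) where
  toFun T := S ∆ T
  invFun T := S ∆ T
  left_inv T := symmDiff_symmDiff_cancel_left S T
  right_inv T := symmDiff_symmDiff_cancel_left S T

theorem mul_assoc' (x y z : Cliff n) : x * y * z = x * (y * z) := by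
  refine ext fun U => ?_
  simp only [mul_apply, Finset.sum_mul, Finset.mul_sum]
  rw [Finset.sum_comm]
  refine Finset.sum_congr rfl fun S _ => ?_
  refine Fintype.sum_equiv (shift S) _ _ fun V => ?_
  have h1 : (shift S) V = S ∆ V := rfl
  have h2 : (S ∆ V) ∆ (S ∆ U) = V ∆ U := by
    rw [symmDiff_comm S V, symmDiff_assoc, symmDiff_symmDiff_cancel_left]
  rw [h1, h2]
  have h3 := sgn_sq S U
  simp only [sgn_symmDiff_left, sgn_symmDiff_right]
  linear_combination (-(sgn V V * sgn V U * sgn S S * sgn S V * x S * y (S ∆ V) * z (V ∆ U))) * h3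

theorem star_mul' (x y : Cliff n) : star (x * y) = star y * star x := by
  refine ext fun U => ?_
  simp only [star_apply, mul_apply, map_sum, Finset.mul_sum, map_mul, sgn_conj]
  refine Fintype.sum_equiv (shift U) _ _ fun S => ?_
  have h1 : (shift U) S = S ∆ U := symmDiff_comm U S
  have h2 : (S ∆ U) ∆ U = S := symmDiff_symmDiff_cancel_right U S
  rw [h1, h2]
  have e1 := sgn_sq S S
  have e3 := sgn_sq U S
  simp only [sgn_symmDiff_left, sgn_symmDiff_right]
  linear_combination
    (-(sgn U U * sgn S S * sgn S U * conj (x S) * conj (y (S ∆ U)))) * (sgn S S * sgn S S * e3 + e1)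

noncomputable instance : Ring (Cliff n) :=
  { (inferInstance : AddCommGroup (Cliff n)) with
    mul := (· * ·)
    one := 1
    left_distrib := fun x y z => ext fun U => by
      simp only [mul_apply, add_apply, ← Finset.sum_add_distrib]
      exact Finset.sum_congr rfl fun S _ => by ring
    right_distrib := fun x y z => ext fun U => by
      simp only [mul_apply, add_apply, ← Finset.sum_add_distrib]
      exact Finset.sum_congr rfl fun S _ => by ring
    zero_mul := fun x => ext fun U => by simp [mul_apply, zero_apply]
    mul_zero := fun x => ext fun U => by simp [mul_apply, zero_apply]
    mul_assoc := mul_assoc'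
    one_mul := fun x => ext fun U => by
      rw [mul_apply, Finset.sum_eq_single ∅]
      · have h : (∅ : Finset (Fin n)) ∆ U = U := bot_symmDiff U
        simp [one_apply, sgn_empty_left, h]
      · intro S _ hS; simp [one_apply, hS]
      · simp
    mul_one := fun x => ext fun U => by
      rw [mul_apply, Finset.sum_eq_single U]
      · simp [one_apply, sgn_empty_right]
      · intro S _ hS
        have : S ∆ U ≠ ∅ := fun h => hS (symmDiff_eq_bot.mp h)
        simp [one_apply, this]
      · simp }

noncomputable instance : Algebra ℂ (Cliff n) :=
  Algebra.ofModule
    (fun c x y => ext fun U => by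
      simp only [mul_apply, smul_apply, Finset.mul_sum]
      exact Finset.sum_congr rfl fun S _ => by ring)
    (fun c x y => ext fun U => by
      simp only [mul_apply, smul_apply, Finset.mul_sum]
      exact Finset.sum_congr rfl fun S _ => by ring)

noncomputable instance : StarRing (Cliff n) where
  star_involutive x := ext fun S => by
    simp only [star_apply, map_mul, sgn_conj, Complex.conj_conj]
    rw [← mul_assoc, sgn_sq, one_mul]
  star_mul := star_mul'
  star_add x y := ext fun S => by simp only [star_apply, add_apply, map_add]; ring

instance : StarModule ℂ (Cliff n) where
  star_smul c x := ext fun S => by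
    simp only [star_apply, smul_apply, map_mul, Complex.star_def]; ring

/-- The indeterminate `χ_j`. -/
noncomputable def χ (j : Fin n) : Cliff n := basisElt {j}

/-- The monomial `χ^S = χ_{k₁} ⋯ χ_{k_q}` for `S = {k₁ < ⋯ < k_q}`. -/
noncomputable def mono (S : Finset (Fin n)) : Cliff n := ((S.sort (· ≤ ·)).map χ).prod

theorem basisElt_apply (S T : Finset (Fin n)) :
    (basisElt S : Cliff n) T = if T = S then 1 else 0 := rfl

theorem basisElt_mul (S T : Finset (Fin n)) :
    (basisElt S * basisElt T : Cliff n) = sgn S T • basisElt (S ∆ T) := by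
  refine ext fun U => ?_
  rw [mul_apply, Finset.sum_eq_single S]
  · simp only [basisElt_apply, smul_apply]
    by_cases h : U = S ∆ T
    · subst h; simp
    · have : S ∆ U ≠ T := fun h' => h (by rw [← h', symmDiff_symmDiff_cancel_left])
      simp [h, this]
  · intro V _ hV; simp [basisElt_apply, hV]
  · simp

/-- Each indeterminate squares to `1`. -/
theorem χ_mul_self (j : Fin n) : χ j * χ j = (1 : Cliff n) := by
  rw [χ, basisElt_mul, symmDiff_self]
  simp only [sgn, Finset.prod_singleton, lt_irrefl, if_false, one_smul]
  rfl

/-- Each indeterminate is self-adjoint. -/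
theorem star_χ (j : Fin n) : star (χ j : Cliff n) = χ j := by
  refine ext fun S => ?_
  rw [star_apply, χ, basisElt_apply]
  by_cases h : S = {j}
  · subst h; simp [sgn]
  · simp [h]

/-- Distinct indeterminates anticommute. -/
theorem χ_anticomm {j k : Fin n} (h : j ≠ k) : χ j * χ k = -(χ k * χ j : Cliff n) := by
  rw [χ, χ, basisElt_mul, basisElt_mul, symmDiff_comm ({k} : Finset (Fin n)) {j}, ← neg_smul]
  congr 1
  simp only [sgn, Finset.prod_singleton]
  rcases lt_or_gt_of_ne h with h | h <;> simp [h, h.not_gt]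

/-- The ordered monomials are the basis elements. -/
theorem mono_eq_basisElt (S : Finset (Fin n)) : (mono S : Cliff n) = basisElt S := by
  have key : ∀ l : List (Fin n), l.Pairwise (· < ·) →
      ((l.map χ).prod : Cliff n) = basisElt l.toFinset := by
    intro l
    induction l with
    | nil => intro _; rfl
    | cons a l ih =>
      intro h
      rw [List.pairwise_cons] at h
      have ha : a ∉ l.toFinset := fun hm => (h.1 a (List.mem_toFinset.mp hm)).ne rfl
      rw [List.map_cons, List.prod_cons, ih h.2, χ, basisElt_mul, List.toFinset_cons]
      have h1 : sgn {a} l.toFinset = 1 := by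
        simp only [sgn, Finset.prod_singleton]
        refine Finset.prod_eq_one fun j hj => ?_
        rw [if_neg (h.1 j (List.mem_toFinset.mp hj)).not_gt]
      have h2 : ({a} : Finset (Fin n)) ∆ l.toFinset = insert a l.toFinset := by
        ext j
        simp only [Finset.mem_symmDiff, Finset.mem_singleton, Finset.mem_insert]
        by_cases hj : j = a
        · subst hj; simp [ha]
        · simp [hj]
      rw [h1, h2, one_smul]
  rw [mono, key _ (Finset.sortedLT_sort S).pairwise, Finset.sort_toFinset]

/-- Every element is the combination of the monomials with its own coefficients. -/
theorem eq_sum_mono (x : Cliff n) : x = ∑ S : Finset (Fin n), x S • mono S := by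
  refine ext fun T => ?_
  rw [sum_apply, Finset.sum_eq_single T]
  · simp [mono_eq_basisElt, smul_apply, basisElt_apply]
  · intro S _ hS
    simp [mono_eq_basisElt, smul_apply, basisElt_apply, hS.symm]
  · simp

/-- `x` is a polynomial of degree at most `d` in the indeterminates. -/
def DegLE (d : ℕ) (x : Cliff n) : Prop := ∀ S : Finset (Fin n), d < S.card → x S = 0

/-! ### States, pseudoexpectations and the SOS relaxation -/

/-- A state: a unital linear functional that respects adjoints and is nonnegative on all squares. -/
structure IsState (φ : Cliff n →ₗ[ℂ] ℂ) : Prop where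
  map_one : φ 1 = 1
  map_star : ∀ x, φ (star x) = conj (φ x)
  nonneg : ∀ g : Cliff n, 0 ≤ φ (star g * g)

/-- A pseudoexpectation of degree `2 * k`: squares are only tested for `g` of degree at most `k`. -/
structure IsPseudoexpectation (k : ℕ) (φ : Cliff n →ₗ[ℂ] ℂ) : Prop where
  map_one : φ 1 = 1
  map_star : ∀ x, φ (star x) = conj (φ x)
  nonneg : ∀ g : Cliff n, DegLE k g → 0 ≤ φ (star g * g)

/-- The values at `h` of all states. -/
def stateValues (h : Cliff n) : Set ℝ := {r | ∃ φ, IsState φ ∧ (φ h).re = r}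

/-- `Opt(h)`, the largest expectation of `h` in a state. -/
noncomputable def opt (h : Cliff n) : ℝ := sSup (stateValues h)

/-- The values at `h` of all pseudoexpectations of degree `2 * k`. -/
def pseudoValues (k : ℕ) (h : Cliff n) : Set ℝ :=
  {r | ∃ φ, IsPseudoexpectation k φ ∧ (φ h).re = r}

/-- `SOS_{2k}(h)`, the value of the degree-`2 * k` SOS relaxation. -/
noncomputable def sos (k : ℕ) (h : Cliff n) : ℝ := sSup (pseudoValues k h)

end Cliff

/-! ### Quartic Hamiltonians and the SYK model -/

/-- The four-element subsets of the index set. -/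
abbrev Quad (n : ℕ) : Type := {S : Finset (Fin n) // S.card = 4}

/-- The quartic polynomial `∑ a_S χ^S`. -/
noncomputable def quartic {n : ℕ} (a : Quad n → ℝ) : Cliff n :=
  ∑ S : Quad n, (a S : ℂ) • Cliff.mono S.1

/-- The degree-4 SYK Hamiltonian with couplings `J`. -/
noncomputable def sykH {n : ℕ} (J : Quad n → ℝ) : Cliff n :=
  quartic fun S => J S / √(n.choose 4 : ℝ)

/-- The law of the couplings: independent standard Gaussians. -/
noncomputable def sykLaw (n : ℕ) : Measure (Quad n → ℝ) :=
  Measure.pi fun _ => gaussianReal 0 1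

/-! ### Deterministic running time: a random access machine with logarithmic cost

Memory cells and input cells hold integers; every operation is charged the bit length of all
integers (values and addresses) that it handles. -/

/-- Programs. The input is read-only; memory cells are named by natural numbers. -/
inductive Prog : Type
  /-- `mem[x] := c` -/
  | const (x : ℕ) (c : ℤ)
  /-- `mem[x] := mem[y] + mem[z]` -/
  | add (x y z : ℕ)
  /-- `mem[x] := mem[y] - mem[z]` -/
  | sub (x y z : ℕ)
  /-- `mem[x] := mem[y] * mem[z]` -/
  | mul (x y z : ℕ)
  /-- `mem[x] := mem[y] / mem[z]`, rounded -/
  | div (x y z : ℕ)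
  /-- `mem[x] := input[mem[y]]` -/
  | read (x y : ℕ)
  /-- `mem[x] := mem[mem[y]]` -/
  | load (x y : ℕ)
  /-- `mem[mem[x]] := mem[y]` -/
  | store (x y : ℕ)
  /-- one program after the other -/
  | seq (p q : Prog)
  /-- run `p` if `mem[x] > 0`, otherwise `q` -/
  | ite (x : ℕ) (p q : Prog)
  /-- repeat `p` as long as `mem[x] > 0` -/
  | loop (x : ℕ) (p : Prog)

/-- The number of bits of an integer. -/
def bits (z : ℤ) : ℕ := z.natAbs.size + 1

/-- `Run inp p s t s'`: with input `inp`, program `p` started with memory `s` halts with memory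
`s'` at cost `t`. Negative addresses are read as `0`. -/
inductive Run (inp : ℕ → ℤ) : Prog → (ℕ → ℤ) → ℕ → (ℕ → ℤ) → Prop
  | const (x c s) :
      Run inp (.const x c) s (bits c) (Function.update s x c)
  | add (x y z s) :
      Run inp (.add x y z) s (bits (s y) + bits (s z)) (Function.update s x (s y + s z))
  | sub (x y z s) :
      Run inp (.sub x y z) s (bits (s y) + bits (s z)) (Function.update s x (s y - s z))
  | mul (x y z s) :
      Run inp (.mul x y z) s (bits (s y) + bits (s z)) (Function.update s x (s y * s z))
  | div (x y z s) :
      Run inp (.div x y z) s (bits (s y) + bits (s z)) (Function.update s x (s y / s z))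
  | read (x y s) :
      Run inp (.read x y) s (bits (s y) + bits (inp (s y).toNat))
        (Function.update s x (inp (s y).toNat))
  | load (x y s) :
      Run inp (.load x y) s (bits (s y) + bits (s (s y).toNat))
        (Function.update s x (s (s y).toNat))
  | store (x y s) :
      Run inp (.store x y) s (bits (s x) + bits (s y)) (Function.update s (s x).toNat (s y))
  | seq {p q s₀ t₁ s₁ t₂ s₂} :
      Run inp p s₀ t₁ s₁ → Run inp q s₁ t₂ s₂ → Run inp (.seq p q) s₀ (t₁ + t₂) s₂
  | ite_pos {x p q s t s'} :
      0 < s x → Run inp p s t s' → Run inp (.ite x p q) s (bits (s x) + t) s'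
  | ite_neg {x p q s t s'} :
      s x ≤ 0 → Run inp q s t s' → Run inp (.ite x p q) s (bits (s x) + t) s'
  | loop_pos {x p s₀ t₁ s₁ t₂ s₂} :
      0 < s₀ x → Run inp p s₀ t₁ s₁ → Run inp (.loop x p) s₁ t₂ s₂ →
        Run inp (.loop x p) s₀ (bits (s₀ x) + t₁ + t₂) s₂
  | loop_neg {x p s} :
      s x ≤ 0 → Run inp (.loop x p) s (bits (s x)) s

/-- The code `((i n + j) n + k) n + l` of the set `{i < j < k < l}`. -/
def Quad.code {n : ℕ} (S : Quad n) : ℕ :=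
  (S.1.sort (· ≤ ·)).foldl (fun m i => m * n + (i : ℕ)) 0

/-- The rational coefficients `a`, as input: cell `0` holds `n`; cells `2 c + 1` and `2 c + 2` hold
the numerator and the denominator of the coefficient of the set with code `c`; all others `0`. -/
def inputOf {n : ℕ} (a : Quad n → ℚ) (m : ℕ) : ℤ :=
  if m = 0 then n
  else ∑ S : Quad n,
    if m = 2 * S.code + 1 then (a S).num else if m = 2 * S.code + 2 then ((a S).den : ℤ) else 0

/-- The rational `q` is written with numerator and denominator of size at most `B`, in absolute
value. -/
def HeightLE (B : ℕ) (q : ℚ) : Prop := q.num.natAbs ≤ B ∧ q.den ≤ B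

/-- The degree-`2 * k` SOS relaxation of quartic Hamiltonians is solvable in deterministic
polynomial time: for every exponent `c` there is a program that, on coefficients of `O(log n)` bits
(height at most `(n + 2) ^ c`), outputs a fraction within `1 / (n + 2) ^ c` of the value of the
relaxation, at polynomial cost in `n`. -/
def SOSPolyTime (k : ℕ) : Prop :=
  ∀ c : ℕ, ∃ (p : Prog) (d : ℕ), ∀ (n : ℕ) (a : Quad n → ℚ),
    (∀ S, HeightLE ((n + 2) ^ c) (a S)) →
      ∃ (t : ℕ) (s : ℕ → ℤ), Run (inputOf a) p (fun _ => 0) t s ∧ t ≤ (n + 2) ^ d ∧ 0 < s 1 ∧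
        |(s 0 : ℝ) / (s 1 : ℝ) - Cliff.sos k (quartic fun S => (a S : ℝ))| ≤ 1 / ((n : ℝ) + 2) ^ c

end Majorana

namespace Majorana

namespace Cliff

variable {n : ℕ}

/-! ### Degrees -/

/-! Part (a) is compactness. A monomial of degree at most 2k is, up to sign, a product of two
unitary monomials of degree at most k, so Cauchy–Schwarz bounds its pseudomoment by 1. Moments of
higher degree can be set to zero without changing the value at h, and the functionals that remain
form a compact set (`isCompact_pseudoValues`). States are pseudoexpectations, hence Opt ≤ SOS.

The probabilistic parts all come from degree 6, since raising the degree only lowers the value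
(`sos_anti`). Let h = ∑ z_S χ^S and let h_i collect the terms with i ∈ S, so that ∑ h_i = 4h. Since
h_i = χ_i (χ_i h_i), where χ_i h_i has degree 3, Cauchy–Schwarz gives 8 φ(h) ≤ n s + s⁻¹ ∑ φ(h_i²)
for every s > 0. Sort the products χ^S χ^T in ∑ h_i² by |S ∩ T|: odd intersections anticommute and
drop out, S = T contributes 4 ∑ z_S², and intersections of size 2 give quartic monomials again, with
coefficients `pairCoef`. Their moments are controlled by a second, deterministic fact: the quartic
moments of a degree-6 pseudoexpectation have square sum at most n² (`sum_sq_moment_le`). It follows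
by taking the moments themselves as coefficients in the first inequality and by bounding ∑ φ(h_i²)
by 16 n ∑ z_S². The latter passes from the parts above one index to those above two and then three
indices, where distinct monomials are orthogonal. The outcome is a bound on SOS_6 that is polynomial
in the couplings (`eight_mul_sos_le`). Its Gaussian mean is estimated by pairing equal couplings and
yields E[SOS_6] ≤ (3/2) √n, whereas √(1 + √6) ≈ 1.857. The value is ℓ¹-Lipschitz in the
coefficients, so its variance is at most 1 (`variance_sos_sykH_le`), and Chebyshev's inequality
turns the gap into high probability.

For (b) the relaxation is the semidefinite program of maximising ∑ b_v y_v subject to M(y) ⪰ 0, with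
variables indexed by words of eight letters and a real matrix indexed by words of four. The
constraint is replaced by the penalty R min(0, λ_min M(y)). This is exact for R ≥ SOS_8(h): if M(y)
+ δ ⪰ 0, mixing with the trace gives a pseudoexpectation (`sum_mul_le_of_posSemidef`). Gradient
ascent on the penalised objective converges in polynomially many steps because an optimal point has
coordinates in [-1, 1] (`subgradient_converges`). A bottom eigenvector is replaced by the normalised
power B^q / tr B^q of B = C - s M(y) (`posSemidef_trace_ratio`), so that integer arithmetic
suffices, with divisions rounded. The output is the average of the penalised objective over the
steps. Running time is handled by a calculus of polynomial-time functions (`PT`, `PTF`) closed under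
arithmetic, branching, bounded sums and vector recursions. -/

theorem DegLE.mono_deg {a b : ℕ} {x : Cliff n} (hx : DegLE a x) (h : a ≤ b) : DegLE b x :=
  fun S hS => hx S (h.trans_lt hS)

theorem DegLE.add {a : ℕ} {x y : Cliff n} (hx : DegLE a x) (hy : DegLE a y) : DegLE a (x + y) :=
  fun S hS => by rw [add_apply, hx S hS, hy S hS, add_zero]

theorem DegLE.smul {a : ℕ} (c : ℂ) {x : Cliff n} (hx : DegLE a x) : DegLE a (c • x) :=
  fun S hS => by rw [smul_apply, hx S hS, mul_zero]

theorem DegLE.sum {ι : Type*} {a : ℕ} {s : Finset ι} {f : ι → Cliff n}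
    (hf : ∀ i ∈ s, DegLE a (f i)) : DegLE a (∑ i ∈ s, f i) := fun S hS => by
  rw [sum_apply]; exact Finset.sum_eq_zero fun i hi => hf i hi S hS

theorem DegLE.star {a : ℕ} {x : Cliff n} (hx : DegLE a x) : DegLE a (star x) := fun S hS => by
  rw [star_apply, hx S hS]; simp

theorem DegLE.mul {a b : ℕ} {x y : Cliff n} (hx : DegLE a x) (hy : DegLE b y) :
    DegLE (a + b) (x * y) := fun U hU => by
  rw [mul_apply]
  refine Finset.sum_eq_zero fun S _ => ?_
  by_cases h : a < S.card
  · rw [hx S h]; ring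
  · by_cases h' : b < (S ∆ U).card
    · rw [hy _ h']; ring
    · exfalso
      have h1 : U ⊆ S ∪ (S ∆ U) := by
        intro i hi
        simp only [Finset.mem_union, Finset.mem_symmDiff]
        tauto
      have := (Finset.card_le_card h1).trans (Finset.card_union_le _ _)
      omega

theorem DegLE.basisElt (S : Finset (Fin n)) : DegLE S.card (basisElt S) := fun T hT => by
  rw [basisElt_apply, if_neg]; rintro rfl; exact hT.false

theorem degLE_top (x : Cliff n) : DegLE n x := fun S hS => by
  have := S.card_le_univ
  rw [Fintype.card_fin] at this
  omega

/-! ### Basis elements and functionals -/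

theorem one_eq : (1 : Cliff n) = basisElt ∅ := rfl

theorem star_basisElt (S : Finset (Fin n)) :
    star (basisElt S : Cliff n) = sgn S S • basisElt S := by
  refine ext fun T => ?_
  rw [star_apply, smul_apply, basisElt_apply]
  by_cases h : T = S
  · subst h; simp
  · simp [h]

theorem star_basisElt_mul_self (S : Finset (Fin n)) :
    star (basisElt S : Cliff n) * basisElt S = 1 := by
  rw [star_basisElt, smul_mul_assoc, basisElt_mul, smul_smul, sgn_sq, symmDiff_self, one_smul]
  rfl

theorem sgn_eq_one_or (S T : Finset (Fin n)) : sgn S T = 1 ∨ sgn S T = -1 :=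
  mul_self_eq_one_iff.mp (sgn_sq S T)

theorem sgn_im (S T : Finset (Fin n)) : (sgn S T).im = 0 := by
  rcases sgn_eq_one_or S T with h | h <;> simp [h]

theorem norm_sgn (S T : Finset (Fin n)) : ‖sgn S T‖ = 1 := by
  rcases sgn_eq_one_or S T with h | h <;> simp [h]

theorem eq_sum_basisElt (x : Cliff n) : x = ∑ S : Finset (Fin n), x S • basisElt S := by
  conv_lhs => rw [eq_sum_mono x]
  simp only [mono_eq_basisElt]

theorem map_eq_sum (φ : Cliff n →ₗ[ℂ] ℂ) (x : Cliff n) :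
    φ x = ∑ S : Finset (Fin n), x S * φ (basisElt S) := by
  conv_lhs => rw [eq_sum_basisElt x]
  simp only [map_sum, map_smul, smul_eq_mul]

/-- The functional with prescribed values at the monomials. -/
noncomputable def ofCoef (m : Finset (Fin n) → ℂ) : Cliff n →ₗ[ℂ] ℂ where
  toFun x := ∑ S, x S * m S
  map_add' x y := by simp only [add_apply, add_mul, Finset.sum_add_distrib]
  map_smul' c x := by simp only [smul_apply, mul_assoc, Finset.mul_sum, RingHom.id_apply, smul_eq_mul]

theorem ofCoef_apply (m : Finset (Fin n) → ℂ) (x : Cliff n) : ofCoef m x = ∑ S, x S * m S := rfl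

theorem ofCoef_basisElt (m : Finset (Fin n) → ℂ) (S : Finset (Fin n)) :
    ofCoef m (basisElt S) = m S := by
  simp [ofCoef_apply, basisElt_apply]

/-! ### The semi-inner product of a pseudoexpectation -/

namespace IsPseudoexpectation

variable {k : ℕ} {φ : Cliff n →ₗ[ℂ] ℂ}

theorem re_nonneg (hφ : IsPseudoexpectation k φ) {g : Cliff n} (hg : DegLE k g) :
    0 ≤ (φ (star g * g)).re := (Complex.nonneg_iff.mp (hφ.nonneg g hg)).1

theorem re_map_star (hφ : IsPseudoexpectation k φ) (x : Cliff n) :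
    (φ (star x)).re = (φ x).re := by rw [hφ.map_star, Complex.conj_re]

/-- Positivity at a - b; the two cross terms are adjoint to each other and so have equal real parts.
-/
theorem two_re_le (hφ : IsPseudoexpectation k φ) {a b : Cliff n} (ha : DegLE k a)
    (hb : DegLE k b) :
    2 * (φ (star a * b)).re ≤ (φ (star a * a)).re + (φ (star b * b)).re := by
  have h := hφ.re_nonneg (ha.add (hb.smul (-1)))
  have e : star (b : Cliff n) * a = star (star a * b) := by rw [star_mul, star_star]
  have h1 : star (a + (-1 : ℂ) • b) * (a + (-1 : ℂ) • b)
      = star a * a + star b * b - (star a * b + star b * a) := by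
    rw [star_add, star_smul]
    simp only [neg_smul, one_smul, star_neg, star_one]
    noncomm_ring
  rw [h1, e] at h
  simp only [map_add, map_sub, Complex.add_re, Complex.sub_re, hφ.re_map_star] at h
  linarith

theorem two_re_le_scaled (hφ : IsPseudoexpectation k φ) {a b : Cliff n} (ha : DegLE k a)
    (hb : DegLE k b) {s : ℝ} (hs : 0 < s) :
    2 * (φ (star a * b)).re ≤ s * (φ (star a * a)).re + (φ (star b * b)).re / s := by
  have h := hφ.two_re_le (ha.smul (s : ℂ)) hb
  simp only [star_smul, smul_mul_assoc, mul_smul_comm, map_smul, smul_eq_mul,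
    Complex.star_def, Complex.conj_ofReal, Complex.re_ofReal_mul] at h
  have h2 : 2 * (φ (star a * b)).re * s
      ≤ (s * (φ (star a * a)).re + (φ (star b * b)).re / s) * s := by
    have : (φ (star b * b)).re / s * s = (φ (star b * b)).re := div_mul_cancel₀ _ hs.ne'
    rw [add_mul, this]
    linarith
  exact le_of_mul_le_mul_right h2 hs

theorem re_sum_le (hφ : IsPseudoexpectation k φ) {ι : Type*} (s : Finset ι) (f : ι → Cliff n)
    (hf : ∀ i ∈ s, DegLE k (f i)) :
    (φ (star (∑ i ∈ s, f i) * ∑ i ∈ s, f i)).re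
      ≤ s.card * ∑ i ∈ s, (φ (star (f i) * f i)).re := by
  have h : ∑ i ∈ s, ∑ j ∈ s, 2 * (φ (star (f i) * f j)).re
      ≤ ∑ i ∈ s, ∑ j ∈ s, ((φ (star (f i) * f i)).re + (φ (star (f j) * f j)).re) :=
    Finset.sum_le_sum fun i hi => Finset.sum_le_sum fun j hj =>
      hφ.two_re_le (hf i hi) (hf j hj)
  simp only [Finset.sum_add_distrib, Finset.sum_const, nsmul_eq_mul, ← Finset.mul_sum] at h
  rw [star_sum, Finset.sum_mul_sum, map_sum, Complex.re_sum]
  simp only [map_sum, Complex.re_sum]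
  linarith

/-- S splits into two sets of at most k elements. Their monomials are unitary, so Cauchy–Schwarz
bounds the moment of the product by 1. -/
theorem norm_map_basisElt_le (hφ : IsPseudoexpectation k φ) {S : Finset (Fin n)}
    (hS : S.card ≤ 2 * k) : ‖φ (basisElt S)‖ ≤ 1 := by
  obtain ⟨A, hA, hAc⟩ : ∃ A ⊆ S, A.card = min k S.card :=
    Finset.exists_subset_card_eq (min_le_right _ _)
  have hB : (S \ A).card ≤ k := by rw [Finset.card_sdiff_of_subset hA]; omega
  have hprod : (basisElt A * basisElt (S \ A) : Cliff n) = sgn A (S \ A) • basisElt S := by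
    rw [basisElt_mul]
    congr 2
    ext i
    have := @hA i
    simp only [Finset.mem_symmDiff, Finset.mem_sdiff]
    tauto
  set w := φ (star (basisElt A) * basisElt (S \ A)) with hw
  have hnorm : ‖w‖ = ‖φ (basisElt S)‖ := by
    rw [hw, star_basisElt, smul_mul_assoc, hprod, map_smul, map_smul, norm_smul, norm_smul,
      norm_sgn, norm_sgn, one_mul, one_mul]
  rw [← hnorm]
  by_cases h0 : w = 0
  · simp [h0]
  have hn : (‖w‖ : ℂ) ≠ 0 := by simpa using h0
  -- The phase conj w / |w| turns the cross moment w into |w|, so the real-part inequality bounds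
  -- the modulus.
  have h := hφ.two_re_le ((DegLE.basisElt A).mono_deg (by omega : A.card ≤ k))
    (((DegLE.basisElt (S \ A)).mono_deg hB).smul (conj w / ‖w‖))
  rw [star_smul, mul_smul_comm, smul_mul_smul_comm, star_basisElt_mul_self,
    star_basisElt_mul_self, map_smul, map_smul, ← hw, hφ.map_one] at h
  have e1 : conj w / (‖w‖ : ℂ) * w = (‖w‖ : ℂ) := by
    rw [div_mul_eq_mul_div, mul_comm, Complex.mul_conj, Complex.normSq_eq_norm_sq]
    push_cast
    field_simp
  have e2 : star (conj w / (‖w‖ : ℂ)) * (conj w / ‖w‖) = 1 := by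
    rw [Complex.star_def, map_div₀, Complex.conj_conj, Complex.conj_ofReal, div_mul_div_comm,
      Complex.mul_conj, Complex.normSq_eq_norm_sq]
    push_cast
    field_simp
  rw [smul_eq_mul, smul_eq_mul, e1, e2] at h
  simp only [Complex.ofReal_re, mul_one, Complex.one_re] at h
  linarith

/-- Pseudoexpectations only weaken when the degree drops. -/
theorem mono_deg (hφ : IsPseudoexpectation k φ) {j : ℕ} (h : j ≤ k) :
    IsPseudoexpectation j φ :=
  ⟨hφ.map_one, hφ.map_star, fun g hg => hφ.nonneg g (hg.mono_deg h)⟩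

end IsPseudoexpectation

theorem isState_iff {φ : Cliff n →ₗ[ℂ] ℂ} : IsState φ ↔ IsPseudoexpectation n φ :=
  ⟨fun h => ⟨h.map_one, h.map_star, fun g _ => h.nonneg g⟩,
    fun h => ⟨h.map_one, h.map_star, fun g => h.nonneg g (degLE_top g)⟩⟩

theorem IsState.isPseudoexpectation {φ : Cliff n →ₗ[ℂ] ℂ} (h : IsState φ) (k : ℕ) :
    IsPseudoexpectation k φ :=
  ⟨h.map_one, h.map_star, fun g _ => h.nonneg g⟩

/-! ### The normalised trace -/

/-- The normalised trace, the coefficient of `1`. -/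
noncomputable def tr : Cliff n →ₗ[ℂ] ℂ where
  toFun x := x ∅
  map_add' _ _ := rfl
  map_smul' _ _ := rfl

theorem tr_apply (x : Cliff n) : tr x = x ∅ := rfl

theorem tr_star (x : Cliff n) : tr (star x) = conj (tr x) := by
  rw [tr_apply, star_apply, sgn_empty_left, one_mul]; rfl

theorem tr_mul (x y : Cliff n) : tr (x * y) = ∑ S, sgn S S * (x S * y S) := by
  rw [tr_apply, mul_apply]
  refine Finset.sum_congr rfl fun S _ => ?_
  have : S ∆ ∅ = S := symmDiff_bot S
  rw [this]

theorem tr_mul_comm (x y : Cliff n) : tr (x * y) = tr (y * x) := by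
  simp only [tr_mul, mul_comm (x _)]

theorem tr_star_mul_self (x : Cliff n) : tr (star x * x) = ((∑ S, ‖x S‖ ^ 2 : ℝ) : ℂ) := by
  rw [tr_mul]
  push_cast
  refine Finset.sum_congr rfl fun S _ => ?_
  have h := sgn_sq S S
  rw [star_apply, ← Complex.conj_mul']
  linear_combination (conj (x S) * x S) * h

theorem isState_tr : IsState (tr : Cliff n →ₗ[ℂ] ℂ) where
  map_one := by simp [tr_apply, one_apply]
  map_star := tr_star
  nonneg g := by
    rw [tr_star_mul_self]
    exact_mod_cast Finset.sum_nonneg fun S _ => sq_nonneg ‖g S‖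

/-! ### Compactness -/

/-- Setting the values at monomials of degree above `2 * k` to zero. -/
theorem IsPseudoexpectation.truncate {k : ℕ} {φ : Cliff n →ₗ[ℂ] ℂ}
    (hφ : IsPseudoexpectation k φ) :
    IsPseudoexpectation k
      (ofCoef fun S => if S.card ≤ 2 * k then φ (basisElt S) else 0) := by
  have key : ∀ x : Cliff n, DegLE (2 * k) x →
      ofCoef (fun S => if S.card ≤ 2 * k then φ (basisElt S) else 0) x = φ x := by
    intro x hx
    rw [ofCoef_apply, map_eq_sum]
    refine Finset.sum_congr rfl fun S _ => ?_
    by_cases h : S.card ≤ 2 * k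
    · rw [if_pos h]
    · rw [if_neg h, hx S (by omega)]; ring
  refine ⟨?_, fun x => ?_, fun g hg => ?_⟩
  · rw [key, hφ.map_one]
    rw [one_eq]
    exact (DegLE.basisElt ∅).mono_deg (by simp)
  · rw [ofCoef_apply, ofCoef_apply, map_sum]
    refine Finset.sum_congr rfl fun S _ => ?_
    have h := hφ.map_star (basisElt S)
    rw [star_basisElt, map_smul, smul_eq_mul] at h
    split_ifs
    · rw [map_mul, ← h, star_apply]; ring
    · simp
  · rw [key]
    · exact hφ.nonneg g hg
    · rw [two_mul]; exact hg.star.mul hg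

theorem continuous_ofCoef (x : Cliff n) :
    Continuous fun m : Finset (Fin n) → ℂ => ofCoef m x := by
  simp only [ofCoef_apply]
  fun_prop

/-- Positivity says nothing about moments of degree above 2k, so the set of all pseudoexpectations
may be unbounded. Those that vanish there form a closed subset of the unit ball of coefficient
families, and truncation shows that they realise every value at h. -/
theorem isCompact_pseudoValues (k : ℕ) {h : Cliff n} (hh : DegLE (2 * k) h) :
    IsCompact (pseudoValues k h) := by
  set A : Set (Finset (Fin n) → ℂ) := {m | IsPseudoexpectation k (ofCoef m) ∧
    ∀ S : Finset (Fin n), 2 * k < S.card → m S = 0} with hA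
  have hA' : A = {m | ofCoef m 1 = 1} ∩ ((⋂ x, {m | ofCoef m (star x) = conj (ofCoef m x)}) ∩
      ((⋂ g, ⋂ (_ : DegLE k g), {m | 0 ≤ ofCoef m (star g * g)}) ∩
        ⋂ S : Finset (Fin n), ⋂ (_ : 2 * k < S.card), {m | m S = 0})) := by
    ext m
    simp only [hA, Set.mem_ofPred_eq, Set.mem_inter_iff, Set.mem_iInter]
    constructor
    · rintro ⟨h1, h2⟩
      exact ⟨h1.map_one, h1.map_star, h1.nonneg, h2⟩
    · rintro ⟨h1, h2, h3, h4⟩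
      exact ⟨⟨h1, h2, h3⟩, h4⟩
  have hclosed : IsClosed A := by
    rw [hA']
    refine (isClosed_eq (continuous_ofCoef 1) continuous_const).inter
      (IsClosed.inter (isClosed_iInter fun x => isClosed_eq (continuous_ofCoef _)
        (Complex.continuous_conj.comp (continuous_ofCoef _))) (IsClosed.inter
        (isClosed_iInter fun g => isClosed_iInter fun _ => ?_)
        (isClosed_iInter fun S => isClosed_iInter fun _ =>
          isClosed_eq (continuous_apply S) continuous_const)))
    exact isClosed_le continuous_const (continuous_ofCoef _)
  have hbdd : A ⊆ Metric.closedBall 0 1 := by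
    rintro m ⟨h1, h2⟩
    rw [mem_closedBall_zero_iff, pi_norm_le_iff_of_nonneg zero_le_one]
    intro S
    by_cases hS : 2 * k < S.card
    · rw [h2 S hS]; simp
    · have := h1.norm_map_basisElt_le (not_lt.mp hS)
      rwa [ofCoef_basisElt] at this
  have hcomp : IsCompact A := (isCompact_closedBall 0 1).of_isClosed_subset hclosed hbdd
  have himg : pseudoValues k h = (fun m => (ofCoef m h).re) '' A := by
    ext r
    constructor
    · rintro ⟨φ, hφ, rfl⟩
      refine ⟨_, ⟨hφ.truncate, fun S hS => if_neg (by omega)⟩, ?_⟩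
      change (ofCoef _ h).re = _
      congr 1
      rw [ofCoef_apply, map_eq_sum φ]
      refine Finset.sum_congr rfl fun S _ => ?_
      by_cases h' : S.card ≤ 2 * k
      · rw [if_pos h']
      · rw [if_neg h', hh S (by omega)]; ring
    · rintro ⟨m, hm, rfl⟩
      exact ⟨_, hm.1, rfl⟩
  rw [himg]
  exact hcomp.image (Complex.continuous_re.comp (continuous_ofCoef h))

theorem pseudoValues_nonempty (k : ℕ) (h : Cliff n) : (pseudoValues k h).Nonempty :=
  ⟨_, tr, isState_tr.isPseudoexpectation k, rfl⟩

theorem isGreatest_sos (k : ℕ) {h : Cliff n} (hh : DegLE (2 * k) h) :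
    IsGreatest (pseudoValues k h) (sos k h) :=
  (isCompact_pseudoValues k hh).isGreatest_sSup (pseudoValues_nonempty k h)

theorem stateValues_eq (h : Cliff n) : stateValues h = pseudoValues n h := by
  simp only [stateValues, pseudoValues, isState_iff]

theorem isGreatest_opt (h : Cliff n) : IsGreatest (stateValues h) (opt h) := by
  rw [opt, stateValues_eq]
  exact isGreatest_sos n ((degLE_top h).mono_deg (by omega))

theorem opt_le_sos (k : ℕ) {h : Cliff n} (hh : DegLE (2 * k) h) : opt h ≤ sos k h := by
  obtain ⟨φ, hφ, he⟩ := (isGreatest_opt h).1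
  exact (isGreatest_sos k hh).2 ⟨φ, hφ.isPseudoexpectation k, he⟩

theorem IsPseudoexpectation.re_le_sos {k : ℕ} {h : Cliff n} (hh : DegLE (2 * k) h)
    {φ : Cliff n →ₗ[ℂ] ℂ} (hφ : IsPseudoexpectation k φ) : (φ h).re ≤ sos k h :=
  (isGreatest_sos k hh).2 ⟨φ, hφ, rfl⟩

theorem sos_anti {j k : ℕ} (hjk : j ≤ k) {h : Cliff n} (hh : DegLE (2 * j) h) :
    sos k h ≤ sos j h := by
  obtain ⟨φ, hφ, he⟩ := (isGreatest_sos k (hh.mono_deg (by omega))).1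
  rw [← he]
  exact (hφ.mono_deg hjk).re_le_sos hh

end Cliff

open Cliff

/-! ### Quartic polynomials -/

theorem degLE_quartic {n : ℕ} (a : Quad n → ℝ) : DegLE 4 (quartic a) :=
  DegLE.sum fun S _ => DegLE.smul _ (by
    rw [mono_eq_basisElt]
    exact (DegLE.basisElt S.1).mono_deg S.2.le)

theorem re_map_quartic {n : ℕ} (φ : Cliff n →ₗ[ℂ] ℂ) (a : Quad n → ℝ) :
    (φ (quartic a)).re = ∑ S, a S * (φ (basisElt S.1)).re := by
  simp only [quartic, map_sum, map_smul, Complex.re_sum, smul_eq_mul, Complex.re_ofReal_mul,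
    mono_eq_basisElt]

/-- Each quartic moment is at most 1 in modulus, so the value is 1-Lipschitz for the ℓ¹ distance of
coefficients. Both the Gaussian concentration and the rounding of rational inputs rest on this. -/
theorem sos_quartic_le {n k : ℕ} (hk : 2 ≤ k) (a b : Quad n → ℝ) :
    sos k (quartic a) ≤ sos k (quartic b) + ∑ S, |a S - b S| := by
  obtain ⟨φ, hφ, he⟩ := (isGreatest_sos k ((degLE_quartic a).mono_deg (by omega))).1
  have hb := hφ.re_le_sos ((degLE_quartic b).mono_deg (by omega : 4 ≤ 2 * k))
  rw [re_map_quartic] at hb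
  rw [← he, re_map_quartic]
  have : ∑ S : Quad n, a S * (φ (basisElt S.1)).re ≤
      ∑ S : Quad n, (b S * (φ (basisElt S.1)).re + |a S - b S|) := by
    refine Finset.sum_le_sum fun S _ => ?_
    have h1 : |(φ (basisElt S.1)).re| ≤ 1 := (Complex.abs_re_le_norm _).trans
      (hφ.norm_map_basisElt_le (by rw [S.2]; omega))
    have h2 : (a S - b S) * (φ (basisElt S.1)).re ≤ |a S - b S| := by
      refine (le_abs_self _).trans ?_
      rw [abs_mul]
      exact mul_le_of_le_one_right (abs_nonneg _) h1
    linarith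
  rw [Finset.sum_add_distrib] at this
  linarith

theorem sos_quartic_nonneg {n k : ℕ} (hk : 2 ≤ k) (a : Quad n → ℝ) :
    0 ≤ sos k (quartic a) := by
  have h := (isState_tr.isPseudoexpectation k).re_le_sos
    ((degLE_quartic a).mono_deg (by omega : 4 ≤ 2 * k))
  rw [re_map_quartic] at h
  refine le_trans (le_of_eq ?_) h
  symm
  refine Finset.sum_eq_zero fun S _ => ?_
  have : (∅ : Finset (Fin n)) ≠ S.1 := by
    intro h
    have := S.2
    rw [← h] at this
    simp at this
  rw [tr_apply, basisElt_apply, if_neg this]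
  simp

theorem sos_quartic_le_sum {n k : ℕ} (hk : 2 ≤ k) (a : Quad n → ℝ) :
    sos k (quartic a) ≤ ∑ S, |a S| := by
  obtain ⟨φ, hφ, he⟩ := (isGreatest_sos k ((degLE_quartic a).mono_deg (by omega))).1
  rw [← he, re_map_quartic]
  refine Finset.sum_le_sum fun S _ => (le_abs_self _).trans ?_
  rw [abs_mul]
  exact mul_le_of_le_one_right (abs_nonneg _) ((Complex.abs_re_le_norm _).trans
    (hφ.norm_map_basisElt_le (by rw [S.2]; omega)))

end Majorana

namespace Majorana

namespace Cliff

variable {n : ℕ}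

/-! ### Commutation signs -/

/-- A pair (i, j) with i ≠ j gives -1 in exactly one of the two orders, a pair with i = j in
neither. The exponent is therefore |S||T| - |S ∩ T| modulo 2. -/
theorem sgn_mul_sgn_swap (S T : Finset (Fin n)) :
    sgn S T * sgn T S = (-1) ^ (S.card * T.card + (S ∩ T).card) := by
  have h1 : sgn T S = ∏ i ∈ S, ∏ j ∈ T, if i < j then (-1 : ℂ) else 1 := by
    unfold sgn; rw [Finset.prod_comm]
  have h2 : ∀ i, ∏ j ∈ T, (if i = j then (-1 : ℂ) else 1) = if i ∈ T then -1 else 1 := by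
    intro i; rw [Finset.prod_ite_eq]
  have h3 : ∏ i ∈ S, (if i ∈ T then (-1 : ℂ) else 1) = (-1) ^ (S ∩ T).card := by
    rw [Finset.prod_ite, Finset.prod_const, Finset.prod_const_one, mul_one,
      Finset.filter_mem_eq_inter]
  have h4 : ∏ _i ∈ S, ∏ _j ∈ T, (-1 : ℂ) = (-1) ^ (S.card * T.card) := by
    simp only [Finset.prod_const, ← pow_mul]
    rw [mul_comm]
  rw [h1, pow_add, ← h3, ← h4]
  unfold sgn
  rw [← Finset.prod_mul_distrib, ← Finset.prod_mul_distrib]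
  refine Finset.prod_congr rfl fun i _ => ?_
  rw [← h2, ← Finset.prod_mul_distrib, ← Finset.prod_mul_distrib]
  refine Finset.prod_congr rfl fun j _ => ?_
  rcases lt_trichotomy i j with h | h | h
  · simp [h, h.not_gt, h.ne]
  · simp [h]
  · simp [h, h.not_gt, h.ne']

theorem sgn_self (S : Finset (Fin n)) : sgn S S = (-1) ^ (S.card.choose 2) := by
  induction S using Finset.induction_on with
  | empty => simp [sgn]
  | insert a s ha ih =>
    have h : insert a s = {a} ∆ s := by
      ext j
      simp only [Finset.mem_symmDiff, Finset.mem_singleton, Finset.mem_insert]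
      by_cases hj : j = a
      · subst hj; simp [ha]
      · simp [hj]
    have h1 := sgn_mul_sgn_swap {a} s
    have h2 : ({a} : Finset (Fin n)) ∩ s = ∅ :=
      Finset.singleton_inter_of_notMem ha
    have h3 : sgn ({a} : Finset (Fin n)) {a} = 1 := by simp [sgn]
    rw [h2, Finset.card_singleton, Finset.card_empty, one_mul, add_zero] at h1
    rw [Finset.card_insert_of_notMem ha, Nat.choose_succ_succ' s.card 1, Nat.choose_one_right,
      pow_add, ← ih, ← h1, h]
    simp only [sgn_symmDiff_left, sgn_symmDiff_right, h3]
    ring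

theorem sgn_self_quad (S : Quad n) : sgn S.1 S.1 = 1 := by
  rw [sgn_self, S.2, Nat.choose_two_right, Even.neg_one_pow]
  decide

theorem star_basisElt_quad (S : Quad n) : star (basisElt S.1 : Cliff n) = basisElt S.1 := by
  rw [star_basisElt, sgn_self_quad, one_smul]

theorem basisElt_mul_star_self (S : Finset (Fin n)) :
    (basisElt S : Cliff n) * star (basisElt S) = 1 := by
  rw [star_basisElt, mul_smul_comm, ← smul_mul_assoc, ← star_basisElt, star_basisElt_mul_self]

theorem star_quartic (a : Quad n → ℝ) : star (quartic a) = quartic a := by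
  simp only [quartic, star_sum, star_smul, mono_eq_basisElt, star_basisElt_quad, Complex.star_def,
    Complex.conj_ofReal]

theorem quartic_smul (c : ℝ) (a : Quad n → ℝ) : quartic (c • a) = (c : ℂ) • quartic a := by
  simp only [quartic, Finset.smul_sum, smul_smul, Pi.smul_apply, smul_eq_mul, Complex.ofReal_mul]

/-! ### Second moments of quartic polynomials under a pseudoexpectation -/

section Quartic

variable {φ : Cliff n →ₗ[ℂ] ℂ}

/-- The real part of the correlation of two quartic monomials. -/
noncomputable def corr (φ : Cliff n →ₗ[ℂ] ℂ) (S T : Quad n) : ℝ :=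
  (φ (basisElt S.1 * basisElt T.1)).re

/-- The coefficients of the monomials that contain `P`. -/
def above (P : Finset (Fin n)) (z : Quad n → ℝ) (S : Quad n) : ℝ := if P ⊆ S.1 then z S else 0

/-- The second moment of the part of the quartic polynomial above `P`. -/
noncomputable def massAbove (φ : Cliff n →ₗ[ℂ] ℂ) (z : Quad n → ℝ) (P : Finset (Fin n)) : ℝ :=
  ∑ S, ∑ T, above P z S * above P z T * corr φ S T

theorem corr_self (h1 : φ 1 = 1) (S : Quad n) : corr φ S S = 1 := by
  rw [corr]
  conv_lhs => rw [← star_basisElt_quad S, star_basisElt_quad S, ← star_basisElt_quad S]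
  have := star_basisElt_mul_self S.1
  rw [star_basisElt_quad] at this ⊢
  rw [this, h1, Complex.one_re]

/-- Even monomials with an odd number of common indices anticommute, so their product is
skew-adjoint and its moment is purely imaginary. -/
theorem corr_eq_zero {k : ℕ} (hφ : IsPseudoexpectation k φ) {S T : Quad n}
    (h : Odd (S.1 ∩ T.1).card) : corr φ S T = 0 := by
  have h1 : star (basisElt S.1 * basisElt T.1 : Cliff n) = -(basisElt S.1 * basisElt T.1) := by
    rw [star_mul, star_basisElt_quad, star_basisElt_quad, basisElt_mul, basisElt_mul,
      symmDiff_comm, ← neg_smul]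
    congr 1
    have h2 := sgn_mul_sgn_swap S.1 T.1
    rw [S.2, T.2, pow_add, h.neg_one_pow, Even.neg_one_pow (by decide)] at h2
    have h3 := sgn_sq S.1 T.1
    linear_combination (sgn S.1 T.1) * h2 - (sgn T.1 S.1) * h3
  have h2 := hφ.re_map_star (basisElt S.1 * basisElt T.1)
  rw [h1, map_neg, Complex.neg_re] at h2
  rw [corr]
  linarith

theorem corr_eq (φ : Cliff n →ₗ[ℂ] ℂ) (S T : Quad n) :
    corr φ S T = (sgn S.1 T.1).re * (φ (basisElt (S.1 ∆ T.1))).re := by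
  rw [corr, basisElt_mul, map_smul, smul_eq_mul, Complex.mul_re, sgn_im, zero_mul, sub_zero]

/-- Multiplication by a unitary monomial leaves the second moment unchanged, while for a polynomial
above P it lowers the degree from 4 to 4 - |P|. This is how second moments of quartics become
accessible to degree-6 positivity. -/
theorem re_star_mul_quartic (φ : Cliff n →ₗ[ℂ] ℂ) (P : Finset (Fin n)) (w : Quad n → ℝ) :
    (φ (star (star (basisElt P) * quartic w) * (star (basisElt P) * quartic w))).re
      = ∑ S, ∑ T, w S * w T * corr φ S T := by
  have h : star (star (basisElt P) * quartic w) * (star (basisElt P) * quartic w)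
      = quartic w * quartic w := by
    rw [star_mul, star_star, star_quartic, mul_assoc, ← mul_assoc (basisElt P),
      basisElt_mul_star_self, one_mul]
  rw [h]
  unfold quartic corr
  rw [Finset.sum_mul_sum, map_sum, Complex.re_sum]
  refine Finset.sum_congr rfl fun S _ => ?_
  rw [map_sum, Complex.re_sum]
  refine Finset.sum_congr rfl fun T _ => ?_
  rw [mono_eq_basisElt, mono_eq_basisElt, smul_mul_smul_comm, map_smul, smul_eq_mul,
    ← Complex.ofReal_mul, Complex.re_ofReal_mul]

theorem degLE_star_mul_quartic (P : Finset (Fin n)) {w : Quad n → ℝ}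
    (hw : ∀ S, ¬P ⊆ S.1 → w S = 0) : DegLE (4 - P.card) (star (basisElt P) * quartic w) := by
  unfold quartic
  rw [Finset.mul_sum]
  refine DegLE.sum fun S _ => ?_
  by_cases h : P ⊆ S.1
  · rw [mul_smul_comm, star_basisElt, smul_mul_assoc, mono_eq_basisElt, basisElt_mul]
    refine DegLE.smul _ (DegLE.smul _ (DegLE.smul _ ?_))
    have hc : (P ∆ S.1).card = 4 - P.card := by
      have : P ∆ S.1 = S.1 \ P := by
        ext i
        have := @h i
        simp only [Finset.mem_symmDiff, Finset.mem_sdiff]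
        tauto
      rw [this, Finset.card_sdiff_of_subset h, S.2]
    rw [← hc]
    exact DegLE.basisElt _
  · rw [hw S h]
    intro T _
    simp [zero_apply]

theorem above_of_not_subset {P : Finset (Fin n)} {z : Quad n → ℝ} (S : Quad n)
    (h : ¬P ⊆ S.1) : above P z S = 0 := if_neg h

/-- Four times the value of a quartic polynomial, bounded through its derivatives. -/
theorem eight_mul_sum_le (hφ : IsPseudoexpectation 3 φ) (z : Quad n → ℝ) {s : ℝ} (hs : 0 < s) :
    8 * ∑ S, z S * (φ (basisElt S.1)).re ≤ n * s + (∑ i, massAbove φ z {i}) / s := by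
  -- Cauchy–Schwarz for χ_i and χ_i h_i, of degrees at most 1 and 3, where h_i is the part above i.
  have h1 : ∀ i : Fin n, 2 * ∑ S, above {i} z S * (φ (basisElt S.1)).re
      ≤ s + massAbove φ z {i} / s := by
    intro i
    have ha : DegLE 3 (star (basisElt {i}) : Cliff n) :=
      ((DegLE.basisElt {i}).mono_deg (by simp)).star
    have hb : DegLE 3 (star (basisElt {i}) * quartic (above {i} z)) :=
      (degLE_star_mul_quartic {i} fun S hS => above_of_not_subset S hS).mono_deg (by simp)
    have h := hφ.two_re_le_scaled ha hb hs
    rw [re_star_mul_quartic, star_star, ← mul_assoc, basisElt_mul_star_self, one_mul,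
      hφ.map_one, re_map_quartic, Complex.one_re, mul_one] at h
    exact h
  have h2 := Finset.sum_le_sum fun i (_ : i ∈ Finset.univ) => h1 i
  rw [Finset.sum_add_distrib, ← Finset.mul_sum, ← Finset.sum_div, Finset.sum_comm] at h2
  -- A quadruple has four indices, so the parts h_i add up to four times the polynomial; together
  -- with the 2 in front this gives the factor 8.
  have h3 : ∀ S : Quad n, ∑ i, above {i} z S * (φ (basisElt S.1)).re
      = 4 * (z S * (φ (basisElt S.1)).re) := by
    intro S
    rw [← Finset.sum_mul]
    simp only [above, Finset.singleton_subset_iff]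
    rw [Finset.sum_ite_mem, Finset.univ_inter, Finset.sum_const, S.2]
    simp only [nsmul_eq_mul]
    push_cast
    ring
  simp only [h3, ← Finset.mul_sum, Finset.sum_const, Finset.card_univ, Fintype.card_fin,
    nsmul_eq_mul] at h2
  linarith

theorem above_mul_above (P : Finset (Fin n)) (z : Quad n → ℝ) (S T : Quad n) :
    above P z S * above P z T = if P ⊆ S.1 ∩ T.1 then z S * z T else 0 := by
  unfold above
  by_cases h1 : P ⊆ S.1 <;> by_cases h2 : P ⊆ T.1 <;> simp [h1, h2, Finset.subset_inter_iff]

theorem sum_massAbove_singleton (φ : Cliff n →ₗ[ℂ] ℂ) (z : Quad n → ℝ) :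
    ∑ i, massAbove φ z {i}
      = ∑ S, ∑ T, ((S.1 ∩ T.1).card : ℝ) * (z S * z T * corr φ S T) := by
  unfold massAbove
  rw [Finset.sum_comm]
  refine Finset.sum_congr rfl fun S _ => ?_
  rw [Finset.sum_comm]
  refine Finset.sum_congr rfl fun T _ => ?_
  rw [← Finset.sum_mul]
  simp only [above_mul_above, Finset.singleton_subset_iff]
  rw [Finset.sum_ite_mem, Finset.univ_inter, Finset.sum_const, nsmul_eq_mul]
  ring

theorem sum_massAbove_pair (φ : Cliff n →ₗ[ℂ] ℂ) (z : Quad n → ℝ) :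
    ∑ p ∈ (Finset.univ : Finset (Fin n)).offDiag, massAbove φ z {p.1, p.2}
      = ∑ S, ∑ T, (((S.1 ∩ T.1).card : ℝ) * (S.1 ∩ T.1).card - (S.1 ∩ T.1).card)
          * (z S * z T * corr φ S T) := by
  unfold massAbove
  rw [Finset.sum_comm]
  refine Finset.sum_congr rfl fun S _ => ?_
  rw [Finset.sum_comm]
  refine Finset.sum_congr rfl fun T _ => ?_
  rw [← Finset.sum_mul]
  simp only [above_mul_above]
  rw [← Finset.sum_filter, Finset.sum_const]
  have : (Finset.univ : Finset (Fin n)).offDiag.filter (fun p => {p.1, p.2} ⊆ S.1 ∩ T.1)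
      = (S.1 ∩ T.1).offDiag := by
    ext p
    simp only [Finset.mem_filter, Finset.mem_offDiag, Finset.mem_univ, true_and,
      Finset.insert_subset_iff, Finset.singleton_subset_iff]
    tauto
  rw [this, Finset.offDiag_card, nsmul_eq_mul, Nat.cast_sub (Nat.le_mul_self _)]
  push_cast
  ring

theorem card_inter_quad_le (S T : Quad n) : (S.1 ∩ T.1).card ≤ 4 :=
  (Finset.card_le_card Finset.inter_subset_left).trans S.2.le

theorem eq_of_card_inter_quad {S T : Quad n} (h : (S.1 ∩ T.1).card = 4) : S = T := by
  have h1 : S.1 ∩ T.1 = S.1 :=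
    Finset.eq_of_subset_of_card_le Finset.inter_subset_left (by rw [S.2, h])
  have h2 : S.1 ∩ T.1 = T.1 :=
    Finset.eq_of_subset_of_card_le Finset.inter_subset_right (by rw [T.2, h])
  exact Subtype.ext (h1.symm.trans h2)

/-- Termwise comparison of t with t (t - 1) for t = |S ∩ T|. They agree for t = 0 and t = 2, odd t
has zero correlation, and t = 4 forces S = T, where the correlation is 1 and the coefficient is a
square. -/
theorem sum_massAbove_singleton_le {k : ℕ} (hφ : IsPseudoexpectation k φ) (z : Quad n → ℝ) :
    ∑ i, massAbove φ z {i}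
      ≤ ∑ p ∈ (Finset.univ : Finset (Fin n)).offDiag, massAbove φ z {p.1, p.2} := by
  rw [sum_massAbove_singleton, sum_massAbove_pair]
  refine Finset.sum_le_sum fun S _ => Finset.sum_le_sum fun T _ => ?_
  have hle := card_inter_quad_le S T
  by_cases ho : Odd (S.1 ∩ T.1).card
  · rw [corr_eq_zero hφ ho]; simp
  by_cases h4 : (S.1 ∩ T.1).card = 4
  · have := eq_of_card_inter_quad h4
    subst this
    rw [corr_self hφ.map_one, h4]
    push_cast
    nlinarith [mul_self_nonneg (z S)]
  · have h02 : (S.1 ∩ T.1).card = 0 ∨ (S.1 ∩ T.1).card = 2 := by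
      rw [Nat.not_odd_iff_even] at ho
      rcases ho with ⟨m, hm⟩
      omega
    rcases h02 with h | h <;> rw [h] <;> norm_num

/-- Monomials that share three indices are orthogonal or equal. -/
theorem massAbove_triple {k : ℕ} (hφ : IsPseudoexpectation k φ) (z : Quad n → ℝ)
    {P : Finset (Fin n)} (hP : P.card = 3) :
    massAbove φ z P = ∑ S, if P ⊆ S.1 then z S ^ 2 else 0 := by
  unfold massAbove
  refine Finset.sum_congr rfl fun S _ => ?_
  rw [Finset.sum_eq_single S]
  · rw [above_mul_above, corr_self hφ.map_one, Finset.inter_self, sq]; simp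
  · intro T _ hT
    rw [above_mul_above]
    split_ifs with h
    · have h3 := Finset.card_le_card h
      have h4 := card_inter_quad_le S T
      have h5 : (S.1 ∩ T.1).card ≠ 4 := fun h => hT (eq_of_card_inter_quad h).symm
      rw [corr_eq_zero hφ, mul_zero]
      rw [show (S.1 ∩ T.1).card = 3 by omega]
      decide
    · simp
  · simp

/-- A quadruple above the pair P has two further indices, so twice the part above P is the sum of
the parts above P ∪ {x}. Cauchy–Schwarz over at most n values of x gives the factor n, and 4 = 2².
-/
theorem four_mul_massAbove_pair_le (hφ : IsPseudoexpectation 3 φ) (z : Quad n → ℝ)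
    {P : Finset (Fin n)} (hP : P.card = 2) :
    4 * massAbove φ z P ≤ n * ∑ x ∈ Pᶜ, massAbove φ z (insert x P) := by
  have hsum : ((2 : ℝ) : ℂ) • (star (basisElt P) * quartic (above P z) : Cliff n)
      = ∑ x ∈ Pᶜ, star (basisElt P) * quartic (above (insert x P) z) := by
    rw [← Finset.mul_sum, ← mul_smul_comm, ← quartic_smul]
    congr 1
    unfold quartic
    rw [Finset.sum_comm]
    refine Finset.sum_congr rfl fun S _ => ?_
    rw [← Finset.sum_smul, ← Complex.ofReal_sum]
    congr 2
    simp only [Pi.smul_apply, smul_eq_mul, above, Finset.insert_subset_iff]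
    by_cases h : P ⊆ S.1
    · simp only [h, and_true, if_true]
      rw [← Finset.sum_filter, Finset.sum_const]
      have : Pᶜ.filter (fun x => x ∈ S.1) = S.1 \ P := by
        ext x
        simp only [Finset.mem_filter, Finset.mem_compl, Finset.mem_sdiff]
        tauto
      rw [this, Finset.card_sdiff_of_subset h, S.2, hP]
      norm_num
    · simp [h]
  have h := hφ.re_sum_le Pᶜ (fun x => star (basisElt P) * quartic (above (insert x P) z))
    fun x _ => (degLE_star_mul_quartic P fun S hS => above_of_not_subset S fun h' =>
      hS ((Finset.subset_insert x P).trans h')).mono_deg (by omega)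
  rw [← hsum, star_smul, smul_mul_smul_comm] at h
  simp only [Complex.star_def, Complex.conj_ofReal, ← Complex.ofReal_mul, map_smul, smul_eq_mul,
    Complex.re_ofReal_mul, re_star_mul_quartic] at h
  have hcard : (Pᶜ.card : ℝ) ≤ n := by
    have := Pᶜ.card_le_univ
    rw [Fintype.card_fin] at this
    exact_mod_cast this
  have hnn : 0 ≤ ∑ x ∈ Pᶜ, massAbove φ z (insert x P) := by
    refine Finset.sum_nonneg fun x hx => ?_
    rw [massAbove_triple hφ z (by
      rw [Finset.card_insert_of_notMem (Finset.mem_compl.mp hx), hP])]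
    refine Finset.sum_nonneg fun S _ => ?_
    split_ifs
    · exact sq_nonneg _
    · exact le_rfl
  have h5 := mul_le_mul_of_nonneg_right hcard hnn
  unfold massAbove at h5 ⊢
  linarith

/-- Descends from single indices through pairs to triples, above which the second moments are
diagonal. The constant is 64 / 4. -/
theorem sum_massAbove_le (hφ : IsPseudoexpectation 3 φ) (z : Quad n → ℝ) :
    ∑ i, massAbove φ z {i} ≤ 16 * n * ∑ S, z S ^ 2 := by
  have h1 := sum_massAbove_singleton_le hφ z
  have h2 : 4 * ∑ p ∈ (Finset.univ : Finset (Fin n)).offDiag, massAbove φ z {p.1, p.2}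
      ≤ n * ∑ p ∈ (Finset.univ : Finset (Fin n)).offDiag,
        ∑ x : Fin n, ∑ S : Quad n, if {x, p.1, p.2} ⊆ S.1 then z S ^ 2 else 0 := by
    rw [Finset.mul_sum, Finset.mul_sum]
    refine Finset.sum_le_sum fun p hp => ?_
    have hne : p.1 ≠ p.2 := (Finset.mem_offDiag.mp hp).2.2
    have hc : ({p.1, p.2} : Finset (Fin n)).card = 2 := Finset.card_pair hne
    refine (four_mul_massAbove_pair_le hφ z hc).trans
      (mul_le_mul_of_nonneg_left ?_ (Nat.cast_nonneg n))
    have : ∀ x ∈ ({p.1, p.2} : Finset (Fin n))ᶜ, massAbove φ z (insert x {p.1, p.2})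
        = ∑ S : Quad n, if {x, p.1, p.2} ⊆ S.1 then z S ^ 2 else 0 := fun x hx =>
      massAbove_triple hφ z (by rw [Finset.card_insert_of_notMem (Finset.mem_compl.mp hx), hc])
    rw [Finset.sum_congr rfl this]
    refine Finset.sum_le_sum_of_subset_of_nonneg (Finset.subset_univ _) fun x _ _ =>
      Finset.sum_nonneg fun S _ => ?_
    split_ifs
    · exact sq_nonneg _
    · exact le_rfl
  -- Dropping the requirement that the three indices be distinct leaves 4³ = 64 choices of (x, p)
  -- within each S.
  have h3 : ∑ p ∈ (Finset.univ : Finset (Fin n)).offDiag,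
        ∑ x : Fin n, ∑ S : Quad n, (if {x, p.1, p.2} ⊆ S.1 then z S ^ 2 else 0)
      ≤ ∑ S : Quad n, 64 * z S ^ 2 := by
    have h4 : ∑ p ∈ (Finset.univ : Finset (Fin n)).offDiag,
        ∑ x : Fin n, ∑ S : Quad n, (if {x, p.1, p.2} ⊆ S.1 then z S ^ 2 else 0)
        ≤ ∑ p ∈ (Finset.univ : Finset (Fin n × Fin n)),
        ∑ x : Fin n, ∑ S : Quad n, (if {x, p.1, p.2} ⊆ S.1 then z S ^ 2 else 0) :=
      Finset.sum_le_sum_of_subset_of_nonneg (Finset.subset_univ _) fun p _ _ =>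
        Finset.sum_nonneg fun x _ => Finset.sum_nonneg fun S _ => by
          split_ifs
          · exact sq_nonneg _
          · exact le_rfl
    refine h4.trans (le_of_eq ?_)
    have h5 : ∀ p : Fin n × Fin n, ∑ x : Fin n, ∑ S : Quad n,
        (if {x, p.1, p.2} ⊆ S.1 then z S ^ 2 else 0)
        = ∑ S : Quad n, ∑ x : Fin n, (if {x, p.1, p.2} ⊆ S.1 then z S ^ 2 else 0) :=
      fun p => Finset.sum_comm
    simp only [h5]
    rw [Finset.sum_comm]
    refine Finset.sum_congr rfl fun S _ => ?_
    rw [Fintype.sum_prod_type]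
    simp only [Finset.insert_subset_iff, Finset.singleton_subset_iff, ite_and,
      Finset.sum_ite_mem, Finset.univ_inter, Finset.sum_const, S.2, nsmul_eq_mul]
    have h6 : ∀ a : Prop, [Decidable a] → ∀ r : ℝ,
        (4 : ℕ) * (if a then r else 0) = if a then 4 * r else 0 := by
      intro a _ r; split_ifs <;> simp
    simp only [h6]
    rw [Finset.sum_comm]
    simp only [Finset.sum_ite_mem, Finset.univ_inter, Finset.sum_const, S.2, nsmul_eq_mul,
      ← Finset.mul_sum]
    push_cast
    ring
  rw [← Finset.mul_sum] at h3
  have h4 := mul_le_mul_of_nonneg_left h3 (Nat.cast_nonneg (α := ℝ) n)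
  linarith

/-- The quartic moments of a degree-6 pseudoexpectation have square sum at most `n ^ 2`. -/
theorem sum_sq_moment_le (hφ : IsPseudoexpectation 3 φ) :
    ∑ S : Quad n, (φ (basisElt S.1)).re ^ 2 ≤ (n : ℝ) ^ 2 := by
  rcases Nat.eq_zero_or_pos n with h0 | h0
  · subst h0
    have : IsEmpty (Quad 0) := ⟨fun S => by
      have := S.1.card_le_univ
      rw [S.2, Fintype.card_fin] at this
      omega⟩
    simp
  have hn : (0 : ℝ) < n := by exact_mod_cast h0
  -- With the moments as coefficients the left side is 8M, where M is their square sum. The choice s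
  -- = 4n makes the last term at most 4M, so 8M ≤ 4n² + 4M.
  have h1 := eight_mul_sum_le hφ (fun S => (φ (basisElt S.1)).re) (s := 4 * n) (by positivity)
  have h2 := sum_massAbove_le hφ (fun S => (φ (basisElt S.1)).re)
  set A := ∑ i, massAbove φ (fun S => (φ (basisElt S.1)).re) {i}
  have h3 : A / (4 * n) ≤ 4 * ∑ S : Quad n, (φ (basisElt S.1)).re ^ 2 := by
    rw [div_le_iff₀ (by positivity)]
    linarith
  simp only [← sq] at h1
  nlinarith

/-- The coefficient at the monomial of `D` of twice the sum of all `z_S z_T χ^S χ^T` with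
`|S ∩ T| = 2`. -/
noncomputable def pairCoef (z : Quad n → ℝ) (D : Quad n) : ℝ :=
  ∑ p : Quad n × Quad n, if (p.1.1 ∩ p.2.1).card = 2 ∧ p.1.1 ∆ p.2.1 = D.1 then
    2 * (sgn p.1.1 p.2.1).re * (z p.1 * z p.2) else 0

theorem card_symmDiff_quad {S T : Quad n} (h : (S.1 ∩ T.1).card = 2) :
    (S.1 ∆ T.1).card = 4 := by
  have h1 : S.1 ∆ T.1 = (S.1 \ T.1) ∪ (T.1 \ S.1) := rfl
  rw [h1, Finset.card_union_of_disjoint disjoint_sdiff_sdiff]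
  have h2 := Finset.card_sdiff_add_card_inter S.1 T.1
  have h3 := Finset.card_sdiff_add_card_inter T.1 S.1
  rw [Finset.inter_comm] at h3
  rw [S.2] at h2
  rw [T.2] at h3
  omega

/-- Only |S ∩ T| = 4, the diagonal, and |S ∩ T| = 2 survive. In the second case S ∆ T is again a
quadruple, so just quartic moments occur, and these have bounded square sum. -/
theorem sum_massAbove_eq {k : ℕ} (hφ : IsPseudoexpectation k φ) (z : Quad n → ℝ) :
    ∑ i, massAbove φ z {i}
      = 4 * ∑ S, z S ^ 2 + ∑ D : Quad n, pairCoef z D * (φ (basisElt D.1)).re := by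
  have h1 : ∀ S T : Quad n, ((S.1 ∩ T.1).card : ℝ) * (z S * z T * corr φ S T)
      = (if S = T then 4 * z S ^ 2 else 0) + ∑ D : Quad n,
        (if (S.1 ∩ T.1).card = 2 ∧ S.1 ∆ T.1 = D.1 then
          2 * (sgn S.1 T.1).re * (z S * z T) else 0) * (φ (basisElt D.1)).re := by
    intro S T
    by_cases h2 : (S.1 ∩ T.1).card = 2
    · have hne : S ≠ T := by
        rintro rfl
        rw [Finset.inter_self, S.2] at h2
        omega
      rw [if_neg hne, zero_add, Finset.sum_eq_single ⟨S.1 ∆ T.1, card_symmDiff_quad h2⟩]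
      · rw [if_pos ⟨h2, rfl⟩, corr_eq, h2]
        push_cast
        ring
      · intro D _ hD
        rw [if_neg, zero_mul]
        rintro ⟨_, h⟩
        exact hD (Subtype.ext h.symm)
      · simp
    · simp only [h2, false_and, if_false, zero_mul, Finset.sum_const_zero, add_zero]
      split_ifs with h
      · subst h
        rw [corr_self hφ.map_one, Finset.inter_self, S.2]
        push_cast
        ring
      · by_cases ho : Odd (S.1 ∩ T.1).card
        · rw [corr_eq_zero hφ ho]; ring
        · have h4 : (S.1 ∩ T.1).card ≠ 4 := fun h' => h (eq_of_card_inter_quad h')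
          have h5 := card_inter_quad_le S T
          have h0 : (S.1 ∩ T.1).card = 0 := by
            rw [Nat.not_odd_iff_even] at ho
            rcases ho with ⟨m, hm⟩
            omega
          rw [h0]; simp
  rw [sum_massAbove_singleton]
  simp only [h1, Finset.sum_add_distrib, Finset.sum_ite_eq, Finset.mem_univ, if_true,
    ← Finset.mul_sum]
  congr 1
  unfold pairCoef
  simp only [Finset.sum_mul, Fintype.sum_prod_type]
  rw [Finset.sum_comm' (t' := Finset.univ) (s' := fun _ => Finset.univ) (by simp)]
  conv_rhs => rw [Finset.sum_comm]
  rw [Finset.sum_comm]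
  exact Finset.sum_congr rfl fun S _ => Finset.sum_comm

/-- A bound on the degree-6 relaxation that is polynomial in the coefficients. -/
theorem eight_mul_sos_le (z : Quad n → ℝ) {s l : ℝ} (hs : 0 < s) (hl : 0 < l) :
    8 * sos 3 (quartic z) ≤ n * s
      + (4 * ∑ S, z S ^ 2 + (l * ∑ D, pairCoef z D ^ 2 + (n : ℝ) ^ 2 / l) / 2) / s := by
  obtain ⟨φ, hφ, he⟩ := (isGreatest_sos 3 ((degLE_quartic z).mono_deg (by omega))).1
  rw [← he, re_map_quartic]
  refine (eight_mul_sum_le hφ z hs).trans ?_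
  rw [sum_massAbove_eq hφ]
  -- Young's inequality with weight l separates the coefficients, which will be random, from the
  -- moments, which depend on the unknown maximiser but have square sum at most n².
  have h1 : ∑ D : Quad n, pairCoef z D * (φ (basisElt D.1)).re
      ≤ ∑ D : Quad n, (l * pairCoef z D ^ 2 + (φ (basisElt D.1)).re ^ 2 / l) / 2 := by
    refine Finset.sum_le_sum fun D _ => ?_
    set x := pairCoef z D
    set y := (φ (basisElt D.1)).re
    have h := div_nonneg (sq_nonneg (l * x - y)) hl.le
    have e : (l * x - y) ^ 2 / l = l * x ^ 2 + y ^ 2 / l - 2 * (x * y) := by field_simp; ring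
    linarith
  have h2 := div_le_div_of_nonneg_right (sum_sq_moment_le hφ) hl.le
  rw [← Finset.sum_div, Finset.sum_add_distrib, ← Finset.mul_sum, ← Finset.sum_div] at h1
  gcongr
  linarith

end Quartic

end Cliff

end Majorana

namespace Majorana

/-! ### Variance of coordinatewise Lipschitz functions of Gaussians -/

/-- `f` is `L`-Lipschitz for the `ℓ¹` distance. -/
def SumLip {ι : Type*} [Fintype ι] (L : ℝ) (f : (ι → ℝ) → ℝ) : Prop :=
  ∀ x y, |f x - f y| ≤ L * ∑ i, |x i - y i|

section Variance

variable {ι : Type*} [Fintype ι] {L : ℝ} {f : (ι → ℝ) → ℝ}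

/-- The law of independent standard Gaussians. -/
noncomputable abbrev gaussianPi (ι : Type*) [Fintype ι] : Measure (ι → ℝ) :=
  Measure.pi fun _ => gaussianReal 0 1

theorem SumLip.continuous (hf : SumLip L f) : Continuous f := by
  rw [continuous_iff_continuousAt]
  intro a
  rw [ContinuousAt, tendsto_iff_norm_sub_tendsto_zero]
  refine squeeze_zero (fun _ => norm_nonneg _) (fun x => hf x a) ?_
  have : Continuous fun x : ι → ℝ => L * ∑ i, |x i - a i| := by fun_prop
  simpa using this.tendsto a

theorem memLp_id_stdGaussian : MemLp (fun x : ℝ => x) 2 (gaussianReal 0 1) :=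
  memLp_id_gaussianReal 2

theorem memLp_eval (i : ι) : MemLp (fun x : ι → ℝ => x i) 2 (gaussianPi ι) :=
  memLp_id_stdGaussian.comp_measurePreserving (measurePreserving_eval _ i)

theorem SumLip.memLp (hf : SumLip L f) : MemLp f 2 (gaussianPi ι) := by
  have h0 : MemLp (fun x : ι → ℝ => ∑ i, |x i|) 2 (gaussianPi ι) :=
    memLp_finsetSum Finset.univ (f := fun i (x : ι → ℝ) => |x i|) fun i _ => (memLp_eval i).abs
  have h1 : MemLp (fun x : ι → ℝ => |f 0| + L * ∑ i, |x i|) 2 (gaussianPi ι) :=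
    (memLp_const |f 0|).add (h0.const_mul L)
  refine h1.of_le hf.continuous.aestronglyMeasurable (Eventually.of_forall fun x => ?_)
  have h2 := hf x 0
  simp only [Pi.zero_apply, sub_zero] at h2
  rw [Real.norm_eq_abs, Real.norm_eq_abs]
  refine le_trans ?_ (le_abs_self _)
  have := abs_sub_abs_le_abs_sub (f x) (f 0)
  linarith

theorem integral_sq_stdGaussian : ∫ x, x ^ 2 ∂(gaussianReal 0 1) = 1 := by
  have h := variance_eq_sub memLp_id_stdGaussian
  have h1 : Var[fun x : ℝ => x; gaussianReal 0 1] = ((1 : NNReal) : ℝ) := variance_id_gaussianReal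
  rw [h1, integral_id_gaussianReal] at h
  simpa using h.symm

/-- The variance of g is that of g - g 0, hence at most the mean of (L x)². -/
theorem integral_sq_le_of_lipschitz {g : ℝ → ℝ} (hg : ∀ x y, |g x - g y| ≤ L * |x - y|) :
    MemLp g 2 (gaussianReal 0 1) ∧
      ∫ x, g x ^ 2 ∂(gaussianReal 0 1) ≤ (∫ x, g x ∂(gaussianReal 0 1)) ^ 2 + L ^ 2 := by
  have hc : Continuous g := by
    rw [continuous_iff_continuousAt]
    intro a
    rw [ContinuousAt, tendsto_iff_norm_sub_tendsto_zero]
    refine squeeze_zero (fun _ => norm_nonneg _) (fun x => hg x a) ?_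
    have : Continuous fun x : ℝ => L * |x - a| := by fun_prop
    simpa using this.tendsto a
  have h0 : MemLp (fun x => g x - g 0) 2 (gaussianReal 0 1) := by
    refine (memLp_id_stdGaussian.const_mul L).of_le (hc.sub continuous_const).aestronglyMeasurable
      (Eventually.of_forall fun x => ?_)
    have := hg x 0
    rw [sub_zero] at this
    rw [Real.norm_eq_abs, Real.norm_eq_abs]
    refine this.trans ((le_abs_self _).trans (le_of_eq ?_))
    rw [abs_mul, abs_mul, abs_abs]
  have h1 : MemLp g 2 (gaussianReal 0 1) := by
    have := h0.add (memLp_const (g 0))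
    refine this.congr_norm hc.aestronglyMeasurable (Eventually.of_forall fun x => ?_)
    simp
  refine ⟨h1, ?_⟩
  have hv := variance_eq_sub h1
  have hv0 := variance_eq_sub h0
  have hs : Var[fun x => g x - g 0; gaussianReal 0 1] = Var[g; gaussianReal 0 1] :=
    variance_sub_const hc.aestronglyMeasurable _
  simp only [Pi.pow_apply] at hv hv0
  have h2 : ∫ x, (g x - g 0) ^ 2 ∂(gaussianReal 0 1)
      ≤ ∫ x, L ^ 2 * x ^ 2 ∂(gaussianReal 0 1) := by
    refine integral_mono h0.integrable_sq (memLp_id_stdGaussian.integrable_sq.const_mul _)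
      fun x => ?_
    have := hg x 0
    rw [sub_zero] at this
    change (g x - g 0) ^ 2 ≤ L ^ 2 * x ^ 2
    rw [← sq_abs (g x - g 0), ← sq_abs x, ← mul_pow]
    exact pow_le_pow_left₀ (abs_nonneg _) this 2
  rw [integral_const_mul, integral_sq_stdGaussian, mul_one] at h2
  have h3 := sq_nonneg (∫ x, (g x - g 0) ∂(gaussianReal 0 1))
  linarith

/-- The variance bound m L², written with second moments so that it integrates over slices.
Conditioning on the first coordinate, the induction bounds each slice, and the slice mean is an
L-Lipschitz function of one Gaussian. -/
theorem integral_sq_le_fin (m : ℕ) : ∀ {L : ℝ} {f : (Fin m → ℝ) → ℝ}, SumLip L f →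
    ∫ x, f x ^ 2 ∂(gaussianPi (Fin m)) ≤ (∫ x, f x ∂(gaussianPi (Fin m))) ^ 2 + m * L ^ 2 := by
  induction m with
  | zero =>
    intro L f _
    have : ∀ x, f x = f 0 := fun x => congrArg f (Subsingleton.elim _ _)
    simp [this]
  | succ m ih =>
    intro L f hf
    set γ := gaussianReal 0 1
    set e := MeasurableEquiv.piFinSuccAbove (fun _ : Fin (m + 1) => ℝ) 0
    have hmp : MeasurePreserving e (gaussianPi (Fin (m + 1))) (γ.prod (gaussianPi (Fin m))) :=
      measurePreserving_piFinSuccAbove (fun _ : Fin (m + 1) => γ) 0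
    have hcons : ∀ p : ℝ × (Fin m → ℝ), e.symm p = Fin.cons p.1 p.2 := by
      intro p
      change (MeasurableEquiv.piFinSuccAbove (fun _ : Fin (m + 1) => ℝ) 0).symm p = _
      rw [MeasurableEquiv.piFinSuccAbove_symm_apply]
      simp [Fin.insertNthEquiv]
    set F : ℝ × (Fin m → ℝ) → ℝ := fun p => f (Fin.cons p.1 p.2) with hF
    have hFe : ∀ x, F (e x) = f x := by
      intro x
      change f (Fin.cons (e x).1 (e x).2) = f x
      rw [← hcons, e.symm_apply_apply]
    have hFm : MemLp F 2 (γ.prod (gaussianPi (Fin m))) := by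
      have := hf.memLp.comp_measurePreserving hmp.symm
      refine this.congr_norm ?_ (Eventually.of_forall fun p => ?_)
      · have : F = f ∘ e.symm := by
          funext p; simp only [Function.comp, hcons, hF]
        rw [this]
        exact (hf.continuous.measurable.comp e.symm.measurable).aestronglyMeasurable
      · simp only [Function.comp, hcons, hF]
    have hF1 : Integrable F (γ.prod (gaussianPi (Fin m))) := hFm.integrable one_le_two
    have hslice : ∀ x, SumLip L fun y : Fin m → ℝ => F (x, y) := by
      intro x y y'
      have := hf (Fin.cons x y) (Fin.cons x y')
      rw [Fin.sum_univ_succ] at this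
      simpa using this
    set g : ℝ → ℝ := fun x => ∫ y, F (x, y) ∂(gaussianPi (Fin m)) with hg
    -- Averaging over the remaining coordinates preserves the Lipschitz constant in the first.
    have hgl : ∀ x x', |g x - g x'| ≤ L * |x - x'| := by
      intro x x'
      simp only [hg]
      rw [← integral_sub ((hslice x).memLp.integrable one_le_two)
        ((hslice x').memLp.integrable one_le_two)]
      have h := norm_integral_le_of_norm_le_const (μ := gaussianPi (Fin m))
        (f := fun y => F (x, y) - F (x', y)) (C := L * |x - x'|) (Eventually.of_forall fun y => by
          have := hf (Fin.cons x y) (Fin.cons x' y)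
          rw [Fin.sum_univ_succ] at this
          simpa using this)
      rwa [probReal_univ, mul_one] at h
    obtain ⟨hg2, hg3⟩ := integral_sq_le_of_lipschitz hgl
    have e1 : ∫ x, f x ^ 2 ∂(gaussianPi (Fin (m + 1)))
        = ∫ x, ∫ y, F (x, y) ^ 2 ∂(gaussianPi (Fin m)) ∂γ := by
      have : ∫ x, ∫ y, F (x, y) ^ 2 ∂(gaussianPi (Fin m)) ∂γ
          = ∫ p, F p ^ 2 ∂(γ.prod (gaussianPi (Fin m))) :=
        (integral_prod (fun p => F p ^ 2) hFm.integrable_sq).symm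
      rw [this, ← hmp.integral_comp' (fun p => F p ^ 2)]
      simp only [hFe]
    have e2 : ∫ x, f x ∂(gaussianPi (Fin (m + 1))) = ∫ x, g x ∂γ := by
      have : ∫ x, g x ∂γ = ∫ p, F p ∂(γ.prod (gaussianPi (Fin m))) := (integral_prod F hF1).symm
      rw [this, ← hmp.integral_comp']
      simp only [hFe]
    rw [e1, e2]
    have h3 : ∫ x, ∫ y, F (x, y) ^ 2 ∂(gaussianPi (Fin m)) ∂γ
        ≤ ∫ x, (g x ^ 2 + m * L ^ 2) ∂γ :=
      integral_mono hFm.integrable_sq.integral_prod_left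
        (hg2.integrable_sq.add (integrable_const _)) fun x => ih (hslice x)
    rw [integral_add hg2.integrable_sq (integrable_const _), integral_const] at h3
    simp only [probReal_univ, smul_eq_mul, one_mul] at h3
    push_cast
    linarith

theorem SumLip.variance_le (hf : SumLip L f) :
    Var[f; gaussianPi ι] ≤ Fintype.card ι * L ^ 2 := by
  classical
  set e := (Fintype.equivFin ι).symm
  set E := MeasurableEquiv.piCongrLeft (fun _ : ι => ℝ) e
  have hmp : MeasurePreserving E (gaussianPi (Fin (Fintype.card ι))) (gaussianPi ι) :=
    measurePreserving_piCongrLeft (fun _ : ι => gaussianReal 0 1) e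
  have hE : ∀ x i, E x (e i) = x i := fun x i =>
    Equiv.piCongrLeft_apply_apply (fun _ : ι => ℝ) e x i
  have hl : SumLip L fun x => f (E x) := by
    intro x y
    refine (hf (E x) (E y)).trans (le_of_eq ?_)
    rw [← e.sum_comp]
    simp only [hE]
  have h := integral_sq_le_fin _ hl
  rw [hmp.integral_comp' (fun y => f y ^ 2), hmp.integral_comp' f] at h
  rw [variance_eq_sub hf.memLp]
  simp only [Pi.pow_apply]
  linarith

end Variance

/-! ### Gaussian moments -/

section Moments

variable {ι : Type*} [Fintype ι] [DecidableEq ι]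

theorem prod_four_eq (a b c d : ι) (x : ι → ℝ) :
    x a * x b * (x c * x d) = ∏ u, x u ^ ((if u = a then 1 else 0) + (if u = b then 1 else 0)
      + ((if u = c then 1 else 0) + (if u = d then 1 else 0))) := by
  have h : ∀ a : ι, ∏ u, x u ^ (if u = a then 1 else 0) = x a := by
    intro a
    rw [Finset.prod_eq_single a] <;> simp +contextual
  simp only [pow_add, Finset.prod_mul_distrib, h]

theorem integrable_pow_stdGaussian {k : ℕ} (hk : k ≤ 2) :
    Integrable (fun x : ℝ => x ^ k) (gaussianReal 0 1) := by
  interval_cases k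
  · simp
  · simpa using memLp_id_stdGaussian.integrable one_le_two
  · exact memLp_id_stdGaussian.integrable_sq

theorem abs_integral_pow_stdGaussian {k : ℕ} (hk : k ≤ 2) :
    |∫ x : ℝ, x ^ k ∂(gaussianReal 0 1)| ≤ 1 := by
  interval_cases k
  · simp
  · simp [integral_id_gaussianReal]
  · rw [integral_sq_stdGaussian, abs_one]

theorem multiplicity_le {ι : Type*} [DecidableEq ι] {a b c d : ι} (hab : a ≠ b) (hcd : c ≠ d)
    (u : ι) :
    (if u = a then 1 else 0) + (if u = b then 1 else 0)
      + ((if u = c then 1 else 0) + (if u = d then 1 else 0)) ≤ 2 := by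
  have h1 : (if u = a then 1 else 0) + (if u = b then 1 else 0) ≤ 1 := by
    by_cases h : u = a
    · subst h; simp [hab]
    · simp only [h, if_false, zero_add]; split_ifs <;> omega
  have h2 : (if u = c then 1 else 0) + (if u = d then 1 else 0) ≤ 1 := by
    by_cases h : u = c
    · subst h; simp [hcd]
    · simp only [h, if_false, zero_add]; split_ifs <;> omega
  omega

theorem integrable_prod_four {a b c d : ι} (hab : a ≠ b) (hcd : c ≠ d) :
    Integrable (fun x : ι → ℝ => x a * x b * (x c * x d)) (gaussianPi ι) := by
  simp only [prod_four_eq]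
  exact Integrable.fintype_prod (f := fun u t => t ^ _) fun u =>
    integrable_pow_stdGaussian (multiplicity_le hab hcd u)

/-- By independence the mean factorises over the indices, each with multiplicity at most 2. Unless
{c, d} = {a, b}, some index has multiplicity 1 and its centred factor annihilates the product. -/
theorem abs_integral_prod_four_le {a b c d : ι} (hab : a ≠ b) (hcd : c ≠ d) :
    |∫ x : ι → ℝ, x a * x b * (x c * x d) ∂(gaussianPi ι)|
      ≤ (if c = a ∧ d = b then 1 else 0) + (if c = b ∧ d = a then 1 else 0) := by
  have hprod : ∫ x : ι → ℝ, x a * x b * (x c * x d) ∂(gaussianPi ι)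
      = ∏ u, ∫ t : ℝ, t ^ ((if u = a then 1 else 0) + (if u = b then 1 else 0)
      + ((if u = c then 1 else 0) + (if u = d then 1 else 0))) ∂(gaussianReal 0 1) := by
    simp only [prod_four_eq]
    exact integral_fintype_prod_eq_prod (𝕜 := ℝ) (fun (u : ι) (t : ℝ) =>
      t ^ ((if u = a then 1 else 0) + (if u = b then 1 else 0)
      + ((if u = c then 1 else 0) + (if u = d then 1 else 0))))
  have hzero : ∀ u : ι, (if u = a then 1 else 0) + (if u = b then 1 else 0)
      + ((if u = c then 1 else 0) + (if u = d then 1 else 0)) = 1 →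
      ∫ x : ι → ℝ, x a * x b * (x c * x d) ∂(gaussianPi ι) = 0 := by
    intro u hu
    rw [hprod]
    refine Finset.prod_eq_zero (Finset.mem_univ u) ?_
    rw [hu]
    simp [integral_id_gaussianReal]
  have hone : |∫ x : ι → ℝ, x a * x b * (x c * x d) ∂(gaussianPi ι)| ≤ 1 := by
    rw [hprod, Finset.abs_prod]
    exact Finset.prod_le_one (fun _ _ => abs_nonneg _) fun u _ =>
      abs_integral_pow_stdGaussian (multiplicity_le hab hcd u)
  by_cases h1 : c = a ∧ d = b
  · rw [if_pos h1]
    refine hone.trans ?_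
    split_ifs <;> norm_num
  · by_cases h2 : c = b ∧ d = a
    · rw [if_neg h1, if_pos h2]; simpa using hone
    · rw [if_neg h1, if_neg h2]
      have : ∃ u : ι, (if u = a then 1 else 0) + (if u = b then 1 else 0)
          + ((if u = c then 1 else 0) + (if u = d then 1 else 0)) = 1 := by
        by_cases hca : c = a
        · have hda : d ≠ a := fun h => hcd (hca.trans h.symm)
          have hdb : d ≠ b := fun h => h1 ⟨hca, h⟩
          exact ⟨d, by simp [hda, hdb, hcd.symm]⟩
        · by_cases hcb : c = b
          · have hdb : d ≠ b := fun h => hcd (hcb.trans h.symm)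
            have hda : d ≠ a := fun h => h2 ⟨hcb, h⟩
            exact ⟨d, by simp [hda, hdb, hcd.symm]⟩
          · exact ⟨c, by simp [hca, hcb, hcd]⟩
      obtain ⟨u, hu⟩ := this
      rw [hzero u hu]
      simp

end Moments

end Majorana

namespace Majorana

open Cliff

/-! ### The SYK model: mean and concentration of the relaxation value -/

section SYK

variable {n : ℕ}

theorem ne_of_card_inter {S T : Quad n} (h : (S.1 ∩ T.1).card = 2) : S ≠ T := by
  rintro rfl
  rw [Finset.inter_self, S.2] at h
  omega

theorem pairCoef_sq (z : Quad n → ℝ) (D : Quad n) :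
    pairCoef z D ^ 2 = ∑ p : Quad n × Quad n, ∑ q : Quad n × Quad n,
      if ((p.1.1 ∩ p.2.1).card = 2 ∧ p.1.1 ∆ p.2.1 = D.1) ∧
          ((q.1.1 ∩ q.2.1).card = 2 ∧ q.1.1 ∆ q.2.1 = D.1) then
        (4 * (sgn p.1.1 p.2.1).re * (sgn q.1.1 q.2.1).re)
          * (z p.1 * z p.2 * (z q.1 * z q.2)) else 0 := by
  rw [sq, pairCoef, Finset.sum_mul_sum]
  refine Finset.sum_congr rfl fun p _ => Finset.sum_congr rfl fun q _ => ?_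
  rw [ite_and (_ ∧ _) (_ ∧ _)]
  by_cases hp : (p.1.1 ∩ p.2.1).card = 2 ∧ p.1.1 ∆ p.2.1 = D.1
  · by_cases hq : (q.1.1 ∩ q.2.1).card = 2 ∧ q.1.1 ∆ q.2.1 = D.1
    · rw [if_pos hp, if_pos hq, if_pos hp, if_pos hq]; ring
    · rw [if_neg hq, if_neg hq, mul_zero, ite_self]
  · rw [if_neg hp, if_neg hp, zero_mul]

theorem integrable_pairCoef_sq (D : Quad n) :
    Integrable (fun J : Quad n → ℝ => pairCoef J D ^ 2) (sykLaw n) := by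
  simp only [pairCoef_sq]
  refine integrable_finsetSum _ fun p _ => integrable_finsetSum _ fun q _ => ?_
  split_ifs with h
  · exact (integrable_prod_four (ne_of_card_inter h.1.1) (ne_of_card_inter h.2.1)).const_mul _
  · exact integrable_zero _ _ _

theorem abs_sgn_re (S T : Finset (Fin n)) : |(sgn S T).re| = 1 := by
  rcases sgn_eq_one_or S T with h | h <;> simp [h]

/-- In the expanded square a pair p of quadruples can be matched only with itself and with its swap,
each at a cost of at most 4. -/
theorem integral_pairCoef_sq_le (D : Quad n) :
    ∫ J, pairCoef J D ^ 2 ∂(sykLaw n)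
      ≤ 8 * ∑ p : Quad n × Quad n,
        if (p.1.1 ∩ p.2.1).card = 2 ∧ p.1.1 ∆ p.2.1 = D.1 then (1 : ℝ) else 0 := by
  simp only [pairCoef_sq]
  have hint : ∀ p q : Quad n × Quad n, Integrable (fun z : Quad n → ℝ =>
      if ((p.1.1 ∩ p.2.1).card = 2 ∧ p.1.1 ∆ p.2.1 = D.1) ∧
          ((q.1.1 ∩ q.2.1).card = 2 ∧ q.1.1 ∆ q.2.1 = D.1) then
        (4 * (sgn p.1.1 p.2.1).re * (sgn q.1.1 q.2.1).re)
          * (z p.1 * z p.2 * (z q.1 * z q.2)) else 0) (sykLaw n) := by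
    intro p q
    split_ifs with h
    · exact (integrable_prod_four (ne_of_card_inter h.1.1) (ne_of_card_inter h.2.1)).const_mul _
    · exact integrable_zero _ _ _
  rw [integral_finsetSum _ fun p _ => integrable_finsetSum _ fun q _ => hint p q, Finset.mul_sum]
  refine Finset.sum_le_sum fun p _ => ?_
  rw [integral_finsetSum _ fun q _ => hint p q]
  by_cases hp : (p.1.1 ∩ p.2.1).card = 2 ∧ p.1.1 ∆ p.2.1 = D.1
  · rw [if_pos hp]
    have h1 : ∀ q : Quad n × Quad n, (∫ z : Quad n → ℝ,
        (if ((p.1.1 ∩ p.2.1).card = 2 ∧ p.1.1 ∆ p.2.1 = D.1) ∧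
          ((q.1.1 ∩ q.2.1).card = 2 ∧ q.1.1 ∆ q.2.1 = D.1) then
        (4 * (sgn p.1.1 p.2.1).re * (sgn q.1.1 q.2.1).re)
          * (z p.1 * z p.2 * (z q.1 * z q.2)) else 0) ∂(sykLaw n))
        ≤ (if q = p then 4 else 0) + (if q = p.swap then 4 else 0) := by
      intro q
      by_cases hq : (q.1.1 ∩ q.2.1).card = 2 ∧ q.1.1 ∆ q.2.1 = D.1
      · simp only [if_pos (And.intro hp hq)]
        rw [integral_const_mul]
        refine (le_abs_self _).trans ?_
        rw [abs_mul, abs_mul, abs_mul, abs_sgn_re, abs_sgn_re]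
        have h := abs_integral_prod_four_le (ne_of_card_inter hp.1) (ne_of_card_inter hq.1)
        have e1 : (q.1 = p.1 ∧ q.2 = p.2) ↔ q = p := Prod.ext_iff.symm
        have e2 : (q.1 = p.2 ∧ q.2 = p.1) ↔ q = p.swap := by
          rw [Prod.ext_iff]; rfl
        simp only [e1, e2] at h
        have h4 : |(4 : ℝ)| * 1 * 1 = 4 := by norm_num
        rw [h4]
        refine (mul_le_mul_of_nonneg_left h (by norm_num : (0 : ℝ) ≤ 4)).trans (le_of_eq ?_)
        rw [mul_add, mul_ite, mul_ite, mul_one, mul_zero]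
      · simp only [hq, and_false, if_false, integral_zero]
        positivity
    refine (Finset.sum_le_sum fun q _ => h1 q).trans (le_of_eq ?_)
    rw [Finset.sum_add_distrib, Finset.sum_ite_eq', Finset.sum_ite_eq']
    simp only [Finset.mem_univ, if_true]
    norm_num
  · simp [hp]

/-- T is determined by S ∩ T and T \ S: six choices for the first, at most n² / 2 for the second. -/
theorem card_inter_eq_two_le (S : Quad n) :
    ((Finset.univ.filter fun T : Quad n => (S.1 ∩ T.1).card = 2).card : ℝ) ≤ 3 * (n : ℝ) ^ 2 := by
  have h1 : (Finset.univ.filter fun T : Quad n => (S.1 ∩ T.1).card = 2).card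
      ≤ (S.1.powersetCard 2 ×ˢ (Finset.univ : Finset (Fin n)).powersetCard 2).card := by
    refine Finset.card_le_card_of_injOn (fun T => (S.1 ∩ T.1, T.1 \ S.1)) ?_ ?_
    · intro T hT
      simp only [Finset.coe_filter, Finset.mem_univ, true_and, Set.mem_ofPred_eq] at hT
      have h3 := Finset.card_sdiff_add_card_inter T.1 S.1
      rw [Finset.inter_comm, T.2, hT] at h3
      simp only [Finset.coe_product, Set.mem_prod, Finset.mem_coe, Finset.mem_powersetCard]
      exact ⟨⟨Finset.inter_subset_left, hT⟩, Finset.subset_univ _, by omega⟩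
    · intro T _ T' _ h
      rw [Prod.mk.injEq] at h
      apply Subtype.ext
      rw [← Finset.sdiff_union_inter T.1 S.1, ← Finset.sdiff_union_inter T'.1 S.1, h.2,
        Finset.inter_comm T.1, h.1, Finset.inter_comm]
  rw [Finset.card_product, Finset.card_powersetCard, Finset.card_powersetCard, S.2,
    Finset.card_univ, Fintype.card_fin] at h1
  have h2 : ((Nat.choose n 2 : ℕ) : ℝ) ≤ (n : ℝ) ^ 2 / 2 := by
    rw [Nat.cast_choose_two]
    nlinarith [Nat.cast_nonneg (α := ℝ) n]
  have h3 : Nat.choose 4 2 = 6 := by decide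
  rw [h3] at h1
  have h4 : ((Finset.univ.filter fun T : Quad n => (S.1 ∩ T.1).card = 2).card : ℝ)
      ≤ 6 * (n.choose 2 : ℕ) := by exact_mod_cast h1
  linarith

theorem card_quad (n : ℕ) : Fintype.card (Quad n) = n.choose 4 := by
  rw [Fintype.card_finset_len, Fintype.card_fin]

/-- A pair (S, T) contributes to the single D = S ∆ T, so the constant is 8 · 3. -/
theorem sum_integral_pairCoef_sq_le :
    ∑ D : Quad n, ∫ J, pairCoef J D ^ 2 ∂(sykLaw n)
      ≤ 24 * (n : ℝ) ^ 2 * (n.choose 4 : ℝ) := by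
  refine (Finset.sum_le_sum fun D _ => integral_pairCoef_sq_le D).trans ?_
  rw [← Finset.mul_sum, Finset.sum_comm]
  have h1 : ∀ p : Quad n × Quad n, (∑ D : Quad n,
      if (p.1.1 ∩ p.2.1).card = 2 ∧ p.1.1 ∆ p.2.1 = D.1 then (1 : ℝ) else 0)
      ≤ if (p.1.1 ∩ p.2.1).card = 2 then 1 else 0 := by
    intro p
    by_cases h : (p.1.1 ∩ p.2.1).card = 2
    · rw [if_pos h, Finset.sum_eq_single ⟨p.1.1 ∆ p.2.1, card_symmDiff_quad h⟩]
      · split_ifs <;> norm_num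
      · intro D _ hD
        rw [if_neg]
        rintro ⟨_, h'⟩
        exact hD (Subtype.ext h'.symm)
      · simp
    · simp [h]
  have h2 : ∑ p : Quad n × Quad n, (if (p.1.1 ∩ p.2.1).card = 2 then (1 : ℝ) else 0)
      ≤ ∑ _S : Quad n, 3 * (n : ℝ) ^ 2 := by
    rw [Fintype.sum_prod_type]
    refine Finset.sum_le_sum fun S _ => ?_
    rw [Finset.sum_boole]
    exact card_inter_eq_two_le S
  rw [Finset.sum_const, Finset.card_univ, card_quad, nsmul_eq_mul] at h2
  have h3 := (Finset.sum_le_sum fun p (_ : p ∈ Finset.univ) => h1 p).trans h2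
  linarith

/-- Nearly sharp at n = 12, where it reads 20736 ≤ 20790. After the substitution n = 12 + t the
difference has nonnegative coefficients. -/
theorem pow_four_le_choose (hn : 12 ≤ n) : (n : ℝ) ^ 4 ≤ 42 * (n.choose 4 : ℝ) := by
  obtain ⟨t, rfl⟩ := Nat.exists_eq_add_of_le hn
  have h := Nat.descFactorial_eq_factorial_mul_choose (12 + t) 4
  have h1 : (12 + t).descFactorial 4 = (t + 9) * ((t + 10) * ((t + 11) * (t + 12))) := by
    simp only [Nat.descFactorial_succ, Nat.descFactorial_zero]
    rw [show 12 + t - 3 = t + 9 by omega, show 12 + t - 2 = t + 10 by omega,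
      show 12 + t - 1 = t + 11 by omega, show 12 + t - 0 = t + 12 by omega]
    ring
  rw [h1, show Nat.factorial 4 = 24 by decide] at h
  have h2 : (24 : ℝ) * ((12 + t).choose 4 : ℝ)
      = (t + 9) * ((t + 10) * ((t + 11) * (t + 12))) := by exact_mod_cast h.symm
  have ht : (0 : ℝ) ≤ t := Nat.cast_nonneg t
  push_cast
  have : (24 : ℝ) * (12 + t) ^ 4 ≤ 42 * ((t + 9) * ((t + 10) * ((t + 11) * (t + 12)))) := by
    have e : 42 * (((t : ℝ) + 9) * ((t + 10) * ((t + 11) * (t + 12)))) - 24 * (12 + t) ^ 4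
      = 18 * t ^ 4 + 612 * t ^ 3 + 6942 * t ^ 2 + 26388 * t + 1296 := by ring
    have : (0 : ℝ) ≤ 18 * t ^ 4 + 612 * t ^ 3 + 6942 * t ^ 2 + 26388 * t + 1296 := by positivity
    linarith
  linarith

theorem pairCoef_div (z : Quad n → ℝ) (c : ℝ) (D : Quad n) :
    pairCoef (fun S => z S / c) D = pairCoef z D / c ^ 2 := by
  unfold pairCoef
  rw [Finset.sum_div]
  refine Finset.sum_congr rfl fun p _ => ?_
  split_ifs
  · rw [div_mul_div_comm, ← sq, mul_div_assoc']
  · simp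

theorem sumLip_sos_sykH {k : ℕ} (hk : 2 ≤ k) :
    SumLip (1 / √(n.choose 4 : ℝ)) fun J : Quad n → ℝ => sos k (sykH J) := by
  have key : ∀ x y : Quad n → ℝ, sos k (sykH x) - sos k (sykH y)
      ≤ 1 / √(n.choose 4 : ℝ) * ∑ i, |x i - y i| := by
    intro x y
    have h := sos_quartic_le hk (fun S => x S / √(n.choose 4 : ℝ))
      (fun S => y S / √(n.choose 4 : ℝ))
    have e : ∑ S : Quad n, |x S / √(n.choose 4 : ℝ) - y S / √(n.choose 4 : ℝ)|
        = 1 / √(n.choose 4 : ℝ) * ∑ i, |x i - y i| := by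
      rw [Finset.mul_sum]
      refine Finset.sum_congr rfl fun S _ => ?_
      rw [← sub_div, abs_div, abs_of_nonneg (Real.sqrt_nonneg _)]
      ring
    rw [e] at h
    unfold sykH
    linarith
  intro x y
  rw [abs_le]
  constructor
  · have := key y x
    simp only [abs_sub_comm (y _)] at this
    linarith
  · exact key x y

theorem integrable_sos_sykH {k : ℕ} (hk : 2 ≤ k) :
    Integrable (fun J : Quad n → ℝ => sos k (sykH J)) (sykLaw n) :=
  (sumLip_sos_sykH hk).memLp.integrable one_le_two

/-- There are N = (n choose 4) couplings, and each contributes the square 1 / N of the Lipschitz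
constant. -/
theorem variance_sos_sykH_le {k : ℕ} (hk : 2 ≤ k) :
    Var[fun J : Quad n → ℝ => sos k (sykH J); sykLaw n] ≤ 1 := by
  refine (sumLip_sos_sykH hk).variance_le.trans ?_
  rw [card_quad, div_pow, one_pow, Real.sq_sqrt (Nat.cast_nonneg _), mul_one_div]
  exact div_self_le_one _

/-- The expected value of the degree-6 relaxation of the SYK model. -/
theorem integral_sos_three_le (hn : 12 ≤ n) :
    ∫ J : Quad n → ℝ, sos 3 (sykH J) ∂(sykLaw n) ≤ 3 / 2 * √(n : ℝ) := by
  set N : ℝ := (n.choose 4 : ℝ) with hN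
  have hN0 : 0 < N := by
    rw [hN]; exact_mod_cast Nat.choose_pos (by omega)
  have hn0 : (0 : ℝ) < n := by
    have : 0 < n := by omega
    exact_mod_cast this
  have hr : 0 < √(n : ℝ) := Real.sqrt_pos.mpr hn0
  have hrr : √(n : ℝ) * √(n : ℝ) = n := Real.mul_self_sqrt hn0.le
  -- The weight l balances the two halves of Young's inequality: they come to at most 63/2 and to
  -- exactly 32. Then 4 + (63/2 + 32) / 2 ≤ 36, so with s = 6 / √n both n s and the last term are at
  -- most 6 √n, and 12 / 8 = 3/2.
  set s : ℝ := 6 / √(n : ℝ) with hs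
  set l : ℝ := (n : ℝ) ^ 2 / 32 with hl
  have hs0 : 0 < s := by positivity
  have hl0 : 0 < l := by positivity
  have hpt : ∀ J : Quad n → ℝ, 8 * sos 3 (sykH J) ≤ n * s + (4 * ∑ S, J S ^ 2 / N
      + (l * ∑ D, pairCoef J D ^ 2 / N ^ 2 + (n : ℝ) ^ 2 / l) / 2) / s := by
    intro J
    have h := eight_mul_sos_le (fun S => J S / √N) hs0 hl0
    simp only [pairCoef_div, div_pow, Real.sq_sqrt hN0.le] at h
    exact h
  have hJ : ∀ S : Quad n, Integrable (fun J : Quad n → ℝ => J S ^ 2 / N) (sykLaw n) := fun S =>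
    (memLp_eval S).integrable_sq.div_const N
  have hJ1 : ∀ S : Quad n, ∫ J : Quad n → ℝ, J S ^ 2 / N ∂(sykLaw n) = 1 / N := by
    intro S
    rw [integral_div]
    rw [← integral_sq_stdGaussian]
    congr 1
    have hm := (measurePreserving_eval (fun _ : Quad n => gaussianReal 0 1) S)
    rw [← hm.map_eq, integral_map hm.measurable.aemeasurable (by fun_prop)]
    rfl
  have hP : ∀ D : Quad n, Integrable (fun J : Quad n → ℝ => pairCoef J D ^ 2 / N ^ 2)
      (sykLaw n) := fun D => (integrable_pairCoef_sq D).div_const _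
  have hJs := integrable_finsetSum Finset.univ fun S _ => hJ S
  have hPs := integrable_finsetSum Finset.univ fun D _ => hP D
  have hprob : IsProbabilityMeasure (sykLaw n) := by unfold sykLaw; infer_instance
  have i1 : Integrable (fun J : Quad n → ℝ => l * ∑ D, pairCoef J D ^ 2 / N ^ 2
      + (n : ℝ) ^ 2 / l) (sykLaw n) := (hPs.const_mul l).add (integrable_const _)
  have i2 : Integrable (fun J : Quad n → ℝ => (l * ∑ D, pairCoef J D ^ 2 / N ^ 2
      + (n : ℝ) ^ 2 / l) / 2) (sykLaw n) := i1.div_const 2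
  have i3 : Integrable (fun J : Quad n → ℝ => 4 * ∑ S, J S ^ 2 / N
      + (l * ∑ D, pairCoef J D ^ 2 / N ^ 2 + (n : ℝ) ^ 2 / l) / 2) (sykLaw n) :=
    (hJs.const_mul 4).add i2
  have i4 : Integrable (fun J : Quad n → ℝ => (4 * ∑ S, J S ^ 2 / N
      + (l * ∑ D, pairCoef J D ^ 2 / N ^ 2 + (n : ℝ) ^ 2 / l) / 2) / s) (sykLaw n) :=
    i3.div_const s
  have hint : ∫ J : Quad n → ℝ, (n * s + (4 * ∑ S, J S ^ 2 / N
      + (l * ∑ D, pairCoef J D ^ 2 / N ^ 2 + (n : ℝ) ^ 2 / l) / 2) / s) ∂(sykLaw n)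
      = n * s + (4 + (l * ∑ D : Quad n, (∫ J, pairCoef J D ^ 2 ∂(sykLaw n)) / N ^ 2
        + (n : ℝ) ^ 2 / l) / 2) / s := by
    rw [integral_add (integrable_const _) i4, integral_const, integral_div,
      integral_add (hJs.const_mul 4) i2, integral_div, integral_const_mul,
      integral_add (hPs.const_mul l) (integrable_const _), integral_const_mul, integral_const,
      integral_finsetSum _ (fun S _ => hJ S), integral_finsetSum _ (fun D _ => hP D)]
    simp only [hJ1, integral_div, Finset.sum_const, Finset.card_univ, card_quad, probReal_univ,
      smul_eq_mul, one_mul, nsmul_eq_mul, ← hN]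
    rw [mul_one_div, div_self hN0.ne', mul_one]
  have hmono := integral_mono ((integrable_sos_sykH (n := n) (by norm_num : 2 ≤ 3)).const_mul 8)
    ((integrable_const (n * s)).add i4) hpt
  rw [integral_const_mul] at hmono
  have hmono' := hmono.trans_eq hint
  have h1 : ∑ D : Quad n, (∫ J, pairCoef J D ^ 2 ∂(sykLaw n)) / N ^ 2
      ≤ 24 * (n : ℝ) ^ 2 / N := by
    rw [← Finset.sum_div, div_le_div_iff₀ (by positivity) hN0]
    have := mul_le_mul_of_nonneg_right (sum_integral_pairCoef_sq_le (n := n)) hN0.le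
    refine this.trans (le_of_eq ?_)
    rw [← hN]; ring
  have h2 : l * (24 * (n : ℝ) ^ 2 / N) ≤ 63 / 2 := by
    have : l * (24 * (n : ℝ) ^ 2 / N) = 3 / 4 * (n : ℝ) ^ 4 / N := by rw [hl]; ring
    rw [this, div_le_iff₀ hN0]
    have := pow_four_le_choose hn
    linarith
  have h3 : (n : ℝ) ^ 2 / l = 32 := by rw [hl]; field_simp
  have h4 : l * ∑ D : Quad n, (∫ J, pairCoef J D ^ 2 ∂(sykLaw n)) / N ^ 2 ≤ 63 / 2 :=
    (mul_le_mul_of_nonneg_left h1 hl0.le).trans h2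
  have h5 : (4 + (l * ∑ D : Quad n, (∫ J, pairCoef J D ^ 2 ∂(sykLaw n)) / N ^ 2
        + (n : ℝ) ^ 2 / l) / 2) / s ≤ 6 * √(n : ℝ) := by
    rw [div_le_iff₀ hs0, h3, hs]
    have : 6 * √(n : ℝ) * (6 / √(n : ℝ)) = 36 := by field_simp; norm_num
    rw [this]
    linarith
  have h6 : (n : ℝ) * s = 6 * √(n : ℝ) := by
    rw [hs]
    nth_rewrite 1 [← hrr]
    field_simp
  linarith

theorem one_point_eight_le : (1.85 : ℝ) ≤ √(1 + √6) := by
  have h1 : (2.44 : ℝ) ≤ √6 := Real.le_sqrt_of_sq_le (by norm_num)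
  exact Real.le_sqrt_of_sq_le (by norm_num; linarith)

theorem sos_four_le_sos_three (J : Quad n → ℝ) : sos 4 (sykH J) ≤ sos 3 (sykH J) :=
  sos_anti (by norm_num) ((degLE_quartic _).mono_deg (by norm_num))

/-- The mean is at most 1.5 √n and the threshold at least 1.85 √n. A deviation of 0.35 √n has
probability at most 1 / (0.1 n) by Chebyshev's inequality, as the variance is at most 1 and 0.35² ≥
0.1. -/
theorem tendsto_sos_three_le :
    Tendsto (fun n : ℕ => sykLaw n {J | sos 3 (sykH J) ≤ √(1 + √6) * √(n : ℝ)}) atTop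
      (𝓝 1) := by
  have hlow : Tendsto (fun n : ℕ => 1 - ENNReal.ofReal (1 / (0.1 * n))) atTop (𝓝 1) := by
    have h1 : Tendsto (fun n : ℕ => (1 : ℝ) / (0.1 * n)) atTop (𝓝 0) :=
      Tendsto.div_atTop tendsto_const_nhds
        (Tendsto.const_mul_atTop (by norm_num) tendsto_natCast_atTop_atTop)
    have h2 := ENNReal.tendsto_ofReal h1
    have h3 := ENNReal.Tendsto.sub (tendsto_const_nhds (x := (1 : ENNReal))) h2
      (Or.inl ENNReal.one_ne_top)
    simpa using h3
  refine tendsto_of_tendsto_of_tendsto_of_le_of_le' hlow tendsto_const_nhds ?_ ?_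
  · filter_upwards [eventually_ge_atTop 12] with n hn
    have hprob : IsProbabilityMeasure (sykLaw n) := by unfold sykLaw; infer_instance
    have hn0 : (0 : ℝ) < n := by
      have : 0 < n := by omega
      exact_mod_cast this
    have hr : 0 < √(n : ℝ) := Real.sqrt_pos.mpr hn0
    set X : (Quad n → ℝ) → ℝ := fun J => sos 3 (sykH J) with hX
    have hX2 : MemLp X 2 (sykLaw n) := (sumLip_sos_sykH (by norm_num)).memLp
    have hch := meas_ge_le_variance_div_sq hX2 (c := 0.35 * √(n : ℝ)) (by positivity)
    have hle : Var[X; sykLaw n] / (0.35 * √(n : ℝ)) ^ 2 ≤ 1 / (0.1 * n) := by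
      have := variance_sos_sykH_le (n := n) (k := 3) (by norm_num)
      rw [mul_pow, Real.sq_sqrt hn0.le]
      apply div_le_div₀ zero_le_one this (by positivity)
      norm_num
      linarith
    have hsub : {J | X J ≤ √(1 + √6) * √(n : ℝ)}ᶜ
        ⊆ {J | 0.35 * √(n : ℝ) ≤ |X J - ∫ J, X J ∂(sykLaw n)|} := by
      intro J hJ
      simp only [Set.mem_compl_iff, Set.mem_ofPred_eq, not_le] at hJ ⊢
      have h1 := integral_sos_three_le hn
      have h2 := mul_le_mul_of_nonneg_right one_point_eight_le hr.le
      refine le_trans ?_ (le_abs_self _)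
      change ∫ J, X J ∂(sykLaw n) ≤ _ at h1
      linarith
    have hmeas : MeasurableSet {J | X J ≤ √(1 + √6) * √(n : ℝ)} :=
      measurableSet_le (sumLip_sos_sykH (by norm_num)).continuous.measurable measurable_const
    have hc := prob_compl_eq_one_sub (μ := sykLaw n) hmeas
    have h1 := (measure_mono hsub).trans (hch.trans (ENNReal.ofReal_le_ofReal hle))
    rw [hc] at h1
    exact tsub_le_iff_tsub_le.mp h1
  · exact Eventually.of_forall fun n => by
      have hprob : IsProbabilityMeasure (sykLaw n) := by unfold sykLaw; infer_instance
      exact prob_le_one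

theorem tendsto_sos_four_le :
    Tendsto (fun n : ℕ => sykLaw n {J | sos 4 (sykH J) ≤ √(1 + √6) * √(n : ℝ)}) atTop
      (𝓝 1) := by
  refine tendsto_of_tendsto_of_tendsto_of_le_of_le tendsto_sos_three_le tendsto_const_nhds
    (fun n => measure_mono fun J hJ => ?_) fun n => ?_
  · exact (sos_four_le_sos_three J).trans hJ
  · have hprob : IsProbabilityMeasure (sykLaw n) := by unfold sykLaw; infer_instance
    exact prob_le_one

theorem integral_sos_four_le (hn : 12 ≤ n) :
    ∫ J : Quad n → ℝ, sos 4 (sykH J) ∂(sykLaw n) ≤ √(1 + √6) * √(n : ℝ) := by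
  have h1 := integral_mono (integrable_sos_sykH (n := n) (k := 4) (by norm_num))
    (integrable_sos_sykH (k := 3) (by norm_num)) sos_four_le_sos_three
  have h2 := integral_sos_three_le hn
  have h3 := mul_le_mul_of_nonneg_right one_point_eight_le (Real.sqrt_nonneg (n : ℝ))
  have h4 := Real.sqrt_nonneg (n : ℝ)
  linarith

end SYK

end Majorana

namespace Majorana

/-! ### Polynomial bounds -/

theorem bits_add_le (x y : ℤ) : bits (x + y) ≤ bits x + bits y := by
  have hx := Nat.lt_size_self x.natAbs
  have hy := Nat.lt_size_self y.natAbs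
  have h : (x + y).natAbs.size ≤ x.natAbs.size + y.natAbs.size + 1 := by
    rw [Nat.size_le]
    have h1 : 2 ^ x.natAbs.size ≤ 2 ^ (x.natAbs.size + y.natAbs.size) :=
      Nat.pow_le_pow_right (by norm_num) (by omega)
    have h2 : 2 ^ y.natAbs.size ≤ 2 ^ (x.natAbs.size + y.natAbs.size) :=
      Nat.pow_le_pow_right (by norm_num) (by omega)
    have h3 := Int.natAbs_add_le x y
    rw [pow_succ]
    omega
  unfold bits
  omega

theorem bits_neg (x : ℤ) : bits (-x) = bits x := by rw [bits, bits, Int.natAbs_neg]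

theorem bits_sub_le (x y : ℤ) : bits (x - y) ≤ bits x + bits y := by
  rw [sub_eq_add_neg, ← bits_neg y]; exact bits_add_le x (-y)

theorem bits_mul_le (x y : ℤ) : bits (x * y) ≤ bits x + bits y := by
  have hx := Nat.lt_size_self x.natAbs
  have hy := Nat.lt_size_self y.natAbs
  have h : (x * y).natAbs.size ≤ x.natAbs.size + y.natAbs.size := by
    rw [Nat.size_le, Int.natAbs_mul, pow_add]
    exact Nat.mul_lt_mul'' hx hy
  unfold bits
  omega

theorem bits_mono {x y : ℤ} (h : x.natAbs ≤ y.natAbs) : bits x ≤ bits y :=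
  Nat.succ_le_succ (Nat.size_le_size h)

theorem bits_div_le (x y : ℤ) : bits (x / y) ≤ bits x + bits y :=
  (bits_mono (Int.natAbs_ediv_le_natAbs x y)).trans (Nat.le_add_right _ _)

theorem bits_natCast_le (m : ℕ) : bits m ≤ m + 1 := by
  rw [bits, Int.natAbs_natCast]
  exact Nat.succ_le_succ (Nat.size_le.mpr Nat.lt_two_pow_self)

theorem bits_sum_le (m B : ℕ) (f : ℕ → ℤ) (hf : ∀ i < m, bits (f i) ≤ B) :
    bits (∑ i ∈ Finset.range m, f i) ≤ m * B + 1 := by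
  induction m with
  | zero => simp [bits]
  | succ m ih =>
    rw [Finset.sum_range_succ, Nat.succ_mul]
    have h1 := bits_add_le (∑ i ∈ Finset.range m, f i) (f m)
    have h2 := ih fun i hi => hf i (by omega)
    have h3 := hf m (by omega)
    omega

theorem bits_prod_le (m B : ℕ) (f : ℕ → ℤ) (hf : ∀ i < m, bits (f i) ≤ B) :
    bits (∏ i ∈ Finset.range m, f i) ≤ m * B + 2 := by
  induction m with
  | zero => simp [bits]
  | succ m ih =>
    rw [Finset.prod_range_succ, Nat.succ_mul]
    have h1 := bits_mul_le (∏ i ∈ Finset.range m, f i) (f m)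
    have h2 := ih fun i hi => hf i (by omega)
    have h3 := hf m (by omega)
    omega

/-- `f` is bounded by a power of `sz`. -/
def PolyBdd {Ω : Type} (sz f : Ω → ℕ) : Prop := ∃ k, ∀ ω, f ω ≤ sz ω ^ k

namespace PolyBdd

variable {Ω : Type} {sz f g : Ω → ℕ}

theorem mono (hg : PolyBdd sz g) (h : ∀ ω, f ω ≤ g ω) : PolyBdd sz f := by
  obtain ⟨k, hk⟩ := hg
  exact ⟨k, fun ω => (h ω).trans (hk ω)⟩

theorem comp {Ω' : Type} (hf : PolyBdd sz f) (h : Ω' → Ω) :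
    PolyBdd (fun ω => sz (h ω)) fun ω => f (h ω) := by
  obtain ⟨k, hk⟩ := hf
  exact ⟨k, fun ω => hk (h ω)⟩

theorem const (h2 : ∀ ω, 2 ≤ sz ω) (c : ℕ) : PolyBdd sz fun _ => c :=
  ⟨c, fun ω => Nat.lt_two_pow_self.le.trans (Nat.pow_le_pow_left (h2 ω) c)⟩

theorem add (h2 : ∀ ω, 2 ≤ sz ω) (hf : PolyBdd sz f) (hg : PolyBdd sz g) :
    PolyBdd sz fun ω => f ω + g ω := by
  obtain ⟨k, hk⟩ := hf
  obtain ⟨l, hl⟩ := hg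
  refine ⟨max k l + 1, fun ω => ?_⟩
  have h1 : sz ω ^ k ≤ sz ω ^ max k l :=
    Nat.pow_le_pow_right (by linarith [h2 ω]) (le_max_left _ _)
  have h3 : sz ω ^ l ≤ sz ω ^ max k l :=
    Nat.pow_le_pow_right (by linarith [h2 ω]) (le_max_right _ _)
  calc f ω + g ω ≤ sz ω ^ max k l * 2 := by linarith [hk ω, hl ω]
    _ ≤ sz ω ^ max k l * sz ω := Nat.mul_le_mul_left _ (h2 ω)
    _ = _ := (pow_succ _ _).symm

theorem mul (hf : PolyBdd sz f) (hg : PolyBdd sz g) : PolyBdd sz fun ω => f ω * g ω := by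
  obtain ⟨k, hk⟩ := hf
  obtain ⟨l, hl⟩ := hg
  exact ⟨k + l, fun ω => (Nat.mul_le_mul (hk ω) (hl ω)).trans_eq (pow_add _ _ _).symm⟩

theorem pow (hf : PolyBdd sz f) (m : ℕ) : PolyBdd sz fun ω => f ω ^ m := by
  obtain ⟨k, hk⟩ := hf
  exact ⟨k * m, fun ω => (Nat.pow_le_pow_left (hk ω) m).trans_eq (pow_mul _ _ _).symm⟩

end PolyBdd

/-! ### Polynomial time computability relative to a context -/

/-- A family of situations `ω`, each with a size, an input tape and the values of some variables. -/
structure Ctx (Ω : Type) where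
  sz : Ω → ℕ
  two_le : ∀ ω, 2 ≤ sz ω
  inp : Ω → ℕ → ℤ
  inp_bdd : ∃ k, ∀ ω m, bits (inp ω m) ≤ sz ω ^ k
  Idx : Type
  var : Idx → Ω → ℤ
  var_bdd : ∀ i, PolyBdd sz fun ω => bits (var i ω)

/-- Starting with the variables in the registers `loc`, the program `p` writes `f ω` into the
register `r`, leaves all registers below `r` unchanged, and has cost at most `sz ω ^ k`. -/
def Computes {Ω : Type} (Γ : Ctx Ω) (loc : Γ.Idx → ℕ) (r : ℕ) (p : Prog) (k : ℕ)
    (f : Ω → ℤ) : Prop :=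
  ∀ ω s, (∀ i, s (loc i) = Γ.var i ω) → ∃ t s', Run (Γ.inp ω) p s t s' ∧ s' r = f ω ∧
    (∀ x < r, s' x = s x) ∧ t ≤ Γ.sz ω ^ k

/-- `f` has polynomially many bits and is computable in polynomial time from the variables. -/
def PT {Ω : Type} (Γ : Ctx Ω) (f : Ω → ℤ) : Prop :=
  PolyBdd Γ.sz (fun ω => bits (f ω)) ∧
    ∀ (loc : Γ.Idx → ℕ) (r : ℕ), (∀ i, loc i < r) → ∃ p k, Computes Γ loc r p k f

/-- A map of situations under which every variable of `Γ` is a variable of `Γ'`. -/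
structure Ext {Ω Ω' : Type} (Γ : Ctx Ω) (Γ' : Ctx Ω') (h : Ω' → Ω) : Prop where
  sz_eq : ∀ ω, Γ'.sz ω = Γ.sz (h ω)
  inp_eq : ∀ ω, Γ'.inp ω = Γ.inp (h ω)
  var_eq : ∃ j : Γ.Idx → Γ'.Idx, ∀ i ω, Γ'.var (j i) ω = Γ.var i (h ω)

theorem Ext.trans {Ω Ω' Ω'' : Type} {Γ : Ctx Ω} {Γ' : Ctx Ω'} {Γ'' : Ctx Ω''} {h : Ω' → Ω}
    {h' : Ω'' → Ω'} (e : Ext Γ Γ' h) (e' : Ext Γ' Γ'' h') : Ext Γ Γ'' fun ω => h (h' ω) := by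
  obtain ⟨j, hj⟩ := e.var_eq
  obtain ⟨j', hj'⟩ := e'.var_eq
  exact ⟨fun ω => (e'.sz_eq ω).trans (e.sz_eq _), fun ω => (e'.inp_eq ω).trans (e.inp_eq _),
    fun i => j' (j i), fun i ω => (hj' _ ω).trans (hj i _)⟩

theorem Ext.polyBdd {Ω Ω' : Type} {Γ : Ctx Ω} {Γ' : Ctx Ω'} {h : Ω' → Ω} (e : Ext Γ Γ' h)
    {f : Ω → ℕ} (hf : PolyBdd Γ.sz f) : PolyBdd Γ'.sz fun ω => f (h ω) := by
  obtain ⟨k, hk⟩ := hf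
  exact ⟨k, fun ω => by rw [e.sz_eq]; exact hk _⟩

namespace PT

variable {Ω : Type} {Γ : Ctx Ω} {f g : Ω → ℤ}

theorem lift (hf : PT Γ f) {Ω' : Type} {Γ' : Ctx Ω'} {h : Ω' → Ω} (e : Ext Γ Γ' h) :
    PT Γ' fun ω => f (h ω) := by
  refine ⟨e.polyBdd hf.1, fun loc r hr => ?_⟩
  obtain ⟨j, hj⟩ := e.var_eq
  obtain ⟨p, k, hp⟩ := hf.2 (fun i => loc (j i)) r fun i => hr _
  refine ⟨p, k, fun ω s hs => ?_⟩
  obtain ⟨t, s', h1, h2, h3, h4⟩ := hp (h ω) s fun i => by rw [hs, hj]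
  exact ⟨t, s', by rwa [e.inp_eq], h2, h3, by rwa [e.sz_eq]⟩

theorem congr (hf : PT Γ f) (h : ∀ ω, f ω = g ω) : PT Γ g := by
  have : f = g := funext h
  rwa [← this]

theorem const (c : ℤ) : PT Γ fun _ => c := by
  refine ⟨PolyBdd.const Γ.two_le _, fun loc r _ => ?_⟩
  obtain ⟨k, hk⟩ := PolyBdd.const Γ.two_le (bits c)
  refine ⟨.const r c, k, fun ω s _ => ⟨_, _, Run.const r c s, by simp, fun x hx => ?_, hk ω⟩⟩
  rw [Function.update_of_ne hx.ne]

theorem var (i : Γ.Idx) : PT Γ (Γ.var i) := by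
  refine ⟨Γ.var_bdd i, fun loc r hr => ?_⟩
  obtain ⟨k, hk⟩ := ((PolyBdd.const Γ.two_le (bits 0)).add Γ.two_le
    ((PolyBdd.const Γ.two_le (bits 0)).add Γ.two_le (Γ.var_bdd i)))
  -- A register is copied by adding it to a zero written beforehand.
  refine ⟨.seq (.const r 0) (.add r r (loc i)), k, fun ω s hs => ?_⟩
  have h0 : Function.update s r 0 (loc i) = Γ.var i ω := by
    rw [Function.update_of_ne (hr i).ne, hs]
  refine ⟨_, _, Run.seq (Run.const r 0 s) (Run.add r r (loc i) _), ?_, fun x hx => ?_, ?_⟩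
  · simp [h0]
  · rw [Function.update_of_ne hx.ne, Function.update_of_ne hx.ne]
  · rw [h0, Function.update_self]; exact hk ω

/-- The second operand is computed from register r + 1 on, so the first one survives in register r.
-/
theorem binop {c : ℕ → ℕ → ℕ → Prog} {o : ℤ → ℤ → ℤ}
    (hc : ∀ inp x y z s, Run inp (c x y z) s (bits (s y) + bits (s z))
      (Function.update s x (o (s y) (s z))))
    (ho : ∀ a b, bits (o a b) ≤ bits a + bits b) (hf : PT Γ f) (hg : PT Γ g) :
    PT Γ fun ω => o (f ω) (g ω) := by
  have hb := hf.1.add Γ.two_le hg.1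
  refine ⟨hb.mono fun ω => ho _ _, fun loc r hr => ?_⟩
  obtain ⟨p, k, hp⟩ := hf.2 loc r hr
  obtain ⟨q, l, hq⟩ := hg.2 loc (r + 1) fun i => (hr i).trans (Nat.lt_succ_self r)
  obtain ⟨m, hm⟩ := (PolyBdd.add Γ.two_le (PolyBdd.add Γ.two_le
    ⟨k, fun _ => le_rfl⟩ ⟨l, fun ω => le_rfl⟩) hb)
  refine ⟨.seq (.seq p q) (c r r (r + 1)), m, fun ω s hs => ?_⟩
  obtain ⟨t₁, s₁, a1, a2, a3, a4⟩ := hp ω s hs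
  obtain ⟨t₂, s₂, b1, b2, b3, b4⟩ := hq ω s₁ fun i => by rw [a3 _ (hr i), hs]
  have e : s₂ r = f ω := by rw [b3 r (Nat.lt_succ_self r), a2]
  refine ⟨_, _, Run.seq (Run.seq a1 b1) (hc _ _ _ _ _), ?_, fun x hx => ?_, ?_⟩
  · rw [Function.update_self, e, b2]
  · rw [Function.update_of_ne hx.ne, b3 x (hx.trans (Nat.lt_succ_self r)), a3 x hx]
  · rw [e, b2]
    have := hm ω
    beta_reduce at this
    omega

theorem add (hf : PT Γ f) (hg : PT Γ g) : PT Γ fun ω => f ω + g ω :=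
  binop (fun _ x y z s => Run.add x y z s) bits_add_le hf hg

theorem sub (hf : PT Γ f) (hg : PT Γ g) : PT Γ fun ω => f ω - g ω :=
  binop (fun _ x y z s => Run.sub x y z s) bits_sub_le hf hg

theorem mul (hf : PT Γ f) (hg : PT Γ g) : PT Γ fun ω => f ω * g ω :=
  binop (fun _ x y z s => Run.mul x y z s) bits_mul_le hf hg

theorem div (hf : PT Γ f) (hg : PT Γ g) : PT Γ fun ω => f ω / g ω :=
  binop (fun _ x y z s => Run.div x y z s) bits_div_le hf hg

theorem emod (hf : PT Γ f) (hg : PT Γ g) : PT Γ fun ω => f ω % g ω :=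
  (hf.sub (hg.mul (hf.div hg))).congr fun _ => (Int.emod_def _ _).symm

theorem read (hf : PT Γ f) : PT Γ fun ω => Γ.inp ω (f ω).toNat := by
  obtain ⟨b, hb⟩ := Γ.inp_bdd
  refine ⟨⟨b, fun _ => hb _ _⟩, fun loc r hr => ?_⟩
  obtain ⟨p, k, hp⟩ := hf.2 loc r hr
  obtain ⟨m, hm⟩ := (PolyBdd.add Γ.two_le ⟨k, fun _ => le_rfl⟩
    (PolyBdd.add Γ.two_le hf.1 ⟨b, fun _ => le_rfl⟩))
  refine ⟨.seq p (.read r r), m, fun ω s hs => ?_⟩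
  obtain ⟨t₁, s₁, a1, a2, a3, a4⟩ := hp ω s hs
  refine ⟨_, _, Run.seq a1 (Run.read r r s₁), ?_, fun x hx => ?_, ?_⟩
  · rw [Function.update_self, a2]
  · rw [Function.update_of_ne hx.ne, a3 x hx]
  · rw [a2]
    have h1 := hm ω
    beta_reduce at h1
    have h2 := hb ω (f ω).toNat
    omega

theorem ite_pos {x : Ω → ℤ} (hx : PT Γ x) (hf : PT Γ f) (hg : PT Γ g) :
    PT Γ fun ω => if 0 < x ω then f ω else g ω := by
  refine ⟨(hf.1.add Γ.two_le hg.1).mono fun ω => ?_, fun loc r hr => ?_⟩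
  · beta_reduce; split_ifs <;> omega
  obtain ⟨p, k, hp⟩ := hf.2 loc r hr
  obtain ⟨q, l, hq⟩ := hg.2 loc r hr
  obtain ⟨u, j, hu⟩ := hx.2 loc r hr
  obtain ⟨m, hm⟩ := (PolyBdd.add Γ.two_le (PolyBdd.add Γ.two_le
    ⟨k, fun _ => le_rfl⟩ ⟨l, fun ω => le_rfl⟩) (PolyBdd.add Γ.two_le ⟨j, fun ω => le_rfl⟩ hx.1))
  refine ⟨.seq u (.ite r p q), m, fun ω s hs => ?_⟩
  obtain ⟨t₁, s₁, a1, a2, a3, a4⟩ := hu ω s hs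
  have hs1 : ∀ i, s₁ (loc i) = Γ.var i ω := fun i => by rw [a3 _ (hr i), hs]
  have h1 := hm ω
  beta_reduce at h1
  by_cases h0 : 0 < x ω
  · obtain ⟨t₂, s₂, b1, b2, b3, b4⟩ := hp ω s₁ hs1
    refine ⟨_, _, Run.seq a1 (Run.ite_pos (by rwa [a2]) b1), ?_, fun y hy => ?_, ?_⟩
    · rw [b2]; exact (if_pos h0).symm
    · rw [b3 y hy, a3 y hy]
    · rw [a2]; omega
  · obtain ⟨t₂, s₂, b1, b2, b3, b4⟩ := hq ω s₁ hs1
    refine ⟨_, _, Run.seq a1 (Run.ite_neg (by rw [a2]; omega) b1), ?_, fun y hy => ?_, ?_⟩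
    · rw [b2]; exact (if_neg h0).symm
    · rw [b3 y hy, a3 y hy]
    · rw [a2]; omega

theorem ite_lt {x y : Ω → ℤ} (hx : PT Γ x) (hy : PT Γ y) (hf : PT Γ f) (hg : PT Γ g) :
    PT Γ fun ω => if x ω < y ω then f ω else g ω :=
  (ite_pos (hy.sub hx) hf hg).congr fun ω => by simp only [sub_pos]

theorem ite_eq {x y : Ω → ℤ} (hx : PT Γ x) (hy : PT Γ y) (hf : PT Γ f) (hg : PT Γ g) :
    PT Γ fun ω => if x ω = y ω then f ω else g ω :=
  (ite_lt hx hy hg (ite_lt hy hx hg hf)).congr fun ω => by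
    rcases lt_trichotomy (x ω) (y ω) with h | h | h
    · rw [if_pos h, if_neg h.ne]
    · simp [h]
    · rw [if_neg h.not_gt, if_pos h, if_neg h.ne']

end PT

/-! ### Loops -/

/-- The context with a loop index below `cnt` as a new variable. -/
def Ctx.loop {Ω : Type} (Γ : Ctx Ω) (cnt : Ω → ℕ) (hc : PolyBdd Γ.sz cnt) :
    Ctx {x : Ω × ℕ // x.2 < cnt x.1} where
  sz x := Γ.sz x.1.1
  two_le x := Γ.two_le _
  inp x := Γ.inp x.1.1
  inp_bdd := by
    obtain ⟨k, hk⟩ := Γ.inp_bdd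
    exact ⟨k, fun x m => hk _ m⟩
  Idx := Option Γ.Idx
  var i x := i.elim (x.1.2 : ℤ) fun i => Γ.var i x.1.1
  var_bdd i := by
    cases i with
    | none => exact (hc.comp fun x : {x : Ω × ℕ // x.2 < cnt x.1} => x.1.1).mono fun x =>
        (bits_natCast_le _).trans x.2
    | some i => exact (Γ.var_bdd i).comp fun x : {x : Ω × ℕ // x.2 < cnt x.1} => x.1.1

/-- The context with one more variable. -/
def Ctx.push {Ω : Type} (Γ : Ctx Ω) (v : Ω → ℤ) (hv : PolyBdd Γ.sz fun ω => bits (v ω)) :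
    Ctx Ω where
  sz := Γ.sz
  two_le := Γ.two_le
  inp := Γ.inp
  inp_bdd := Γ.inp_bdd
  Idx := Option Γ.Idx
  var i ω := i.elim (v ω) fun i => Γ.var i ω
  var_bdd i := by
    cases i with
    | none => exact hv
    | some i => exact Γ.var_bdd i

section Loops

variable {Ω : Type} {Γ : Ctx Ω}

theorem Ext.loop {cnt : Ω → ℕ} (hc : PolyBdd Γ.sz cnt) :
    Ext Γ (Γ.loop cnt hc) fun x => x.1.1 :=
  ⟨fun _ => rfl, fun _ => rfl, some, fun _ _ => rfl⟩

theorem Ext.push {v : Ω → ℤ} (hv : PolyBdd Γ.sz fun ω => bits (v ω)) :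
    Ext Γ (Γ.push v hv) fun ω => ω :=
  ⟨fun _ => rfl, fun _ => rfl, some, fun _ _ => rfl⟩

theorem PT.loopVar {cnt : Ω → ℕ} (hc : PolyBdd Γ.sz cnt) :
    PT (Γ.loop cnt hc) fun x => (x.1.2 : ℤ) := PT.var (Γ := Γ.loop cnt hc) none

theorem PT.pushVar {v : Ω → ℤ} (hv : PolyBdd Γ.sz fun ω => bits (v ω)) :
    PT (Γ.push v hv) v := PT.var (Γ := Γ.push v hv) none

/-- Iteration: `acc ω (i + 1)` is computed from `i` and `acc ω i`. -/
theorem PT.iter {cnt : Ω → ℕ} {acc : Ω → ℕ → ℤ} (hcnt : PT Γ fun ω => (cnt ω : ℤ))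
    (hc : PolyBdd Γ.sz cnt) (h0 : PT Γ fun ω => acc ω 0)
    (hb : ∃ k, ∀ ω, ∀ i ≤ cnt ω, bits (acc ω i) ≤ Γ.sz ω ^ k)
    (hb' : PolyBdd (Γ.loop cnt hc).sz fun x => bits (acc x.1.1 x.1.2))
    (hstep : PT ((Γ.loop cnt hc).push (fun x => acc x.1.1 x.1.2) hb')
      fun x => acc x.1.1 (x.1.2 + 1)) :
    PT Γ fun ω => acc ω (cnt ω) := by
  obtain ⟨b, hb⟩ := hb
  refine ⟨⟨b, fun ω => hb ω _ le_rfl⟩, fun loc r hr => ?_⟩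
  obtain ⟨p, k, hp⟩ := h0.2 loc r hr
  obtain ⟨q, l, hq⟩ := hcnt.2 loc (r + 2) fun i => by have := hr i; omega
  -- Register layout: r holds the accumulator, r + 1 the loop index, r + 2 the number of rounds
  -- left, r + 3 receives the next accumulator and r + 4 is scratch. The pushed variable and the
  -- loop variable of the context are placed at r and r + 1 accordingly.
  obtain ⟨u, j, hu⟩ := hstep.2 (fun i => i.elim r fun i => i.elim (r + 1) loc) (r + 3) (by
    rintro (_ | _ | i)
    · exact Nat.lt_add_of_pos_right (by norm_num)
    · exact Nat.add_lt_add_left (by norm_num) r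
    · exact (hr i).trans (Nat.lt_add_of_pos_right (by norm_num)))
  set body : Prog := .seq u (.seq (.const (r + 4) 0) (.seq (.add r (r + 3) (r + 4))
    (.seq (.const (r + 4) 1) (.seq (.add (r + 1) (r + 1) (r + 4))
      (.sub (r + 2) (r + 2) (r + 4)))))) with hbody
  have hstepcost : PolyBdd Γ.sz fun ω => (cnt ω + 1) + (Γ.sz ω ^ j + (bits 0
      + (Γ.sz ω ^ b + bits 0 + (bits 1 + ((cnt ω + 1) + bits 1 + ((cnt ω + 1) + bits 1)))))) := by
    have h2 := Γ.two_le
    have hC := hc.add h2 (PolyBdd.const h2 1)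
    exact hC.add h2 (PolyBdd.add h2 ⟨j, fun ω => le_rfl⟩ ((PolyBdd.const h2 _).add h2
      ((PolyBdd.add h2 ⟨b, fun _ => le_rfl⟩ (PolyBdd.const h2 _)).add h2
        ((PolyBdd.const h2 _).add h2 ((hC.add h2 (PolyBdd.const h2 _)).add h2
          (hC.add h2 (PolyBdd.const h2 _)))))))
  -- Induction on the number m of rounds left; the index is then cnt - m, and the cost is at most m
  -- times the cost of a round plus 1 for the final test.
  have hloop : ∀ ω, ∀ m, ∀ s : ℕ → ℤ, m ≤ cnt ω → (∀ i, s (loc i) = Γ.var i ω) →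
      s r = acc ω (cnt ω - m) → s (r + 1) = ((cnt ω - m : ℕ) : ℤ) → s (r + 2) = m →
      ∃ t s', Run (Γ.inp ω) (.loop (r + 2) body) s t s' ∧ s' r = acc ω (cnt ω) ∧
        (∀ x < r, s' x = s x) ∧ t ≤ 1 + m * ((cnt ω + 1) + (Γ.sz ω ^ j + (bits 0
      + (Γ.sz ω ^ b + bits 0 + (bits 1 + ((cnt ω + 1) + bits 1 + ((cnt ω + 1) + bits 1))))))) := by
    intro ω m
    induction m with
    | zero =>
      intro s _ _ h1 _ h3
      refine ⟨_, s, Run.loop_neg (by rw [h3]; simp), by rw [h1, Nat.sub_zero], fun _ _ => rfl, ?_⟩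
      rw [h3]; simp [bits]
    | succ m ih =>
      intro s hm hs h1 h2 h3
      obtain ⟨t₁, s₁, a1, a2, a3, a4⟩ := hu ⟨(ω, cnt ω - (m + 1)), by simp; omega⟩ s (by
        rintro (_ | _ | i)
        · exact h1
        · exact h2
        · exact hs i)
      have e1 : cnt ω - (m + 1) + 1 = cnt ω - m := by omega
      simp only [e1] at a2
      change t₁ ≤ Γ.sz ω ^ j at a4
      set s₂ := Function.update s₁ (r + 4) 0 with hs2
      set s₃ := Function.update s₂ r (s₂ (r + 3) + s₂ (r + 4)) with hs3
      set s₄ := Function.update s₃ (r + 4) 1 with hs4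
      set s₅ := Function.update s₄ (r + 1) (s₄ (r + 1) + s₄ (r + 4)) with hs5
      set s₆ := Function.update s₅ (r + 2) (s₅ (r + 2) - s₅ (r + 4)) with hs6
      have c23 : s₂ (r + 3) = acc ω (cnt ω - m) := by
        rw [hs2, Function.update_of_ne (by omega), a2]
      have c24 : s₂ (r + 4) = 0 := Function.update_self ..
      have c41 : s₄ (r + 1) = ((cnt ω - (m + 1) : ℕ) : ℤ) := by
        rw [hs4, Function.update_of_ne (by omega), hs3, Function.update_of_ne (by omega),
          hs2, Function.update_of_ne (by omega), a3 _ (by omega), h2]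
      have c44 : s₄ (r + 4) = 1 := Function.update_self ..
      have c52 : s₅ (r + 2) = ((m + 1 : ℕ) : ℤ) := by
        rw [hs5, Function.update_of_ne (by omega), hs4, Function.update_of_ne (by omega), hs3,
          Function.update_of_ne (by omega), hs2, Function.update_of_ne (by omega), a3 _ (by omega), h3]
      have c54 : s₅ (r + 4) = 1 := by
        rw [hs5, Function.update_of_ne (by omega), c44]
      have hlow : ∀ x < r, s₆ x = s x := fun x hx => by
        rw [hs6, Function.update_of_ne (by omega), hs5, Function.update_of_ne (by omega), hs4,
          Function.update_of_ne (by omega), hs3, Function.update_of_ne (by omega),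
          hs2, Function.update_of_ne (by omega), a3 _ (by omega)]
      have d0 : s₆ r = acc ω (cnt ω - m) := by
        rw [hs6, Function.update_of_ne (by omega), hs5, Function.update_of_ne (by omega), hs4,
          Function.update_of_ne (by omega), hs3, Function.update_self, c23, c24, add_zero]
      have d1 : s₆ (r + 1) = ((cnt ω - m : ℕ) : ℤ) := by
        rw [hs6, Function.update_of_ne (by omega), hs5, Function.update_self, c41, c44, ← e1]
        push_cast
        rfl
      have d2 : s₆ (r + 2) = m := by
        rw [hs6, Function.update_self, c52, c54]
        push_cast
        ring
      obtain ⟨t₂, s', b1, b2, b3, b4⟩ := ih s₆ (by omega)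
        (fun i => by rw [hlow _ (hr i), hs]) d0 d1 d2
      have hrun : Run (Γ.inp ω) body s (t₁ + (bits 0 + (bits (s₂ (r + 3)) + bits (s₂ (r + 4))
          + (bits 1 + (bits (s₄ (r + 1)) + bits (s₄ (r + 4))
            + (bits (s₅ (r + 2)) + bits (s₅ (r + 4)))))))) s₆ :=
        Run.seq a1 (Run.seq (Run.const (r + 4) 0 s₁) (Run.seq (Run.add r (r + 3) (r + 4) s₂)
          (Run.seq (Run.const (r + 4) 1 s₃) (Run.seq (Run.add (r + 1) (r + 1) (r + 4) s₄)
            (Run.sub (r + 2) (r + 2) (r + 4) s₅)))))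
      refine ⟨_, s', Run.loop_pos (by rw [h3]; positivity) hrun b1, b2,
        fun x hx => by rw [b3 x hx, hlow x hx], ?_⟩
      rw [h3, c23, c24, c41, c44, c52, c54]
      have f1 := bits_natCast_le (m + 1)
      have f2 := bits_natCast_le (cnt ω - (m + 1))
      have f3 := hb ω (cnt ω - m) (Nat.sub_le _ _)
      rw [Nat.succ_mul]
      omega
  obtain ⟨w, hw⟩ := (PolyBdd.add Γ.two_le (PolyBdd.add Γ.two_le
    ⟨k, fun _ => le_rfl⟩ ⟨l, fun ω => le_rfl⟩) (PolyBdd.add Γ.two_le (PolyBdd.const Γ.two_le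
      (bits 0)) ((PolyBdd.const Γ.two_le 1).add Γ.two_le (hc.mul hstepcost))))
  refine ⟨.seq (.seq p q) (.seq (.const (r + 1) 0) (.loop (r + 2) body)), w, fun ω s hs => ?_⟩
  obtain ⟨t₁, s₁, a1, a2, a3, a4⟩ := hp ω s hs
  obtain ⟨t₂, s₂, b1, b2, b3, b4⟩ := hq ω s₁ fun i => by rw [a3 _ (hr i), hs]
  set s₃ := Function.update s₂ (r + 1) 0 with hs3
  have hlow : ∀ x < r, s₃ x = s x := fun x hx => by
    rw [hs3, Function.update_of_ne (by omega), b3 _ (by omega), a3 _ hx]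
  obtain ⟨t₄, s', c1, c2, c3, c4⟩ := hloop ω (cnt ω) s₃ le_rfl
    (fun i => by rw [hlow _ (hr i), hs])
    (by rw [hs3, Function.update_of_ne (by omega), b3 _ (by omega), a2, Nat.sub_self])
    (by rw [hs3, Function.update_self, Nat.sub_self]; rfl)
    (by rw [hs3, Function.update_of_ne (by omega), b2])
  refine ⟨_, s', Run.seq (Run.seq a1 b1) (Run.seq (Run.const (r + 1) 0 s₂) c1), c2,
    fun x hx => by rw [c3 x hx, hlow x hx], ?_⟩
  have := hw ω
  beta_reduce at this
  omega

end Loops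

end Majorana

namespace Majorana

/-- Computability of a family of natural numbers. -/
abbrev PTN {Ω : Type} (Γ : Ctx Ω) (c : Ω → ℕ) : Prop := PT Γ fun ω => (c ω : ℤ)

/-- Computability of a family of functions on `{0, …, D - 1}`: `F` can be evaluated at every
computable index, in every extension of the context. -/
def PTF {Ω : Type} (Γ : Ctx Ω) (D : Ω → ℕ) (F : Ω → ℕ → ℤ) : Prop :=
  ∀ (Ω' : Type) (Γ' : Ctx Ω') (h : Ω' → Ω), Ext Γ Γ' h → ∀ j : Ω' → ℕ, PTN Γ' j →
    (∀ ω, j ω < D (h ω)) → PT Γ' fun ω => F (h ω) (j ω)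

/-! ### Bounded sums, products and powers -/

section Derived

variable {Ω : Type} {Γ : Ctx Ω}

theorem PTF.lift {D : Ω → ℕ} {F : Ω → ℕ → ℤ} (hF : PTF Γ D F) {Ω' : Type} {Γ' : Ctx Ω'}
    {h : Ω' → Ω} (e : Ext Γ Γ' h) : PTF Γ' (fun ω => D (h ω)) fun ω i => F (h ω) i :=
  fun _ Γ'' h' e' j hj hjD => hF _ Γ'' (fun ω => h (h' ω)) (e.trans e') j hj hjD

/-- Evaluation at the loop index is one function in one context, so its polynomial bit bound is
uniform in i. -/
theorem PTF.bits_le {D : Ω → ℕ} {F : Ω → ℕ → ℤ} (hF : PTF Γ D F) (hD : PolyBdd Γ.sz D) :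
    ∃ k, ∀ ω, ∀ i < D ω, bits (F ω i) ≤ Γ.sz ω ^ k := by
  obtain ⟨k, hk⟩ := (hF _ (Γ.loop D hD) _ (Ext.loop hD) (fun x => x.1.2) (PT.loopVar hD)
    fun x => x.2).1
  exact ⟨k, fun ω i hi => hk ⟨(ω, i), hi⟩⟩

/-- Sums and products share this proof. The bound `hb` on partial results is essential: it keeps
every accumulator at polynomially many bits. -/
theorem PT.fold {o : ℤ → ℤ → ℤ} (ho : ∀ {Ω : Type} {Γ : Ctx Ω} {f g : Ω → ℤ}, PT Γ f → PT Γ g →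
      PT Γ fun ω => o (f ω) (g ω))
    {R : ℕ → (ℕ → ℤ) → ℤ} (c : ℤ) (hR0 : ∀ f, R 0 f = c)
    (hR : ∀ m f, R (m + 1) f = o (R m f) (f m))
    (hb : ∀ m B f, (∀ i < m, bits (f i) ≤ B) → bits (R m f) ≤ m * B + 2)
    {cnt : Ω → ℕ} {F : Ω → ℕ → ℤ} (hcnt : PTN Γ cnt) (hc : PolyBdd Γ.sz cnt)
    (hF : PTF Γ cnt F) : PT Γ fun ω => R (cnt ω) (F ω) := by
  obtain ⟨k, hk⟩ := hF.bits_le hc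
  obtain ⟨l, hl⟩ := (hc.mul ⟨k, fun _ => le_rfl⟩).add Γ.two_le (PolyBdd.const Γ.two_le 2)
  have hbd : ∀ ω, ∀ i ≤ cnt ω, bits (R i (F ω)) ≤ Γ.sz ω ^ l := fun ω i hi =>
    ((hb i _ _ fun j hj => hk ω j (hj.trans_le hi)).trans
      (Nat.add_le_add_right (Nat.mul_le_mul_right _ hi) 2)).trans (hl ω)
  have hbd' : PolyBdd (Γ.loop cnt hc).sz fun x => bits (R x.1.2 (F x.1.1)) :=
    ⟨l, fun x => hbd _ _ x.2.le⟩
  refine PT.iter (acc := fun ω i => R i (F ω)) hcnt hc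
    ((PT.const c).congr fun ω => (hR0 _).symm) ⟨l, hbd⟩ hbd' ?_
  refine (ho (PT.pushVar hbd') (hF _ _ _ ((Ext.loop hc).trans (Ext.push hbd')) (fun x => x.1.2)
    ((PT.loopVar hc).lift (Ext.push hbd')) fun x => x.2)).congr fun x => ?_
  rw [hR]

theorem PT.sum {cnt : Ω → ℕ} {F : Ω → ℕ → ℤ} (hcnt : PTN Γ cnt) (hc : PolyBdd Γ.sz cnt)
    (hF : PTF Γ cnt F) : PT Γ fun ω => ∑ i ∈ Finset.range (cnt ω), F ω i :=
  PT.fold (o := fun a b => a + b) PT.add (R := fun m f => ∑ i ∈ Finset.range m, f i) 0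
    (fun _ => rfl) (fun m f => Finset.sum_range_succ f m)
    (fun m B f h => (bits_sum_le m B f h).trans (Nat.le_succ _)) hcnt hc hF

theorem PT.prod {cnt : Ω → ℕ} {F : Ω → ℕ → ℤ} (hcnt : PTN Γ cnt) (hc : PolyBdd Γ.sz cnt)
    (hF : PTF Γ cnt F) : PT Γ fun ω => ∏ i ∈ Finset.range (cnt ω), F ω i :=
  PT.fold (o := fun a b => a * b) PT.mul (R := fun m f => ∏ i ∈ Finset.range m, f i) 1
    (fun _ => rfl) (fun m f => Finset.prod_range_succ f m) bits_prod_le hcnt hc hF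

theorem PT.pow {x : Ω → ℤ} {e : Ω → ℕ} (hx : PT Γ x) (he : PTN Γ e) (hb : PolyBdd Γ.sz e) :
    PT Γ fun ω => x ω ^ e ω :=
  (PT.prod (F := fun ω _ => x ω) he hb fun _ Γ' h e' j _ _ => hx.lift e').congr fun ω => by simp

theorem PT.pow_const {x : Ω → ℤ} (hx : PT Γ x) (e : ℕ) : PT Γ fun ω => x ω ^ e :=
  hx.pow (PT.const _) (PolyBdd.const Γ.two_le e)

theorem PTN.const (c : ℕ) : PTN Γ fun _ => c := PT.const _

theorem PTN.add {a b : Ω → ℕ} (ha : PTN Γ a) (hb : PTN Γ b) : PTN Γ fun ω => a ω + b ω :=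
  (PT.add ha hb).congr fun ω => by push_cast; rfl

theorem PTN.mul {a b : Ω → ℕ} (ha : PTN Γ a) (hb : PTN Γ b) : PTN Γ fun ω => a ω * b ω :=
  (PT.mul ha hb).congr fun ω => by push_cast; rfl

theorem PTN.div {a b : Ω → ℕ} (ha : PTN Γ a) (hb : PTN Γ b) : PTN Γ fun ω => a ω / b ω :=
  (PT.div ha hb).congr fun ω => by push_cast; rfl

theorem PTN.mod {a b : Ω → ℕ} (ha : PTN Γ a) (hb : PTN Γ b) : PTN Γ fun ω => a ω % b ω :=
  (PT.emod ha hb).congr fun ω => by push_cast; rfl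

theorem PTN.pow {a e : Ω → ℕ} (ha : PTN Γ a) (he : PTN Γ e) (hb : PolyBdd Γ.sz e) :
    PTN Γ fun ω => a ω ^ e ω :=
  (PT.pow ha he hb).congr fun ω => by push_cast; rfl

theorem PTN.pow_const {a : Ω → ℕ} (ha : PTN Γ a) (e : ℕ) : PTN Γ fun ω => a ω ^ e :=
  (PT.pow_const ha e).congr fun ω => by push_cast; rfl

/-! ### Vectors encoded as integers -/

theorem digit_eq {b : ℤ} (D : ℕ) (a : ℕ → ℤ) (h0 : ∀ i < D, 0 ≤ a i) (hb : ∀ i < D, a i < b)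
    {i : ℕ} (hi : i < D) : (∑ j ∈ Finset.range D, a j * b ^ j) / b ^ i % b = a i := by
  induction i generalizing D a with
  | zero =>
    obtain ⟨D, rfl⟩ : ∃ E, D = E + 1 := ⟨D - 1, by omega⟩
    rw [Finset.sum_range_succ', pow_zero, Int.ediv_one, mul_one]
    have : ∀ j ∈ Finset.range D, a (j + 1) * b ^ (j + 1) = (a (j + 1) * b ^ j) * b := fun j _ => by
      ring
    rw [Finset.sum_congr rfl this, ← Finset.sum_mul, add_comm, Int.add_mul_emod_self_right]
    exact Int.emod_eq_of_lt (h0 0 hi) (hb 0 hi)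
  | succ i ih =>
    obtain ⟨D, rfl⟩ : ∃ E, D = E + 1 := ⟨D - 1, by omega⟩
    have hbpos : 0 < b := (h0 _ hi).trans_lt (hb _ hi)
    have h1 : (∑ j ∈ Finset.range (D + 1), a j * b ^ j) / b
        = ∑ j ∈ Finset.range D, a (j + 1) * b ^ j := by
      rw [Finset.sum_range_succ', pow_zero, mul_one]
      have : ∀ j ∈ Finset.range D, a (j + 1) * b ^ (j + 1) = (a (j + 1) * b ^ j) * b :=
        fun j _ => by ring
      rw [Finset.sum_congr rfl this, ← Finset.sum_mul, add_comm, Int.add_mul_ediv_right _ _ hbpos.ne',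
        Int.ediv_eq_zero_of_lt (h0 0 (by omega)) (hb 0 (by omega)), zero_add]
    rw [pow_succ', ← Int.ediv_ediv_of_nonneg hbpos.le, h1]
    exact ih D (fun j => a (j + 1)) (fun j hj => h0 _ (by omega)) (fun j hj => hb _ (by omega))
      (by omega)

/-- The vector with entries `f 0, …, f (D - 1)` in `[-H, H)`, as one integer. -/
def encode (H : ℤ) (D : ℕ) (f : ℕ → ℤ) : ℤ := ∑ j ∈ Finset.range D, (f j + H) * (2 * H) ^ j

theorem decode_encode {H : ℤ} {D : ℕ} {f : ℕ → ℤ} (hf : ∀ i < D, -H ≤ f i ∧ f i < H) {i : ℕ}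
    (hi : i < D) : encode H D f / (2 * H) ^ i % (2 * H) - H = f i := by
  rw [encode, digit_eq D (fun j => f j + H) (fun j hj => by linarith [(hf j hj).1])
    (fun j hj => by linarith [(hf j hj).2]) hi]
  ring

theorem PT.encode {D : Ω → ℕ} {H : Ω → ℤ} {F : Ω → ℕ → ℤ} (hH : PT Γ H) (hD : PTN Γ D)
    (hDb : PolyBdd Γ.sz D) (hF : PTF Γ D F) : PT Γ fun ω => encode (H ω) (D ω) (F ω) :=
  PT.sum hD hDb fun _ Γ' h e j hj hjD =>
    ((hF _ Γ' h e j hj hjD).add (hH.lift e)).mul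
      (PT.pow ((PT.const 2).mul (hH.lift e)) hj ((e.polyBdd hDb).mono fun ω => (hjD ω).le))

theorem PTF.of_encode {D : Ω → ℕ} {H : Ω → ℤ} {F : Ω → ℕ → ℤ} (hH : PT Γ H)
    (hDb : PolyBdd Γ.sz D) (hE : PT Γ fun ω => Majorana.encode (H ω) (D ω) (F ω))
    (hF : ∀ ω, ∀ i < D ω, -H ω ≤ F ω i ∧ F ω i < H ω) : PTF Γ D F := by
  intro Ω' Γ' h e j hj hjD
  have h2H := (PT.const 2).mul (hH.lift e)
  exact ((((hE.lift e).div (h2H.pow hj ((e.polyBdd hDb).mono fun ω => (hjD ω).le))).emod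
    h2H).sub (hH.lift e)).congr fun ω => decode_encode (hF (h ω)) (hjD ω)

/-- Iteration of a vector-valued recursion. -/
theorem PTF.iter {cnt D : Ω → ℕ} {H : Ω → ℤ} {Y : Ω → ℕ → ℕ → ℤ} (hcnt : PTN Γ cnt)
    (hc : PolyBdd Γ.sz cnt) (hD : PTN Γ D) (hDb : PolyBdd Γ.sz D) (hH : PT Γ H)
    (hY : ∀ ω, ∀ t ≤ cnt ω, ∀ i < D ω, -H ω ≤ Y ω t i ∧ Y ω t i < H ω)
    (h0 : PTF Γ D fun ω i => Y ω 0 i)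
    (hstep : ∀ {Ω' : Type} (Γ' : Ctx Ω') (h : Ω' → Ω), Ext Γ Γ' h → ∀ t : Ω' → ℕ, PTN Γ' t →
      (∀ ω, t ω < cnt (h ω)) → PTF Γ' (fun ω => D (h ω)) (fun ω i => Y (h ω) (t ω) i) →
      PTF Γ' (fun ω => D (h ω)) fun ω i => Y (h ω) (t ω + 1) i) :
    PTF Γ D fun ω i => Y ω (cnt ω) i := by
  obtain ⟨kH, hkH⟩ := hH.1
  have hbase : PolyBdd Γ.sz fun ω => D ω * (Γ.sz ω ^ kH + bits 0 + D ω * (bits 2 + Γ.sz ω ^ kH)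
      + 4) + 2 := by
    have h2 := Γ.two_le
    exact ((hDb.mul (((PolyBdd.add h2 ⟨kH, fun _ => le_rfl⟩ (PolyBdd.const h2 _)).add h2
      (hDb.mul ((PolyBdd.const h2 _).add h2 ⟨kH, fun _ => le_rfl⟩))).add h2
        (PolyBdd.const h2 4))).add h2 (PolyBdd.const h2 2))
  obtain ⟨l, hl⟩ := hbase
  have hbd : ∀ ω, ∀ t ≤ cnt ω, bits (Majorana.encode (H ω) (D ω) (Y ω t)) ≤ Γ.sz ω ^ l := by
    intro ω t ht
    refine le_trans ?_ (hl ω)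
    refine (bits_sum_le (D ω) (Γ.sz ω ^ kH + bits 0 + D ω * (bits 2 + Γ.sz ω ^ kH) + 4) _ ?_).trans
      (Nat.le_succ _)
    intro j hj
    have h1 : bits (Y ω t j + H ω) ≤ bits 2 + Γ.sz ω ^ kH := by
      have h3 : bits (Y ω t j + H ω) ≤ bits (2 * H ω) := by
        have := hY ω t ht j hj
        apply bits_mono
        omega
      exact (h3.trans (bits_mul_le _ _)).trans (Nat.add_le_add_left (hkH ω) _)
    have h2 : bits ((2 * H ω) ^ j) ≤ D ω * (bits 2 + Γ.sz ω ^ kH) + 2 := by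
      have h3 := bits_prod_le j (bits 2 + Γ.sz ω ^ kH) (fun _ => 2 * H ω) fun _ _ =>
        (bits_mul_le _ _).trans (Nat.add_le_add_left (hkH ω) _)
      rw [Finset.prod_const, Finset.card_range] at h3
      exact h3.trans (Nat.add_le_add_right (Nat.mul_le_mul_right _ hj.le) 2)
    have h4 := bits_mul_le (Y ω t j + H ω) ((2 * H ω) ^ j)
    have h5 : bits 2 = 3 := by decide
    have h6 : bits 0 = 1 := by decide
    omega
  have hbd' : PolyBdd (Γ.loop cnt hc).sz fun x =>
      bits (Majorana.encode (H x.1.1) (D x.1.1) (Y x.1.1 x.1.2)) :=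
    ⟨l, fun x => hbd _ _ x.2.le⟩
  refine PTF.of_encode hH hDb ?_ fun ω => hY ω _ le_rfl
  -- The accumulator of a loop is a single integer, so the vector is packed as digits in base 2H and
  -- unpacked in each round. With polynomially many digits of polynomially many bits, the packed
  -- value stays polynomial in length.
  refine PT.iter (acc := fun ω t => Majorana.encode (H ω) (D ω) (Y ω t)) hcnt hc
    (PT.encode hH hD hDb h0) ⟨l, hbd⟩ hbd' ?_
  have hext := (Ext.loop hc).trans (Ext.push hbd')
  have hvec : PTF ((Γ.loop cnt hc).push _ hbd') (fun x => D x.1.1)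
      fun x i => Y x.1.1 x.1.2 i :=
    PTF.of_encode (hH.lift hext) (hext.polyBdd hDb) (PT.pushVar hbd') fun x =>
      hY x.1.1 x.1.2 x.2.le
  exact PT.encode (hH.lift hext) (hD.lift hext) (hext.polyBdd hDb)
    (hstep _ _ hext (fun x => x.1.2) ((PT.loopVar hc).lift (Ext.push hbd')) (fun x => x.2) hvec)

end Derived

end Majorana

namespace Majorana

open Matrix

/-! ### Trace powers of a positive semidefinite matrix -/

/-- The trace equals that of P A P. This is the reason for using even powers as weights. -/
theorem trace_mul_mul_self_nonneg {W : Type*} [Fintype W] {A P : Matrix W W ℝ} (hA : A.PosSemidef) (hP : P.IsHermitian) :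
    0 ≤ (A * (P * P)).trace := by
  rw [← mul_assoc, Matrix.trace_mul_comm, ← mul_assoc]
  have h := (hA.conjTranspose_mul_mul_same P).trace_nonneg
  rwa [hP.eq] at h

section Spectral

variable {W : Type*} [Fintype W] [DecidableEq W] {B : Matrix W W ℝ}

theorem trace_pow_eq_sum (hB : B.IsHermitian) (q : ℕ) :
    (B ^ q).trace = ∑ i, hB.eigenvalues i ^ q := by
  conv_lhs => rw [hB.spectral_theorem]
  rw [← map_pow, Unitary.conjStarAlgAut_apply, Matrix.trace_mul_comm, ← mul_assoc,
    Unitary.coe_star_mul_self, one_mul, Matrix.diagonal_pow, Matrix.trace_diagonal]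
  rfl

theorem posSemidef_smul_one_sub (hB : B.IsHermitian) {μ : ℝ} (h : ∀ i, hB.eigenvalues i ≤ μ) :
    (μ • (1 : Matrix W W ℝ) - B).PosSemidef := by
  have h1 : μ • (1 : Matrix W W ℝ) - B = (hB.eigenvectorUnitary : Matrix W W ℝ)
      * diagonal (fun i => μ - hB.eigenvalues i) * (hB.eigenvectorUnitary : Matrix W W ℝ)ᴴ := by
    have h2 : diagonal (fun i => μ - hB.eigenvalues i)
        = μ • (1 : Matrix W W ℝ) - diagonal hB.eigenvalues := by
      ext i j
      by_cases hij : i = j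
      · subst hij; simp
      · simp [hij]
    rw [h2, Matrix.mul_sub, Matrix.sub_mul, Matrix.mul_smul, Matrix.mul_one, Matrix.smul_mul]
    congr 1
    · rw [← Matrix.star_eq_conjTranspose, Matrix.mem_unitaryGroup_iff.mp hB.eigenvectorUnitary.2]
    · conv_lhs => rw [hB.spectral_theorem, Unitary.conjStarAlgAut_apply]
      rfl
  rw [h1]
  exact (PosSemidef.diagonal fun i => sub_nonneg.mpr (h i)).mul_mul_conjTranspose_same _

/-- Factor μ^(q+1) - x^(q+1) as (μ - x) ∑ μ^i x^(q-i); each of the q + 1 summands is at least x^q.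
-/
theorem succ_mul_pow_mul_sub_le {x μ : ℝ} (hx : 0 ≤ x) (hxμ : x ≤ μ) (q : ℕ) :
    (q + 1) * (x ^ q * (μ - x)) ≤ μ ^ (q + 1) := by
  have h1 : ∑ i ∈ Finset.range (q + 1), x ^ q ≤ ∑ i ∈ Finset.range (q + 1), μ ^ i * x ^ (q - i) := by
    refine Finset.sum_le_sum fun i hi => ?_
    have hi' : i ≤ q := Nat.lt_succ_iff.mp (Finset.mem_range.mp hi)
    calc x ^ q = x ^ i * x ^ (q - i) := by rw [← pow_add, Nat.add_sub_cancel' hi']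
      _ ≤ _ := mul_le_mul_of_nonneg_right (pow_le_pow_left₀ hx hxμ i) (pow_nonneg hx _)
  rw [Finset.sum_const, Finset.card_range, nsmul_eq_mul] at h1
  have h2 := Commute.geom_sum₂_mul (Commute.all μ x) (q + 1)
  have h3 := mul_le_mul_of_nonneg_right h1 (sub_nonneg.mpr hxμ)
  simp only [Nat.add_sub_cancel] at h2
  rw [h2] at h3
  push_cast at h3
  have h4 := pow_nonneg hx (q + 1)
  linarith

/-- A ratio of consecutive trace powers approximates the largest eigenvalue. -/
theorem posSemidef_trace_ratio [Nonempty W] (hB : B.PosSemidef) (q : ℕ) :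
    (((B ^ (q + 1)).trace + Fintype.card W * B.trace / (q + 1) * (B ^ q).trace)
      • (1 : Matrix W W ℝ) - (B ^ q).trace • B).PosSemidef := by
  set l := hB.1.eigenvalues with hl
  obtain ⟨i₀, hi₀⟩ := Finite.exists_max l
  have hl0 : ∀ i, 0 ≤ l i := hB.eigenvalues_nonneg
  have hq : (B ^ q).trace = ∑ i, l i ^ q := trace_pow_eq_sum hB.1 q
  have hq1 : (B ^ (q + 1)).trace = ∑ i, l i ^ (q + 1) := trace_pow_eq_sum hB.1 (q + 1)
  have h1 : B.trace = ∑ i, l i := by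
    have := trace_pow_eq_sum hB.1 1
    simpa using this
  have hμ : l i₀ ≤ B.trace := by
    rw [h1]
    exact Finset.single_le_sum (fun i _ => hl0 i) (Finset.mem_univ i₀)
  have htq : l i₀ ^ q ≤ (B ^ q).trace := by
    rw [hq]
    exact Finset.single_le_sum (f := fun i => l i ^ q) (fun i _ => pow_nonneg (hl0 i) q)
      (Finset.mem_univ i₀)
  -- With μ the largest eigenvalue, the left side is ∑ λ_i^q (μ - λ_i), at most W μ^(q+1) / (q + 1)
  -- for W eigenvalues; then μ ≤ tr B and μ^q ≤ tr B^q.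
  have hkey : l i₀ * (B ^ q).trace - (B ^ (q + 1)).trace
      ≤ Fintype.card W * B.trace / (q + 1) * (B ^ q).trace := by
    have h2 : (q + 1) * (l i₀ * (B ^ q).trace - (B ^ (q + 1)).trace)
        ≤ Fintype.card W * l i₀ ^ (q + 1) := by
      rw [hq, hq1, Finset.mul_sum, ← Finset.sum_sub_distrib, Finset.mul_sum]
      refine (Finset.sum_le_sum fun i _ => ?_).trans_eq
        (by rw [Finset.sum_const, Finset.card_univ, nsmul_eq_mul])
      refine le_trans (le_of_eq ?_) (succ_mul_pow_mul_sub_le (hl0 i) (hi₀ i) q)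
      ring
    have h3 : (Fintype.card W : ℝ) * l i₀ ^ (q + 1)
        ≤ Fintype.card W * B.trace * (B ^ q).trace := by
      rw [pow_succ', mul_assoc]
      refine mul_le_mul_of_nonneg_left ?_ (Nat.cast_nonneg _)
      exact mul_le_mul hμ htq (pow_nonneg (hl0 _) _) ((hl0 i₀).trans hμ)
    have hpos : (0 : ℝ) < q + 1 := by positivity
    rw [div_mul_eq_mul_div, le_div_iff₀ hpos]
    linarith
  have hsplit : ((B ^ (q + 1)).trace + Fintype.card W * B.trace / (q + 1) * (B ^ q).trace)
      • (1 : Matrix W W ℝ) - (B ^ q).trace • B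
      = ((B ^ (q + 1)).trace + Fintype.card W * B.trace / (q + 1) * (B ^ q).trace
        - l i₀ * (B ^ q).trace) • (1 : Matrix W W ℝ)
        + (B ^ q).trace • (l i₀ • (1 : Matrix W W ℝ) - B) := by
    rw [smul_sub, sub_smul, smul_smul, mul_comm (l i₀)]
    abel
  rw [hsplit]
  refine (PosSemidef.one.smul (by linarith)).add ((posSemidef_smul_one_sub hB.1 hi₀).smul ?_)
  exact (pow_nonneg (hl0 i₀) q).trans htq

theorem trace_pow_pos [Nonempty W] (hB : B.PosDef) (q : ℕ) : 0 < (B ^ q).trace := by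
  rw [trace_pow_eq_sum hB.1]
  exact Finset.sum_pos (fun i _ => pow_pos (hB.eigenvalues_pos i) q) Finset.univ_nonempty

end Spectral

/-! ### The subgradient method for a semidefinite program -/

section Subgradient

variable {V W : Type*} [Fintype V]

/-- The affine matrix function of a semidefinite program. -/
def pencil (M₀ : Matrix W W ℝ) (K : V → Matrix W W ℝ) (y : V → ℝ) : Matrix W W ℝ :=
  M₀ + ∑ v, y v • K v

variable {M₀ : Matrix W W ℝ} {K : V → Matrix W W ℝ} {b : V → ℝ} {R val : ℝ}

theorem trace_pencil_mul [Fintype W] (y : V → ℝ) (X : Matrix W W ℝ) :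
    (pencil M₀ K y * X).trace = (M₀ * X).trace + ∑ v, y v * (K v * X).trace := by
  rw [pencil, Matrix.add_mul, Matrix.trace_add, Matrix.sum_mul, Matrix.trace_sum]
  simp only [Matrix.smul_mul, Matrix.trace_smul, smul_eq_mul]

/-- The penalised objective is at most slightly above the optimal value. -/
theorem penalized_le [DecidableEq W] (h0 : 0 ≤ val) (hR : val ≤ R)
    (hdual : ∀ (y : V → ℝ) (δ : ℝ), 0 ≤ δ → (pencil M₀ K y + δ • (1 : Matrix W W ℝ)).PosSemidef →
      ∑ v, b v * y v ≤ (1 + δ) * val)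
    {y : V → ℝ} {ρ ε : ℝ} (hε : 0 ≤ ε)
    (hy : (pencil M₀ K y + (ε - ρ) • (1 : Matrix W W ℝ)).PosSemidef) :
    ∑ v, b v * y v + (if ρ < 0 then R else 0) * ρ ≤ val + R * ε := by
  have hmax : (pencil M₀ K y + max 0 (ε - ρ) • (1 : Matrix W W ℝ)).PosSemidef := by
    have h := hy.add ((PosSemidef.one (n := W) (R := ℝ)).smul
      (sub_nonneg.mpr (le_max_right 0 (ε - ρ))))
    rwa [add_assoc, ← add_smul, add_sub_cancel] at h
  have h1 := hdual y _ (le_max_left _ _) hmax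
  -- For ρ < 0 the bound is (1 + ε - ρ) val + Rρ = val + ε val + ρ (R - val), and the last term is
  -- nonpositive: this is where R ≥ val makes the penalty exact.
  split_ifs with hρ
  · rw [max_eq_right (by linarith)] at h1
    nlinarith
  · have h2 : max 0 (ε - ρ) ≤ ε := max_le hε (by linarith)
    nlinarith [mul_le_mul_of_nonneg_right h2 h0]

/-- The subgradient inequality for the penalised objective. -/
theorem sub_penalized_le [Fintype W] {y z : V → ℝ} {X : Matrix W W ℝ} {r : ℝ} (hr : 0 ≤ r)
    (hz : 0 ≤ (pencil M₀ K z * X).trace) :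
    ∑ v, b v * z v - (∑ v, b v * y v + r * (pencil M₀ K y * X).trace)
      ≤ ∑ v, (b v + r * (K v * X).trace) * (z v - y v) := by
  have h := mul_nonneg hr hz
  have e : ∑ v, (b v + r * (K v * X).trace) * (z v - y v)
      = ∑ v, b v * z v - ∑ v, b v * y v
        + r * ((pencil M₀ K z * X).trace - (pencil M₀ K y * X).trace) := by
    rw [trace_pencil_mul, trace_pencil_mul, add_sub_add_left_eq_sub, ← Finset.sum_sub_distrib,
      ← Finset.sum_sub_distrib, Finset.mul_sum, ← Finset.sum_add_distrib]
    exact Finset.sum_congr rfl fun v _ => by ring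
  linarith

/-- The regret of gradient steps of size `1 / s`. -/
theorem regret_le {s : ℝ} (hs : 0 < s) (y : ℕ → V → ℝ) (z : V → ℝ) (h0 : ∀ v, y 0 v = 0)
    (T : ℕ) :
    ∑ t ∈ Finset.range T, ∑ v, s * (y (t + 1) v - y t v) * (z v - y t v)
      ≤ s / 2 * ∑ v, z v ^ 2
        + (∑ t ∈ Finset.range T, ∑ v, (s * (y (t + 1) v - y t v)) ^ 2) / (2 * s) := by
  -- An exact telescoping identity for the squared distance to the comparison point z.
  have key : ∑ t ∈ Finset.range T, ∑ v, s * (y (t + 1) v - y t v) * (z v - y t v)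
      = s / 2 * ∑ v, z v ^ 2 - s / 2 * ∑ v, (z v - y T v) ^ 2
        + (∑ t ∈ Finset.range T, ∑ v, (s * (y (t + 1) v - y t v)) ^ 2) / (2 * s) := by
    induction T with
    | zero => simp [h0]
    | succ T ih =>
      rw [Finset.sum_range_succ, ih, Finset.sum_range_succ, add_div]
      have : ∑ v, s * (y (T + 1) v - y T v) * (z v - y T v)
          = s / 2 * ∑ v, (z v - y T v) ^ 2 - s / 2 * ∑ v, (z v - y (T + 1) v) ^ 2
            + (∑ v, (s * (y (T + 1) v - y T v)) ^ 2) / (2 * s) := by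
        rw [Finset.mul_sum, Finset.mul_sum, ← Finset.sum_sub_distrib, Finset.sum_div,
          ← Finset.sum_add_distrib]
        refine Finset.sum_congr rfl fun v _ => ?_
        field_simp
        ring
      rw [this]
      ring
  rw [key]
  have : 0 ≤ s / 2 * ∑ v, (z v - y T v) ^ 2 :=
    mul_nonneg (by positivity) (Finset.sum_nonneg fun _ _ => sq_nonneg _)
  linarith

/-- Convergence of the subgradient method with inexact eigenvectors and rounded steps. -/
theorem subgradient_converges [Fintype W] [DecidableEq W] {s ε γ Y : ℝ} (hs : 0 < s) (hε : 0 ≤ ε) (h0 : 0 ≤ val)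
    (hR : val ≤ R)
    (hdual : ∀ (y : V → ℝ) (δ : ℝ), 0 ≤ δ → (pencil M₀ K y + δ • (1 : Matrix W W ℝ)).PosSemidef →
      ∑ v, b v * y v ≤ (1 + δ) * val)
    {z : V → ℝ} (hz1 : ∀ v, |z v| ≤ 1) (hz : (pencil M₀ K z).PosSemidef)
    (hzval : ∑ v, b v * z v = val) {y : ℕ → V → ℝ} {X : ℕ → Matrix W W ℝ} {T : ℕ}
    (hy0 : ∀ v, y 0 v = 0)
    (hX : ∀ t < T, ∃ (c : ℝ) (P : Matrix W W ℝ), 0 ≤ c ∧ P.IsHermitian ∧ X t = c • (P * P))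
    (happ : ∀ t < T, (pencil M₀ K (y t)
      + (ε - (pencil M₀ K (y t) * X t).trace) • (1 : Matrix W W ℝ)).PosSemidef)
    (hstep : ∀ t < T, ∀ v, |s * (y (t + 1) v - y t v)
      - (b v + (if (pencil M₀ K (y t) * X t).trace < 0 then R else 0) * (K v * X t).trace)| ≤ 1)
    (hγ : ∀ t < T, ∀ v, |s * (y (t + 1) v - y t v)| ≤ γ) (hY : ∀ t < T, ∀ v, |y t v| ≤ Y) :
    (∑ t ∈ Finset.range T, (∑ v, b v * y t v
      + (if (pencil M₀ K (y t) * X t).trace < 0 then R else 0) * (pencil M₀ K (y t) * X t).trace)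
      ≤ T * (val + R * ε)) ∧
    T * val - s / 2 * Fintype.card V - T * (Fintype.card V * γ ^ 2) / (2 * s)
      - T * (Fintype.card V * (1 + Y)) ≤
    ∑ t ∈ Finset.range T, (∑ v, b v * y t v
      + (if (pencil M₀ K (y t) * X t).trace < 0 then R else 0)
        * (pencil M₀ K (y t) * X t).trace) := by
  have hR0 : 0 ≤ R := h0.trans hR
  constructor
  · refine (Finset.sum_le_sum fun t ht => penalized_le h0 hR hdual hε
      (happ t (Finset.mem_range.mp ht))).trans_eq ?_
    rw [Finset.sum_const, Finset.card_range, nsmul_eq_mul]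
  · have hlow : ∀ t ∈ Finset.range T, val - (∑ v, b v * y t v
        + (if (pencil M₀ K (y t) * X t).trace < 0 then R else 0) * (pencil M₀ K (y t) * X t).trace)
        ≤ ∑ v, s * (y (t + 1) v - y t v) * (z v - y t v) + Fintype.card V * (1 + Y) := by
      intro t ht
      have htT := Finset.mem_range.mp ht
      set r : ℝ := if (pencil M₀ K (y t) * X t).trace < 0 then R else 0 with hr
      have hr0 : 0 ≤ r := by rw [hr]; split_ifs <;> [exact hR0; exact le_rfl]
      -- The comparison point is feasible and X is a nonnegative multiple of a square, so z incurs
      -- no penalty against any of the test matrices.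
      have hzX : 0 ≤ (pencil M₀ K z * X t).trace := by
        obtain ⟨c, P, hc, hP, hXt⟩ := hX t htT
        rw [hXt, Matrix.mul_smul, Matrix.trace_smul, smul_eq_mul]
        exact mul_nonneg hc (trace_mul_mul_self_nonneg hz hP)
      have h1 := sub_penalized_le (b := b) (y := y t) hr0 hzX
      rw [hzval] at h1
      -- The actual step differs from the subgradient by rounding, at most 1 per coordinate, which
      -- costs at most |z_v - y_v| ≤ 1 + Y.
      have h2 : ∑ v, (b v + r * (K v * X t).trace) * (z v - y t v)
          ≤ ∑ v, (s * (y (t + 1) v - y t v) * (z v - y t v) + (1 + Y)) := by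
        refine Finset.sum_le_sum fun v _ => ?_
        have h3 := hstep t htT v
        have h4 : |z v - y t v| ≤ 1 + Y :=
          (abs_sub _ _).trans (add_le_add (hz1 v) (hY t htT v))
        have h5 : |(s * (y (t + 1) v - y t v) - (b v + r * (K v * X t).trace)) * (z v - y t v)|
            ≤ 1 * (1 + Y) := by
          rw [abs_mul]
          exact mul_le_mul h3 h4 (abs_nonneg _) zero_le_one
        have h6 := (abs_le.mp h5).1
        linarith
      rw [Finset.sum_add_distrib, Finset.sum_const, Finset.card_univ, nsmul_eq_mul] at h2
      linarith
    generalize hG : (fun t => ∑ v, b v * y t v + (if (pencil M₀ K (y t) * X t).trace < 0 then R else 0)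
      * (pencil M₀ K (y t) * X t).trace) = G
    have hlow' : ∀ t ∈ Finset.range T, val - G t
        ≤ ∑ v, s * (y (t + 1) v - y t v) * (z v - y t v) + Fintype.card V * (1 + Y) :=
      fun t ht => by rw [← hG]; exact hlow t ht
    have hsum := Finset.sum_le_sum hlow'
    rw [Finset.sum_sub_distrib, Finset.sum_const, Finset.card_range, nsmul_eq_mul,
      Finset.sum_add_distrib, Finset.sum_const, Finset.card_range, nsmul_eq_mul] at hsum
    have hreg := regret_le hs y z hy0 T
    have hz2 : ∑ v, z v ^ 2 ≤ Fintype.card V := by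
      refine (Finset.sum_le_sum fun v _ => ?_ : _ ≤ ∑ _v : V, (1 : ℝ)).trans_eq (by simp)
      exact (sq_le_one_iff_abs_le_one _).mpr (hz1 v)
    have hg2 : ∑ t ∈ Finset.range T, ∑ v, (s * (y (t + 1) v - y t v)) ^ 2
        ≤ T * (Fintype.card V * γ ^ 2) := by
      refine (Finset.sum_le_sum fun t ht => ?_ :
        _ ≤ ∑ _t ∈ Finset.range T, (Fintype.card V * γ ^ 2)).trans_eq
        (by rw [Finset.sum_const, Finset.card_range, nsmul_eq_mul])
      refine (Finset.sum_le_sum fun v _ => ?_ : _ ≤ ∑ _v : V, γ ^ 2).trans_eq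
        (by rw [Finset.sum_const, Finset.card_univ, nsmul_eq_mul])
      exact sq_le_sq' (abs_le.mp (hγ t (Finset.mem_range.mp ht) v)).1
        (abs_le.mp (hγ t (Finset.mem_range.mp ht) v)).2
    have h7 := div_le_div_of_nonneg_right hg2 (by positivity : 0 ≤ 2 * s)
    have h8 := mul_le_mul_of_nonneg_left hz2 (by positivity : 0 ≤ s / 2)
    linarith

end Subgradient

end Majorana

namespace Majorana

open Cliff

/-! ### Words in the indeterminates -/

/-- The digits of a word in the letters `0, …, n`. -/
def digit (n c p : ℕ) : ℕ := c / (n + 1) ^ p % (n + 1)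

theorem digit_le (n c p : ℕ) : digit n c p ≤ n := Nat.lt_succ_iff.mp (Nat.mod_lt _ n.succ_pos)

theorem digit_add_low {n L c : ℕ} (e : ℕ) {p : ℕ} (hp : p < L) :
    digit n (c + (n + 1) ^ L * e) p = digit n c p := by
  obtain ⟨k, rfl⟩ : ∃ k, L = p + (k + 1) := ⟨L - p - 1, by omega⟩
  have h : c + (n + 1) ^ (p + (k + 1)) * e = c + (n + 1) ^ p * ((n + 1) * ((n + 1) ^ k * e)) := by
    ring
  rw [digit, digit, h, Nat.add_mul_div_left _ _ (by positivity), Nat.add_mul_mod_self_left]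

theorem digit_add_high {n L c : ℕ} (hc : c < (n + 1) ^ L) (e p : ℕ) :
    digit n (c + (n + 1) ^ L * e) (L + p) = digit n e p := by
  rw [digit, digit, pow_add, ← Nat.div_div_eq_div_mul, Nat.add_mul_div_left _ _ (by positivity),
    Nat.div_eq_of_lt hc, zero_add]

/-- The letter `0` stands for `1`, the letter `i + 1` for the `i`-th indeterminate. -/
def letterSet (n e : ℕ) : Finset (Fin n) := Finset.univ.filter fun i => (i : ℕ) + 1 = e

/-- The element with code `c`, a product of `L` letters. -/
noncomputable def word (n : ℕ) : ℕ → ℕ → Cliff n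
  | 0, _ => 1
  | L + 1, c => word n L c * basisElt (letterSet n (digit n c L))

/-- The monomial underlying a word. -/
def wordSet (n : ℕ) : ℕ → ℕ → Finset (Fin n)
  | 0, _ => ∅
  | L + 1, c => wordSet n L c ∆ letterSet n (digit n c L)

/-- The sign that arises by sorting a word. -/
def wordSgn (n L c : ℕ) : ℤ := ∏ q ∈ Finset.range L, ∏ p ∈ Finset.range q,
  if 0 < digit n c q then (if digit n c q < digit n c p then -1 else 1) else 1

/-- The coefficient of `1` of a word. -/
def wordTr (n L c : ℕ) : ℤ := wordSgn n L c * ∏ j ∈ Finset.range n,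
  if 0 < ∏ p ∈ Finset.range L, (if digit n c p = j + 1 then (-1 : ℤ) else 1) then 1 else 0

theorem letterSet_zero (n : ℕ) : letterSet n 0 = ∅ := by
  simp [letterSet]

theorem letterSet_succ {n : ℕ} (i : Fin n) : letterSet n (i + 1) = {i} := by
  ext j
  simp [letterSet, Fin.ext_iff]

theorem sgn_letterSet {n d e : ℕ} (hd : d ≤ n) (he : e ≤ n) :
    sgn (letterSet n d) (letterSet n e)
      = ((if 0 < e then (if e < d then -1 else 1) else 1 : ℤ) : ℂ) := by
  rcases Nat.eq_zero_or_pos e with rfl | he0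
  · simp [letterSet_zero, sgn_empty_right]
  rcases Nat.eq_zero_or_pos d with rfl | hd0
  · simp [letterSet_zero, sgn_empty_left]
  obtain ⟨d, rfl⟩ : ∃ k, d = k + 1 := ⟨d - 1, by omega⟩
  obtain ⟨e, rfl⟩ : ∃ k, e = k + 1 := ⟨e - 1, by omega⟩
  have h1 := letterSet_succ (⟨d, by omega⟩ : Fin n)
  have h2 := letterSet_succ (⟨e, by omega⟩ : Fin n)
  simp only at h1 h2
  rw [h1, h2, sgn, Finset.prod_singleton, Finset.prod_singleton]
  simp

theorem sgn_wordSet (n L c : ℕ) (T : Finset (Fin n)) :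
    sgn (wordSet n L c) T = ∏ p ∈ Finset.range L, sgn (letterSet n (digit n c p)) T := by
  induction L with
  | zero => simp [wordSet, sgn_empty_left]
  | succ L ih => rw [wordSet, sgn_symmDiff_left, ih, Finset.prod_range_succ]

theorem word_eq (n L c : ℕ) : word n L c = (wordSgn n L c : ℂ) • basisElt (wordSet n L c) := by
  induction L with
  | zero => simp [word, wordSgn, wordSet]; rfl
  | succ L ih =>
    rw [word, ih, smul_mul_assoc, basisElt_mul, smul_smul, wordSet]
    congr 1
    rw [sgn_wordSet, wordSgn, wordSgn, Finset.prod_range_succ, Int.cast_mul]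
    congr 1
    rw [Int.cast_prod]
    exact Finset.prod_congr rfl fun p _ => sgn_letterSet (digit_le _ _ _) (digit_le _ _ _)

theorem wordSgn_eq_one_or (n L c : ℕ) : wordSgn n L c = 1 ∨ wordSgn n L c = -1 := by
  rw [← sq_eq_one_iff, wordSgn, ← Finset.prod_pow]
  refine Finset.prod_eq_one fun q _ => ?_
  rw [← Finset.prod_pow]
  refine Finset.prod_eq_one fun p _ => ?_
  split_ifs <;> norm_num

theorem prod_wordSet (n L c : ℕ) (f : Fin n → ℂ) (hf : ∀ i, f i * f i = 1) :
    ∏ i ∈ wordSet n L c, f i = ∏ p ∈ Finset.range L, ∏ i ∈ letterSet n (digit n c p), f i := by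
  induction L with
  | zero => simp [wordSet]
  | succ L ih => rw [wordSet, prod_symmDiff f hf, ih, Finset.prod_range_succ]

/-- An index remains after sorting exactly when its letter occurs an odd number of times; the
product of signs computes this parity. -/
theorem mem_wordSet (n L c : ℕ) (j : Fin n) : j ∉ wordSet n L c ↔
    0 < ∏ p ∈ Finset.range L, (if digit n c p = j + 1 then (-1 : ℤ) else 1) := by
  have h1 : ((∏ p ∈ Finset.range L, (if digit n c p = j + 1 then (-1 : ℤ) else 1) : ℤ) : ℂ)
      = if j ∈ wordSet n L c then -1 else 1 := by
    have h := prod_wordSet n L c (fun i => if i = j then -1 else 1) fun i => by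
      split_ifs <;> norm_num
    rw [Finset.prod_ite_eq'] at h
    rw [h, Int.cast_prod]
    refine Finset.prod_congr rfl fun p _ => ?_
    rw [Finset.prod_ite_eq']
    simp only [letterSet, Finset.mem_filter, Finset.mem_univ, true_and, eq_comm]
    split_ifs <;> simp
  by_cases hj : j ∈ wordSet n L c
  · rw [if_pos hj] at h1
    have : (∏ p ∈ Finset.range L, (if digit n c p = j + 1 then (-1 : ℤ) else 1)) = -1 := by
      exact_mod_cast h1
    simp [hj, this]
  · rw [if_neg hj] at h1
    have : (∏ p ∈ Finset.range L, (if digit n c p = j + 1 then (-1 : ℤ) else 1)) = 1 := by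
      exact_mod_cast h1
    simp [hj, this]

theorem tr_word (n L c : ℕ) : tr (word n L c) = (wordTr n L c : ℂ) := by
  rw [word_eq, map_smul, tr_apply, basisElt_apply, wordTr, Int.cast_mul, smul_eq_mul]
  congr 1
  rw [Int.cast_prod, ← Fin.prod_univ_eq_prod_range (fun j => (((if 0 < ∏ p ∈ Finset.range L,
    (if digit n c p = j + 1 then (-1 : ℤ) else 1) then 1 else 0 : ℤ)) : ℂ))]
  by_cases h : ∅ = wordSet n L c
  · rw [if_pos h, Finset.prod_eq_one]
    intro j _
    rw [if_pos ((mem_wordSet n L c j).mp (by simp [← h])), Int.cast_one]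
  · rw [if_neg h]
    obtain ⟨j, hj⟩ := Finset.nonempty_of_ne_empty (Ne.symm h)
    refine (Finset.prod_eq_zero (Finset.mem_univ j) ?_).symm
    rw [if_neg (fun h' => (mem_wordSet n L c j).mpr h' hj), Int.cast_zero]

theorem word_low (n L M c e : ℕ) (hM : M ≤ L) :
    word n M (c + (n + 1) ^ L * e) = word n M c := by
  induction M with
  | zero => rfl
  | succ M ih => rw [word, word, ih (by omega), digit_add_low e (by omega)]

theorem wordSet_low (n L M c e : ℕ) (hM : M ≤ L) :
    wordSet n M (c + (n + 1) ^ L * e) = wordSet n M c := by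
  induction M with
  | zero => rfl
  | succ M ih => rw [wordSet, wordSet, ih (by omega), digit_add_low e (by omega)]

/-- Concatenation of words is arithmetic on codes. Every trace of a product of words thereby becomes
a value of `wordTr`, which a program can evaluate. -/
theorem word_add {n L c : ℕ} (hc : c < (n + 1) ^ L) (M e : ℕ) :
    word n (L + M) (c + (n + 1) ^ L * e) = word n L c * word n M e := by
  induction M with
  | zero => rw [Nat.add_zero, word_low _ _ _ _ _ le_rfl, word, mul_one]
  | succ M ih => rw [← Nat.add_assoc, word, ih, digit_add_high hc, word, mul_assoc]

/-- Shorter monomials are padded with the letter 0, so words of length L reach every monomial of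
degree at most L. -/
theorem exists_wordSet_eq {n : ℕ} (L : ℕ) (S : Finset (Fin n)) (hS : S.card ≤ L) :
    ∃ c < (n + 1) ^ L, wordSet n L c = S := by
  induction L generalizing S with
  | zero => exact ⟨0, by simp, (Finset.card_eq_zero.mp (by omega)).symm⟩
  | succ L ih =>
    rcases S.eq_empty_or_nonempty with rfl | ⟨i, hi⟩
    · obtain ⟨c, hc, h⟩ := ih ∅ (by simp)
      refine ⟨c + (n + 1) ^ L * 0, by rw [pow_succ]; nlinarith, ?_⟩
      have h2 : digit n (c + (n + 1) ^ L * 0) L = digit n 0 0 := digit_add_high hc 0 0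
      rw [wordSet, h2, wordSet_low _ _ _ _ _ le_rfl, h]
      simp [digit, letterSet_zero]
    · obtain ⟨c, hc, h⟩ := ih (S.erase i) (by rw [Finset.card_erase_of_mem hi]; omega)
      refine ⟨c + (n + 1) ^ L * (i + 1), ?_, ?_⟩
      · have := i.2
        calc c + (n + 1) ^ L * (i + 1) < (n + 1) ^ L + (n + 1) ^ L * (i + 1) := by omega
          _ = (n + 1) ^ L * (i + 2) := by ring
          _ ≤ (n + 1) ^ L * (n + 1) := Nat.mul_le_mul_left _ (by omega)
          _ = _ := (pow_succ _ _).symm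
      · have h2 : digit n (c + (n + 1) ^ L * (i + 1)) L = digit n (i + 1) 0 :=
          digit_add_high hc (i + 1) 0
        have h3 : digit n (i + 1) 0 = i + 1 := by
          rw [digit, pow_zero, Nat.div_one, Nat.mod_eq_of_lt (by have := i.2; omega)]
        rw [wordSet, h2, wordSet_low _ _ _ _ _ le_rfl, h, h3, letterSet_succ]
        ext j
        rw [Finset.mem_symmDiff, Finset.mem_erase, Finset.mem_singleton]
        by_cases hj : j = i
        · subst hj; simp [hi]
        · simp [hj]

theorem card_letterSet_le (n e : ℕ) : (letterSet n e).card ≤ 1 := by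
  refine Finset.card_le_one.mpr fun i hi j hj => ?_
  simp only [letterSet, Finset.mem_filter, Finset.mem_univ, true_and] at hi hj
  exact Fin.ext (by omega)

theorem card_wordSet_le (n L c : ℕ) : (wordSet n L c).card ≤ L := by
  induction L with
  | zero => simp [wordSet]
  | succ L ih =>
    refine (Finset.card_le_card (Finset.symmDiff_subset_union)).trans
      ((Finset.card_union_le _ _).trans (add_le_add ih (card_letterSet_le _ _)))

theorem degLE_word (n L c : ℕ) : DegLE L (word n L c) := by
  rw [word_eq]
  intro S hS
  rw [smul_apply, basisElt_apply, if_neg, mul_zero]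
  rintro rfl
  exact (card_wordSet_le n L c).not_gt hS

theorem wordTr_add {n L c : ℕ} (hc : c < (n + 1) ^ L) (M e : ℕ) :
    (wordTr n (L + M) (c + (n + 1) ^ L * e) : ℂ) = tr (word n L c * word n M e) := by
  rw [← tr_word, word_add hc]

theorem wordSgn_mul_self (n L c : ℕ) : (wordSgn n L c : ℂ) * wordSgn n L c = 1 := by
  rcases wordSgn_eq_one_or n L c with h | h <;> simp [h]

theorem tr_word_mul_self (n L c : ℕ) :
    tr (word n L c * word n L c) = sgn (wordSet n L c) (wordSet n L c) := by
  rw [word_eq, smul_mul_smul_comm, wordSgn_mul_self, one_smul, basisElt_mul, symmDiff_self, map_smul,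
    tr_apply, basisElt_apply]
  simp

/-- The adjoint of a word is the word up to the sign of its square, and that sign is the trace of
the word written twice. -/
theorem star_word {n L c : ℕ} (hc : c < (n + 1) ^ L) :
    star (word n L c) = (wordTr n (L + L) (c + (n + 1) ^ L * c) : ℂ) • word n L c := by
  rw [wordTr_add hc, tr_word_mul_self, word_eq, star_smul, star_basisElt, smul_smul, smul_smul,
    Complex.star_def, map_intCast, mul_comm]

theorem tr_word_mul_basisElt (n L c : ℕ) (S : Finset (Fin n)) :
    tr (word n L c * basisElt S) = if wordSet n L c = S then (wordSgn n L c : ℂ) * sgn S S else 0 := by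
  rw [word_eq, smul_mul_assoc, basisElt_mul, map_smul, map_smul, tr_apply, basisElt_apply]
  by_cases h : wordSet n L c = S
  · subst h
    rw [symmDiff_self, if_pos rfl]
    simp
  · rw [if_neg h, if_neg]
    · simp
    · exact fun h' => h (symmDiff_eq_bot.mp h'.symm)

theorem tr_basisElt {n : ℕ} (S : Finset (Fin n)) :
    tr (basisElt S) = if S = ∅ then 1 else 0 := by
  rw [tr_apply, basisElt_apply]
  simp only [eq_comm]

theorem exists_wordSet_section (n L : ℕ) : ∃ r : Finset (Fin n) → Fin ((n + 1) ^ L),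
    ∀ S, S.card ≤ L → wordSet n L (r S) = S := by
  have h : ∀ S : Finset (Fin n), ∃ c : Fin ((n + 1) ^ L), S.card ≤ L → wordSet n L c = S := by
    intro S
    by_cases hS : S.card ≤ L
    · obtain ⟨c, hc, h⟩ := exists_wordSet_eq L S hS
      exact ⟨⟨c, hc⟩, fun _ => h⟩
    · exact ⟨⟨0, by positivity⟩, fun h => absurd h hS⟩
  exact ⟨fun S => (h S).choose, fun S => (h S).choose_spec⟩

end Majorana

namespace Majorana

open Cliff Matrix

/-! ### The SOS relaxation as a semidefinite program indexed by words -/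

/-- The sign `±1` with `star g = ± g`, for a word `g` of four letters. -/
def starSgn (n u : ℕ) : ℤ := wordTr n 8 (u + (n + 1) ^ 4 * u)

/-- Whether a word of eight letters is self-adjoint and not a multiple of `1`. -/
def isObs (n v : ℕ) : ℤ :=
  if wordTr n 8 v = 0 then (if wordTr n 16 (v + (n + 1) ^ 8 * v) = 1 then 1 else 0) else 0

/-- The part of the moment matrix coming from the normalised trace. -/
def baseEntry (n u w : ℕ) : ℤ := starSgn n u * wordTr n 8 (u + (n + 1) ^ 4 * w)

/-- The part of the moment matrix that depends on the expectation of the word `v`. -/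
def coefEntry (n v u w : ℕ) : ℤ :=
  isObs n v * (starSgn n u * wordTr n 16 (v + (n + 1) ^ 8 * (u + (n + 1) ^ 4 * w)))

/-- The moment matrix of the normalised trace. -/
def baseMat (n : ℕ) : Matrix (Fin ((n + 1) ^ 4)) (Fin ((n + 1) ^ 4)) ℝ :=
  Matrix.of fun u w => (baseEntry n u w : ℝ)

/-- The coefficients of the word `v` in the moment matrix. -/
def coefMat (n : ℕ) (v : Fin ((n + 1) ^ 8)) : Matrix (Fin ((n + 1) ^ 4)) (Fin ((n + 1) ^ 4)) ℝ :=
  Matrix.of fun u w => (coefEntry n v u w : ℝ)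

/-- The functional with prescribed values at words. -/
noncomputable def wordFun {n : ℕ} (y : Fin ((n + 1) ^ 8) → ℝ) : Cliff n →ₗ[ℂ] ℂ :=
  tr + ∑ v, ((y v * isObs n v : ℝ) : ℂ) • tr ∘ₗ LinearMap.mulLeft ℂ (word n 8 v)

theorem wordFun_apply {n : ℕ} (y : Fin ((n + 1) ^ 8) → ℝ) (x : Cliff n) :
    wordFun y x = tr x + ∑ v, ((y v * isObs n v : ℝ) : ℂ) * tr (word n 8 v * x) := by
  simp [wordFun, LinearMap.add_apply, LinearMap.sum_apply, LinearMap.smul_apply]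

/-- A word is nonscalar when its trace vanishes, and its square is the sign that its adjoint
acquires. Only nonscalar self-adjoint monomials have a free real moment: the moment of 1 is fixed,
and those of skew-adjoint monomials have real part zero. -/
theorem isObs_eq {n v : ℕ} (hv : v < (n + 1) ^ 8) : isObs n v
    = if wordSet n 8 v ≠ ∅ ∧ sgn (wordSet n 8 v) (wordSet n 8 v) = 1 then 1 else 0 := by
  have h1 : wordTr n 8 v = 0 ↔ wordSet n 8 v ≠ ∅ := by
    rw [← Int.cast_eq_zero (α := ℂ), ← tr_word, word_eq, map_smul, tr_basisElt]
    rcases wordSgn_eq_one_or n 8 v with h | h <;> simp [h]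
  have h2 : wordTr n 16 (v + (n + 1) ^ 8 * v) = 1 ↔
      sgn (wordSet n 8 v) (wordSet n 8 v) = 1 := by
    have h3 : (wordTr n 16 (v + (n + 1) ^ 8 * v) : ℂ) = tr (word n 8 v * word n 8 v) :=
      wordTr_add hv 8 v
    rw [← tr_word_mul_self, ← h3, Int.cast_eq_one]
  rw [isObs]
  by_cases h3 : wordSet n 8 v = ∅
  · rw [if_neg (fun h => h1.mp h h3), if_neg (fun h => h.1 h3)]
  · rw [if_pos (h1.mpr h3)]
    by_cases h4 : sgn (wordSet n 8 v) (wordSet n 8 v) = 1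
    · rw [if_pos (h2.mpr h4), if_pos ⟨h3, h4⟩]
    · rw [if_neg (fun h => h4 (h2.mp h)), if_neg (fun h => h4 h.2)]

theorem wordFun_one {n : ℕ} (y : Fin ((n + 1) ^ 8) → ℝ) : wordFun y (1 : Cliff n) = 1 := by
  rw [wordFun_apply, isState_tr.map_one, Finset.sum_eq_zero, add_zero]
  intro v _
  rw [one_eq, tr_word_mul_basisElt, isObs_eq v.2]
  by_cases h : wordSet n 8 v = ∅ <;> simp [h]

theorem wordFun_star {n : ℕ} (y : Fin ((n + 1) ^ 8) → ℝ) (x : Cliff n) :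
    wordFun y (star x) = conj (wordFun y x) := by
  rw [wordFun_apply, wordFun_apply, map_add, tr_star, map_sum]
  congr 1
  refine Finset.sum_congr rfl fun v _ => ?_
  rw [map_mul (starRingEnd ℂ), Complex.conj_ofReal, isObs_eq v.2]
  by_cases h : wordSet n 8 v ≠ ∅ ∧ sgn (wordSet n 8 v) (wordSet n 8 v) = 1
  · congr 1
    have h1 : star (word n 8 v) = word n 8 v := by
      rw [word_eq, star_smul, star_basisElt, h.2, one_smul, Complex.star_def, map_intCast]
    rw [← tr_star, star_mul, h1, tr_mul_comm]
  · rw [if_neg h]; simp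

/-- The product of the adjoint of u with w is, up to sign, the concatenated word. The trace part of
the functional gives the base matrix and the term of v gives the coefficient matrix of v. -/
theorem pencil_apply {n : ℕ} (y : Fin ((n + 1) ^ 8) → ℝ) (u w : Fin ((n + 1) ^ 4)) :
    ((pencil (baseMat n) (coefMat n) y u w : ℝ) : ℂ)
      = wordFun y (star (word n 4 u) * word n 4 w) := by
  have hs : star (word n 4 (u : ℕ)) = (starSgn n u : ℂ) • word n 4 u := star_word u.2
  rw [wordFun_apply, pencil, Matrix.add_apply, Matrix.sum_apply, Complex.ofReal_add,
    Complex.ofReal_sum, hs]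
  congr 1
  · rw [smul_mul_assoc, map_smul, baseMat, Matrix.of_apply, baseEntry]
    push_cast
    rw [smul_eq_mul, ← wordTr_add u.2 4 w]
  · refine Finset.sum_congr rfl fun v _ => ?_
    rw [smul_mul_assoc, mul_smul_comm, map_smul, coefMat, Matrix.smul_apply, Matrix.of_apply,
      coefEntry, ← word_add u.2, ← wordTr_add v.2]
    push_cast
    rw [smul_eq_mul, smul_eq_mul]
    push_cast
    ring

theorem isHermitian_pencil {n : ℕ} (y : Fin ((n + 1) ^ 8) → ℝ) :
    (pencil (baseMat n) (coefMat n) y).IsHermitian := by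
  ext u w
  rw [conjTranspose_apply, star_trivial]
  have h : ((pencil (baseMat n) (coefMat n) y w u : ℝ) : ℂ)
      = pencil (baseMat n) (coefMat n) y u w := by
    rw [pencil_apply, ← Complex.conj_ofReal (pencil (baseMat n) (coefMat n) y u w), pencil_apply,
      ← wordFun_star, star_mul, star_star]
  exact_mod_cast h

theorem map_star_sum_mul_sum {n : ℕ} {ι : Type*} [Fintype ι] (φ : Cliff n →ₗ[ℂ] ℂ) (a : ι → ℂ)
    (g : ι → Cliff n) : φ (star (∑ i, a i • g i) * ∑ j, a j • g j)
      = ∑ i, ∑ j, conj (a i) * a j * φ (star (g i) * g j) := by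
  rw [star_sum, Finset.sum_mul, map_sum]
  refine Finset.sum_congr rfl fun i _ => ?_
  rw [Finset.mul_sum, map_sum]
  refine Finset.sum_congr rfl fun j _ => ?_
  rw [star_smul, smul_mul_smul_comm, map_smul, smul_eq_mul]
  rfl

/-- The values at words of the functional `φ`, each monomial being represented once. -/
noncomputable def wordValues {n : ℕ} (r : Finset (Fin n) → Fin ((n + 1) ^ 8))
    (φ : Cliff n →ₗ[ℂ] ℂ) (v : Fin ((n + 1) ^ 8)) : ℝ :=
  if v = r (wordSet n 8 v) then (φ (word n 8 v)).re else 0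

/-- Many words spell the same monomial; with the value placed on one representative only one summand
survives. Only the real part is reproduced, which suffices because real vectors test a real
symmetric matrix. -/
theorem wordFun_wordValues {n k : ℕ} {r : Finset (Fin n) → Fin ((n + 1) ^ 8)}
    (hr : ∀ S, S.card ≤ 8 → wordSet n 8 (r S) = S) {φ : Cliff n →ₗ[ℂ] ℂ}
    (hφ : IsPseudoexpectation k φ) {S : Finset (Fin n)} (hS : S.card ≤ 8) :
    wordFun (wordValues r φ) (basisElt S) = ((φ (basisElt S)).re : ℂ) := by
  have hrS := hr S hS
  rw [wordFun_apply, tr_basisElt, Finset.sum_eq_single (r S)]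
  · rw [wordValues, tr_word_mul_basisElt, isObs_eq (r S).2, hrS, if_pos rfl, if_pos rfl, word_eq,
      map_smul, hrS, smul_eq_mul]
    have hsg := wordSgn_mul_self n 8 (r S)
    rcases Finset.eq_empty_or_nonempty S with h | h
    · subst h
      rw [← one_eq, hφ.map_one]
      simp
    rw [if_neg h.ne_empty, zero_add]
    rcases sgn_eq_one_or S S with h1 | h1
    · rw [if_pos ⟨h.ne_empty, h1⟩, h1, ← Complex.ofReal_intCast, Complex.re_ofReal_mul]
      push_cast
      linear_combination ((φ (basisElt S)).re : ℂ) * hsg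
    · have h2 := hφ.map_star (basisElt S)
      rw [star_basisElt, h1, map_smul, smul_eq_mul] at h2
      have h3 := congrArg Complex.re h2
      rw [Complex.conj_re] at h3
      -- A skew-adjoint monomial has a purely imaginary moment, matching the missing variable.
      have h4 : (φ (basisElt S)).re = 0 := by
        simp at h3
        linarith
      rw [if_neg (by rw [h1]; norm_num), h4]
      simp
  · intro v _ hv
    rw [tr_word_mul_basisElt]
    by_cases h : wordSet n 8 v = S
    · rw [wordValues, if_neg (by rwa [h])]
      simp
    · rw [if_neg h, mul_zero]
  · simp

theorem abs_wordValues_le {n : ℕ} (r : Finset (Fin n) → Fin ((n + 1) ^ 8))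
    {φ : Cliff n →ₗ[ℂ] ℂ} (hφ : IsPseudoexpectation 4 φ) (v : Fin ((n + 1) ^ 8)) :
    |wordValues r φ v| ≤ 1 := by
  rw [wordValues]
  split_ifs
  · refine (Complex.abs_re_le_norm _).trans ?_
    rw [word_eq, map_smul, norm_smul]
    have h1 : ‖(wordSgn n 8 v : ℂ)‖ = 1 := by
      rcases wordSgn_eq_one_or n 8 v with h | h <;> simp [h]
    rw [h1, one_mul]
    exact hφ.norm_map_basisElt_le (card_wordSet_le n 8 v)
  · simp

theorem exists_star_word_mul_word {n : ℕ} (u w : Fin ((n + 1) ^ 4)) :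
    ∃ (ε : ℝ) (S : Finset (Fin n)), S.card ≤ 8 ∧
      star (word n 4 u) * word n 4 w = (ε : ℂ) • basisElt S := by
  refine ⟨starSgn n u * wordSgn n 8 (u + (n + 1) ^ 4 * w), wordSet n 8 (u + (n + 1) ^ 4 * w),
    card_wordSet_le _ _ _, ?_⟩
  have hs : star (word n 4 (u : ℕ)) = (starSgn n u : ℂ) • word n 4 u := star_word u.2
  rw [hs, smul_mul_assoc, ← word_add u.2 4 w, word_eq, smul_smul]
  push_cast
  rfl

/-- The pencil is the real part of the Gram matrix of the words under φ, and its form on real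
vectors is the value of φ at a square of degree 4 + 4. -/
theorem posSemidef_pencil_wordValues {n : ℕ} {r : Finset (Fin n) → Fin ((n + 1) ^ 8)}
    (hr : ∀ S, S.card ≤ 8 → wordSet n 8 (r S) = S) {φ : Cliff n →ₗ[ℂ] ℂ}
    (hφ : IsPseudoexpectation 4 φ) :
    (pencil (baseMat n) (coefMat n) (wordValues r φ)).PosSemidef := by
  have hent : ∀ u w, pencil (baseMat n) (coefMat n) (wordValues r φ) u w
      = (φ (star (word n 4 u) * word n 4 w)).re := by
    intro u w
    obtain ⟨ε, S, hS, h⟩ := exists_star_word_mul_word u w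
    have h1 := pencil_apply (wordValues r φ) u w
    rw [h, map_smul, wordFun_wordValues hr hφ hS, smul_eq_mul] at h1
    rw [h, map_smul, smul_eq_mul, Complex.re_ofReal_mul]
    exact_mod_cast h1
  refine PosSemidef.of_dotProduct_mulVec_nonneg (isHermitian_pencil _) fun x => ?_
  have h := hφ.re_nonneg (g := ∑ u : Fin ((n + 1) ^ 4), (x u : ℂ) • word n 4 u)
    (DegLE.sum fun u _ => (degLE_word n 4 u).smul _)
  rw [map_star_sum_mul_sum] at h
  simp only [Complex.re_sum, Complex.conj_ofReal, ← Complex.ofReal_mul, Complex.re_ofReal_mul] at h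
  simp only [dotProduct, mulVec, Finset.mul_sum, Pi.star_apply, star_trivial, hent]
  refine h.trans_eq (Finset.sum_congr rfl fun u _ => Finset.sum_congr rfl fun w _ => ?_)
  ring

/-- The mask `isObs` is invisible here: quartic monomials are self-adjoint and nonscalar, so b
vanishes at every word that is masked out. -/
theorem sum_mul_eq_wordFun_quartic {n : ℕ} (a : Quad n → ℝ) {b : Fin ((n + 1) ^ 8) → ℝ}
    (hb : ∀ v : Fin ((n + 1) ^ 8), (b v : ℂ) = tr (word n 8 v * quartic a))
    (y : Fin ((n + 1) ^ 8) → ℝ) : ((∑ v, b v * y v : ℝ) : ℂ) = wordFun y (quartic a) := by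
  have h0 : tr (quartic a) = 0 := by
    rw [quartic, map_sum]
    refine Finset.sum_eq_zero fun S _ => ?_
    rw [mono_eq_basisElt, map_smul, tr_basisElt, if_neg, smul_zero]
    intro h
    have := S.2
    rw [h] at this
    simp at this
  rw [wordFun_apply, h0, zero_add, Complex.ofReal_sum]
  refine Finset.sum_congr rfl fun v _ => ?_
  rw [Complex.ofReal_mul, hb]
  by_cases hv : wordSet n 8 v ≠ ∅ ∧ sgn (wordSet n 8 v) (wordSet n 8 v) = 1
  · rw [isObs_eq v.2, if_pos hv]
    push_cast
    ring
  · have : tr (word n 8 v * quartic a) = 0 := by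
      rw [quartic, Finset.mul_sum, map_sum]
      refine Finset.sum_eq_zero fun S _ => ?_
      rw [mono_eq_basisElt, mul_smul_comm, map_smul, tr_word_mul_basisElt, if_neg, smul_zero]
      intro h
      refine hv ⟨fun h' => ?_, by rw [h, sgn_self_quad]⟩
      have := S.2
      rw [← h, h'] at this
      simp at this
    rw [this]
    simp

theorem exists_optimal_wordValues {n : ℕ} (a : Quad n → ℝ) {b : Fin ((n + 1) ^ 8) → ℝ}
    (hb : ∀ v : Fin ((n + 1) ^ 8), (b v : ℂ) = tr (word n 8 v * quartic a)) :
    ∃ z : Fin ((n + 1) ^ 8) → ℝ, (∀ v, |z v| ≤ 1) ∧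
      (pencil (baseMat n) (coefMat n) z).PosSemidef ∧ ∑ v, b v * z v = sos 4 (quartic a) := by
  obtain ⟨φ, hφ, hval⟩ := (isGreatest_sos 4 ((degLE_quartic a).mono_deg (by norm_num))).1
  obtain ⟨r, hr⟩ := exists_wordSet_section n 8
  refine ⟨wordValues r φ, abs_wordValues_le r hφ, posSemidef_pencil_wordValues hr hφ, ?_⟩
  have h := sum_mul_eq_wordFun_quartic a hb (wordValues r φ)
  have h1 : wordFun (wordValues r φ) (quartic a) = ((φ (quartic a)).re : ℂ) := by
    rw [re_map_quartic, quartic, map_sum, Complex.ofReal_sum]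
    refine Finset.sum_congr rfl fun S _ => ?_
    rw [mono_eq_basisElt, map_smul, wordFun_wordValues hr hφ (by rw [S.2]; norm_num), smul_eq_mul]
    push_cast
    rfl
  rw [h1, hval] at h
  exact_mod_cast h

/-- Write g in one representative word per monomial. The matrix is real, so real and imaginary parts
of the coefficients decouple into two real quadratic forms. Distinct monomials have distinct
representatives, so the shift δ becomes δ tr(g* g). -/
theorem wordFun_add_nonneg {n : ℕ} {y : Fin ((n + 1) ^ 8) → ℝ} {δ : ℝ}
    (h : (pencil (baseMat n) (coefMat n) y
      + δ • (1 : Matrix (Fin ((n + 1) ^ 4)) (Fin ((n + 1) ^ 4)) ℝ)).PosSemidef)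
    {g : Cliff n} (hg : DegLE 4 g) :
    0 ≤ (wordFun y (star g * g)).re + δ * (tr (star g * g)).re := by
  obtain ⟨r, hr⟩ := exists_wordSet_section n 4
  set a : Finset (Fin n) → ℂ := fun S => (wordSgn n 4 (r S) : ℂ) * g S with ha
  have ha0 : ∀ S, 4 < S.card → a S = 0 := fun S hS => by rw [ha]; simp [hg S hS]
  have hga : g = ∑ S, a S • word n 4 (r S) := by
    conv_lhs => rw [eq_sum_basisElt g]
    refine Finset.sum_congr rfl fun S _ => ?_
    by_cases hS : 4 < S.card
    · rw [ha0 S hS, hg S hS, zero_smul, zero_smul]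
    · rw [word_eq, hr S (by omega), smul_smul, ha]
      congr 1
      linear_combination (-(g S)) * wordSgn_mul_self n 4 (r S)
  have htr : (tr (star g * g)).re = ∑ S, ((a S).re ^ 2 + (a S).im ^ 2) := by
    rw [tr_star_mul_self, Complex.ofReal_re]
    refine Finset.sum_congr rfl fun S _ => ?_
    rw [← Complex.normSq_eq_norm_sq, Complex.normSq_apply, ha]
    rcases wordSgn_eq_one_or n 4 (r S) with h | h <;> simp [h] <;> ring
  have hfun : (wordFun y (star g * g)).re = ∑ S, ∑ T, ((a S).re * (a T).re + (a S).im * (a T).im)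
      * pencil (baseMat n) (coefMat n) y (r S) (r T) := by
    conv_lhs => rw [hga]
    rw [map_star_sum_mul_sum, Complex.re_sum]
    refine Finset.sum_congr rfl fun S _ => ?_
    rw [Complex.re_sum]
    refine Finset.sum_congr rfl fun T _ => ?_
    rw [← pencil_apply, Complex.re_mul_ofReal, Complex.mul_re, Complex.conj_re, Complex.conj_im]
    ring
  have hone : ∀ p : Finset (Fin n) → ℝ, (∀ S, 4 < S.card → p S = 0) →
      0 ≤ ∑ S, ∑ T, p S * p T * pencil (baseMat n) (coefMat n) y (r S) (r T)
        + δ * ∑ S, p S ^ 2 := by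
    intro p hp
    have h1 := (h.submatrix r).dotProduct_mulVec_nonneg p
    simp only [dotProduct, mulVec, Finset.mul_sum, Pi.star_apply, star_trivial, submatrix_apply,
      Matrix.add_apply, Matrix.smul_apply, smul_eq_mul] at h1
    refine h1.trans_eq ?_
    rw [Finset.mul_sum, ← Finset.sum_add_distrib]
    refine Finset.sum_congr rfl fun S _ => ?_
    have h2 : δ * p S ^ 2 = ∑ T, p S * p T
        * (δ * (1 : Matrix (Fin ((n + 1) ^ 4)) (Fin ((n + 1) ^ 4)) ℝ) (r S) (r T)) := by
      rw [Finset.sum_eq_single S]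
      · rw [Matrix.one_apply_eq]; ring
      · intro T _ hT
        by_cases hS4 : 4 < S.card
        · rw [hp S hS4]; ring
        by_cases hT4 : 4 < T.card
        · rw [hp T hT4]; ring
        rw [Matrix.one_apply_ne]
        · ring
        · intro he
          have h3 := hr S (by omega)
          rw [he, hr T (by omega)] at h3
          exact hT h3
      · simp
    rw [h2, ← Finset.sum_add_distrib]
    exact Finset.sum_congr rfl fun T _ => by ring
  have h1 := hone (fun S => (a S).re) fun S hS => by rw [ha0 S hS]; rfl
  have h2 := hone (fun S => (a S).im) fun S hS => by rw [ha0 S hS]; rfl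
  rw [htr, hfun, Finset.sum_add_distrib]
  simp only [add_mul, Finset.sum_add_distrib]
  linarith

/-- A nearly feasible point of the semidefinite program has nearly at most the optimal value. -/
theorem sum_mul_le_of_posSemidef {n : ℕ} (a : Quad n → ℝ) {b : Fin ((n + 1) ^ 8) → ℝ}
    (hb : ∀ v : Fin ((n + 1) ^ 8), (b v : ℂ) = tr (word n 8 v * quartic a))
    (y : Fin ((n + 1) ^ 8) → ℝ) (δ : ℝ) (hδ : 0 ≤ δ)
    (h : (pencil (baseMat n) (coefMat n) y
      + δ • (1 : Matrix (Fin ((n + 1) ^ 4)) (Fin ((n + 1) ^ 4)) ℝ)).PosSemidef) :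
    ∑ v, b v * y v ≤ (1 + δ) * sos 4 (quartic a) := by
  have hδ1 : (0 : ℝ) < 1 + δ := by linarith
  -- The shift by δ amounts to adding δ times the trace. Dividing by 1 + δ restores the value 1 at
  -- the unit, and the added trace vanishes on quartic polynomials.
  set ψ : Cliff n →ₗ[ℂ] ℂ := (((1 + δ)⁻¹ : ℝ) : ℂ) • (wordFun y + (δ : ℂ) • tr) with hψ
  have hap : ∀ x, ψ x = (((1 + δ)⁻¹ : ℝ) : ℂ) * (wordFun y x + (δ : ℂ) * tr x) := fun x => by
    rw [hψ]; rfl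
  have hstar : ∀ x, ψ (star x) = conj (ψ x) := fun x => by
    rw [hap, hap, wordFun_star, tr_star, map_mul, map_add, map_mul, Complex.conj_ofReal,
      Complex.conj_ofReal]
  have hps : IsPseudoexpectation 4 ψ := by
    refine ⟨?_, hstar, fun g hg => ?_⟩
    · rw [hap, wordFun_one, isState_tr.map_one]
      have : ((1 + δ : ℝ) : ℂ) ≠ 0 := by exact_mod_cast hδ1.ne'
      push_cast at this ⊢
      field_simp
    · rw [Complex.nonneg_iff]
      constructor
      · rw [hap, Complex.re_ofReal_mul, Complex.add_re, Complex.re_ofReal_mul]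
        exact mul_nonneg (inv_nonneg.mpr hδ1.le) (wordFun_add_nonneg h hg)
      · have h1 := hstar (star g * g)
        rw [star_mul, star_star] at h1
        have h2 := congrArg Complex.im h1
        rw [Complex.conj_im] at h2
        linarith
  have h1 := hps.re_le_sos (h := quartic a) ((degLE_quartic a).mono_deg (by norm_num))
  have h0 : tr (quartic a) = 0 := by
    have := sum_mul_eq_wordFun_quartic a hb 0
    simpa [wordFun_apply] using this.symm
  rw [hap, h0, mul_zero, add_zero, ← sum_mul_eq_wordFun_quartic a hb y, ← Complex.ofReal_mul,
    Complex.ofReal_re, inv_mul_le_iff₀ hδ1] at h1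
  exact h1

end Majorana

namespace Majorana

open Cliff Matrix

/-! ### Bounds on matrices -/

/-- By 2 |x_u x_w| ≤ x_u² + x_w² the quadratic form of M is at most |W| m times the squared norm. -/
theorem posDef_smul_one_sub {W : Type*} [Fintype W] [DecidableEq W] {M : Matrix W W ℝ}
    (hM : M.IsHermitian) {m C : ℝ} (hm : ∀ u w, |M u w| ≤ m) (hC : Fintype.card W * m < C) :
    (C • (1 : Matrix W W ℝ) - M).PosDef := by
  have hsub : (C • (1 : Matrix W W ℝ) - M).IsHermitian := by
    refine IsHermitian.sub ?_ hM
    rw [IsHermitian, conjTranspose_smul, conjTranspose_one, star_trivial]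
  refine PosDef.of_dotProduct_mulVec_pos hsub fun x hx => ?_
  have hpos : 0 < ∑ u, x u ^ 2 := by
    obtain ⟨u, hu⟩ := Function.ne_iff.mp hx
    exact Finset.sum_pos' (fun _ _ => sq_nonneg _) ⟨u, Finset.mem_univ u, by
      have : x u ≠ 0 := hu
      positivity⟩
  have h1 : star x ⬝ᵥ ((C • (1 : Matrix W W ℝ) - M) *ᵥ x)
      = C * ∑ u, x u ^ 2 - ∑ u, ∑ w, x u * (M u w * x w) := by
    rw [sub_mulVec, dotProduct_sub, smul_mulVec, one_mulVec, dotProduct_smul, smul_eq_mul]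
    congr 1
    · simp only [dotProduct, Pi.star_apply, star_trivial, sq]
    · simp only [dotProduct, mulVec, Finset.mul_sum, Pi.star_apply, star_trivial]
  have h2 : ∑ u, ∑ w, x u * (M u w * x w) ≤ ∑ u, ∑ w, m * ((x u ^ 2 + x w ^ 2) / 2) := by
    refine Finset.sum_le_sum fun u _ => Finset.sum_le_sum fun w _ => ?_
    have h3 : |x u * x w| ≤ (x u ^ 2 + x w ^ 2) / 2 := by
      rw [abs_le]
      constructor <;> nlinarith [sq_nonneg (x u - x w), sq_nonneg (x u + x w)]
    calc x u * (M u w * x w) ≤ |x u * (M u w * x w)| := le_abs_self _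
      _ = |M u w| * |x u * x w| := by rw [← abs_mul]; congr 1; ring
      _ ≤ _ := mul_le_mul (hm u w) h3 (abs_nonneg _) ((abs_nonneg _).trans (hm u w))
  have h3 : ∑ u, ∑ w, m * ((x u ^ 2 + x w ^ 2) / 2) = Fintype.card W * m * ∑ u, x u ^ 2 := by
    have : ∀ u w, m * ((x u ^ 2 + x w ^ 2) / 2) = m / 2 * x u ^ 2 + m / 2 * x w ^ 2 :=
      fun u w => by ring
    simp only [this, Finset.sum_add_distrib, ← Finset.mul_sum, Finset.sum_const, Finset.card_univ,
      nsmul_eq_mul]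
    ring
  rw [h1]
  nlinarith

/-- An entry of P² is an inner product of two rows of P, and the trace is the sum of the squared row
norms. Hence normalised weight matrices have entries at most 1 and the subgradients are bounded. -/
theorem abs_mul_self_apply_le {W : Type*} [Fintype W] {P : Matrix W W ℝ} (hP : P.IsHermitian)
    (u w : W) : |(P * P) u w| ≤ (P * P).trace := by
  have hsymm : ∀ i j, P i j = P j i := fun i j => by
    have := hP.apply j i
    rwa [star_trivial, eq_comm, eq_comm] at this
  have hdiag : ∀ i, (P * P) i i = ∑ x, P i x ^ 2 := fun i => by
    rw [Matrix.mul_apply]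
    exact Finset.sum_congr rfl fun x _ => by rw [hsymm x i]; ring
  have hle : ∀ i, ∑ x, P i x ^ 2 ≤ (P * P).trace := fun i => by
    rw [Matrix.trace, ← hdiag]
    exact Finset.single_le_sum (f := fun i => (P * P).diag i)
      (fun j _ => by rw [diag_apply, hdiag]; positivity) (Finset.mem_univ i)
  have h1 : |(P * P) u w| ≤ (∑ x, P u x ^ 2 + ∑ x, P w x ^ 2) / 2 := by
    rw [Matrix.mul_apply, ← Finset.sum_add_distrib, Finset.sum_div]
    refine (Finset.abs_sum_le_sum_abs _ _).trans (Finset.sum_le_sum fun x _ => ?_)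
    rw [hsymm x w, abs_le]
    constructor <;> nlinarith [sq_nonneg (P u x - P w x), sq_nonneg (P u x + P w x)]
  linarith [hle u, hle w]

/-! ### Integer matrices given by functions on natural numbers -/

/-- The real matrix with given integer entries. -/
def toMat (W : ℕ) (A : ℕ → ℕ → ℤ) : Matrix (Fin W) (Fin W) ℝ := Matrix.of fun u w => (A u w : ℝ)

/-- Powers of an integer matrix. -/
def intPow (W : ℕ) (A : ℕ → ℕ → ℤ) : ℕ → ℕ → ℕ → ℤ
  | 0, u, w => if u = w then 1 else 0
  | i + 1, u, w => ∑ x ∈ Finset.range W, intPow W A i u x * A x w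

/-- The trace of the product of two integer matrices. -/
def pairing (W : ℕ) (A X : ℕ → ℕ → ℤ) : ℤ :=
  ∑ u ∈ Finset.range W, ∑ w ∈ Finset.range W, A u w * X w u

/-- The trace of an integer matrix. -/
def intTrace (W : ℕ) (A : ℕ → ℕ → ℤ) : ℤ := ∑ u ∈ Finset.range W, A u u

theorem toMat_intPow (W : ℕ) (A : ℕ → ℕ → ℤ) (q : ℕ) : toMat W (intPow W A q) = toMat W A ^ q := by
  induction q with
  | zero =>
    ext u w
    rw [toMat, Matrix.of_apply, intPow, pow_zero, Matrix.one_apply]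
    simp only [Fin.val_inj]
    split_ifs <;> simp
  | succ q ih =>
    rw [pow_succ, ← ih]
    ext u w
    rw [toMat, Matrix.of_apply, intPow, Matrix.mul_apply]
    push_cast
    rw [← Fin.sum_univ_eq_sum_range fun x => ((intPow W A q u x : ℝ) * A x w)]
    rfl

theorem cast_pairing (W : ℕ) (A X : ℕ → ℕ → ℤ) :
    (pairing W A X : ℝ) = (toMat W A * toMat W X).trace := by
  rw [pairing, Matrix.trace]
  push_cast
  rw [← Fin.sum_univ_eq_sum_range fun u => ∑ w ∈ Finset.range W, ((A u w : ℝ) * X w u)]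
  refine Finset.sum_congr rfl fun u _ => ?_
  rw [diag_apply, Matrix.mul_apply, ← Fin.sum_univ_eq_sum_range fun w => ((A u w : ℝ) * X w u)]
  rfl

theorem cast_intTrace (W : ℕ) (A : ℕ → ℕ → ℤ) : (intTrace W A : ℝ) = (toMat W A).trace := by
  rw [intTrace, Matrix.trace]
  push_cast
  rw [← Fin.sum_univ_eq_sum_range fun u => ((A u u : ℤ) : ℝ)]
  rfl

theorem abs_trace_mul_le {W : ℕ} {K X : Matrix (Fin W) (Fin W) ℝ} {τ : ℝ}
    (hK : ∀ u w, |K u w| ≤ 1) (hX : ∀ u w, |X u w| ≤ τ) : |(K * X).trace| ≤ W ^ 2 * τ := by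
  rw [Matrix.trace]
  refine (Finset.abs_sum_le_sum_abs _ _).trans ?_
  have h : ∀ u, |(K * X).diag u| ≤ W * τ := fun u => by
    rw [diag_apply, Matrix.mul_apply]
    refine (Finset.abs_sum_le_sum_abs _ _).trans ?_
    refine (Finset.sum_le_sum fun w _ => ?_ : _ ≤ ∑ _w : Fin W, τ).trans_eq (by simp)
    rw [abs_mul]
    calc |K u w| * |X w u| ≤ 1 * |X w u| := mul_le_mul_of_nonneg_right (hK u w) (abs_nonneg _)
      _ ≤ τ := by rw [one_mul]; exact hX w u
  refine (Finset.sum_le_sum fun u _ => h u).trans_eq ?_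
  simp
  ring

/-! ### The descent in integer arithmetic -/

/-- The moment matrix scaled by `s`, at the point `Y / s`. -/
def gram (n : ℕ) (s : ℤ) (Y : ℕ → ℤ) (u w : ℕ) : ℤ :=
  s * baseEntry n u w + ∑ v ∈ Finset.range ((n + 1) ^ 8), Y v * coefEntry n v u w

/-- A shift of the negated moment matrix. -/
def shifted (n : ℕ) (s C : ℤ) (Y : ℕ → ℤ) (u w : ℕ) : ℤ := (if u = w then C else 0) - gram n s Y u w

/-- A power that concentrates on the eigenvectors of the smallest eigenvalues. -/
def weight (n : ℕ) (s C : ℤ) (q : ℕ) (Y : ℕ → ℤ) : ℕ → ℕ → ℤ :=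
  intPow ((n + 1) ^ 4) (shifted n s C Y) q

/-- The penalty, with respect to a test matrix `A`. -/
def penalty (n : ℕ) (R s C : ℤ) (q : ℕ) (Y : ℕ → ℤ) (A : ℕ → ℕ → ℤ) : ℤ :=
  if pairing ((n + 1) ^ 4) (gram n s Y) (weight n s C q Y) < 0 then
    R * pairing ((n + 1) ^ 4) A (weight n s C q Y) / intTrace ((n + 1) ^ 4) (weight n s C q Y)
  else 0

/-- The iterates of the descent. -/
def iterates (n : ℕ) (b : ℕ → ℤ) (R s C : ℤ) (q : ℕ) : ℕ → ℕ → ℤ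
  | 0, _ => 0
  | t + 1, v => iterates n b R s C q t v
      + (b v + penalty n R s C q (iterates n b R s C q t) (coefEntry n v))

/-- The penalised objective, scaled by `s`. -/
def objective (n : ℕ) (b : ℕ → ℤ) (R s C : ℤ) (q : ℕ) (Y : ℕ → ℤ) : ℤ :=
  ∑ v ∈ Finset.range ((n + 1) ^ 8), b v * Y v + penalty n R s C q Y (gram n s Y)

theorem abs_wordTr_le (n L c : ℕ) : |wordTr n L c| ≤ 1 := by
  rw [wordTr, abs_mul, Finset.abs_prod]
  have h1 : |wordSgn n L c| = 1 := by
    rcases wordSgn_eq_one_or n L c with h | h <;> simp [h]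
  rw [h1, one_mul]
  refine Finset.prod_le_one (fun _ _ => abs_nonneg _) fun j _ => ?_
  split_ifs <;> simp

theorem abs_isObs_le (n v : ℕ) : |isObs n v| ≤ 1 := by
  rw [isObs]
  split_ifs <;> simp

theorem abs_mul_le_one {x y : ℤ} (hx : |x| ≤ 1) (hy : |y| ≤ 1) : |x * y| ≤ 1 := by
  rw [abs_mul]
  exact mul_le_one₀ hx (abs_nonneg _) hy

theorem abs_baseEntry_le (n u w : ℕ) : |baseEntry n u w| ≤ 1 :=
  abs_mul_le_one (abs_wordTr_le _ _ _) (abs_wordTr_le _ _ _)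

theorem abs_coefEntry_le (n v u w : ℕ) : |coefEntry n v u w| ≤ 1 :=
  abs_mul_le_one (abs_isObs_le _ _) (abs_mul_le_one (abs_wordTr_le _ _ _) (abs_wordTr_le _ _ _))

theorem abs_gram_le {n : ℕ} {s L : ℤ} (hs : 0 ≤ s) {Y : ℕ → ℤ}
    (hY : ∀ v < (n + 1) ^ 8, |Y v| ≤ L) (u w : ℕ) :
    |gram n s Y u w| ≤ s + (n + 1) ^ 8 * L := by
  refine (abs_add_le _ _).trans (add_le_add ?_ ?_)
  · rw [abs_mul, abs_of_nonneg hs]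
    exact mul_le_of_le_one_right hs (abs_baseEntry_le n u w)
  · refine (Finset.abs_sum_le_sum_abs _ _).trans ?_
    refine (Finset.sum_le_sum fun v hv => ?_ :
      _ ≤ ∑ _v ∈ Finset.range ((n + 1) ^ 8), L).trans_eq (by simp)
    rw [abs_mul]
    have h := hY v (Finset.mem_range.mp hv)
    exact (mul_le_of_le_one_right (abs_nonneg _) (abs_coefEntry_le n v u w)).trans h

theorem toMat_gram {n : ℕ} {s : ℤ} (hs : 0 < s) (Y : ℕ → ℤ) :
    toMat ((n + 1) ^ 4) (gram n s Y)
      = (s : ℝ) • pencil (baseMat n) (coefMat n) fun v => (Y v : ℝ) / s := by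
  have hs' : (s : ℝ) ≠ 0 := by exact_mod_cast hs.ne'
  ext u w
  rw [toMat, Matrix.of_apply, gram, Matrix.smul_apply, pencil, Matrix.add_apply, Matrix.sum_apply,
    smul_eq_mul, mul_add, Finset.mul_sum]
  push_cast
  rw [← Fin.sum_univ_eq_sum_range fun v => ((Y v : ℝ) * coefEntry n v u w)]
  congr 1
  refine Finset.sum_congr rfl fun v _ => ?_
  rw [Matrix.smul_apply, smul_eq_mul, coefMat, Matrix.of_apply]
  field_simp

theorem toMat_shifted (n : ℕ) (s C : ℤ) (Y : ℕ → ℤ) : toMat ((n + 1) ^ 4) (shifted n s C Y)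
    = (C : ℝ) • (1 : Matrix (Fin ((n + 1) ^ 4)) (Fin ((n + 1) ^ 4)) ℝ)
      - toMat ((n + 1) ^ 4) (gram n s Y) := by
  ext u w
  rw [Matrix.sub_apply, Matrix.smul_apply, Matrix.one_apply, toMat, toMat, Matrix.of_apply,
    Matrix.of_apply, shifted]
  simp only [Fin.val_inj]
  push_cast
  split_ifs <;> simp

/-! ### Bounds and the eigenvalue certificate for one step of the descent -/

section Step

variable {n : ℕ} {s C L : ℤ} {Y : ℕ → ℤ}

theorem posDef_toMat_shifted (hs : 0 < s) (hY : ∀ v < (n + 1) ^ 8, |Y v| ≤ L)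
    (hC : (n + 1) ^ 4 * (s + (n + 1) ^ 8 * L) < C) :
    (toMat ((n + 1) ^ 4) (shifted n s C Y)).PosDef := by
  rw [toMat_shifted]
  refine posDef_smul_one_sub (m := s + (n + 1) ^ 8 * L) ?_ (fun u w => ?_) ?_
  · rw [toMat_gram hs, IsHermitian, conjTranspose_smul, star_trivial, (isHermitian_pencil _).eq]
  · rw [toMat, Matrix.of_apply]
    exact_mod_cast abs_gram_le hs.le hY u w
  · rw [Fintype.card_fin]
    exact_mod_cast hC

theorem toMat_weight (q : ℕ) : toMat ((n + 1) ^ 4) (weight n s C q Y)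
    = toMat ((n + 1) ^ 4) (shifted n s C Y) ^ q := toMat_intPow _ _ _

theorem intTrace_weight_pos (hs : 0 < s) (hY : ∀ v < (n + 1) ^ 8, |Y v| ≤ L)
    (hC : (n + 1) ^ 4 * (s + (n + 1) ^ 8 * L) < C) (q : ℕ) :
    0 < intTrace ((n + 1) ^ 4) (weight n s C q Y) := by
  have h := trace_pow_pos (posDef_toMat_shifted hs hY hC) q
  rw [← toMat_weight, ← cast_intTrace] at h
  exact_mod_cast h

theorem abs_pairing_coefEntry_le (hs : 0 < s) (hY : ∀ v < (n + 1) ^ 8, |Y v| ≤ L)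
    (hC : (n + 1) ^ 4 * (s + (n + 1) ^ 8 * L) < C) (r v : ℕ) :
    |pairing ((n + 1) ^ 4) (coefEntry n v) (weight n s C (r + r) Y)|
      ≤ ((n + 1) ^ 4) ^ 2 * intTrace ((n + 1) ^ 4) (weight n s C (r + r) Y) := by
  have hB := posDef_toMat_shifted hs hY hC
  have h := abs_trace_mul_le (K := toMat ((n + 1) ^ 4) (coefEntry n v))
    (X := toMat ((n + 1) ^ 4) (weight n s C (r + r) Y))
    (τ := (toMat ((n + 1) ^ 4) (weight n s C (r + r) Y)).trace)
    (fun u w => by rw [toMat, Matrix.of_apply]; exact_mod_cast abs_coefEntry_le n v u w)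
    (fun u w => by
      rw [toMat_weight, pow_add]
      exact abs_mul_self_apply_le (hB.isHermitian.pow r) u w)
  rw [← cast_pairing, ← cast_intTrace] at h
  exact_mod_cast h

theorem abs_penalty_le (hs : 0 < s) (hY : ∀ v < (n + 1) ^ 8, |Y v| ≤ L)
    (hC : (n + 1) ^ 4 * (s + (n + 1) ^ 8 * L) < C) {R : ℤ} (hR : 0 ≤ R) (r v : ℕ) :
    |penalty n R s C (r + r) Y (coefEntry n v)| ≤ R * ((n + 1) ^ 4) ^ 2 := by
  rw [penalty]
  split_ifs
  · have hT := intTrace_weight_pos hs hY hC (r + r)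
    have h := abs_le.mp (abs_pairing_coefEntry_le hs hY hC r v)
    rw [abs_le]
    constructor
    · rw [Int.le_ediv_iff_mul_le hT]
      nlinarith [mul_le_mul_of_nonneg_left h.1 hR]
    · refine Int.ediv_le_of_le_mul hT ?_
      nlinarith [mul_le_mul_of_nonneg_left h.2 hR]
  · rw [abs_zero]; positivity

theorem abs_cast_ediv_sub_le (a : ℤ) {d : ℤ} (hd : 0 < d) :
    |((a / d : ℤ) : ℝ) - (a : ℝ) / d| ≤ 1 := by
  have hd' : (0 : ℝ) < d := by exact_mod_cast hd
  have h1 : ((a / d : ℤ) : ℝ) * d ≤ a := by exact_mod_cast Int.ediv_mul_le a hd.ne'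
  have h2 : (a : ℝ) < ((a / d : ℤ) + 1) * d := by exact_mod_cast Int.lt_ediv_add_one_mul_self a hd
  rw [← le_div_iff₀ hd'] at h1
  rw [← div_lt_iff₀ hd'] at h2
  rw [abs_le]
  constructor <;> linarith

theorem abs_iterates_le {b : ℕ → ℤ} {R : ℤ} (hs : 0 < s) (hR : 0 ≤ R)
    (hb : ∀ v, |b v| ≤ R) {T : ℕ}
    (hC : (n + 1) ^ 4 * (s + (n + 1) ^ 8 * (T * (R + R * ((n + 1) ^ 4) ^ 2))) < C) (r : ℕ) {t : ℕ}
    (ht : t ≤ T) (v : ℕ) :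
    |iterates n b R s C (r + r) t v| ≤ t * (R + R * ((n + 1) ^ 4) ^ 2) := by
  have hγ : 0 ≤ R + R * ((n + 1 : ℤ) ^ 4) ^ 2 := by positivity
  induction t generalizing v with
  | zero => simp [iterates]
  | succ t ih =>
    rw [iterates]
    have h1 := ih (by omega) v
    -- The condition on C refers to a bound on the iterates, so the uniform bound for all T steps is
    -- used as L; the current iterate obeys it by induction.
    have h2 := abs_penalty_le hs (L := T * (R + R * ((n + 1) ^ 4) ^ 2)) (fun v _ =>
      (ih (by omega) v).trans (mul_le_mul_of_nonneg_right (by exact_mod_cast (by omega)) hγ))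
      hC hR r v
    have h3 := abs_add_le (iterates n b R s C (r + r) t v)
      (b v + penalty n R s C (r + r) (iterates n b R s C (r + r) t) (coefEntry n v))
    have h4 := abs_add_le (b v)
      (penalty n R s C (r + r) (iterates n b R s C (r + r) t) (coefEntry n v))
    have h5 := hb v
    push_cast
    linarith

theorem trace_shifted_le (hs : 0 < s) (hY : ∀ v < (n + 1) ^ 8, |Y v| ≤ L)
    (hC : (n + 1) ^ 4 * (s + (n + 1) ^ 8 * L) < C) :
    (toMat ((n + 1) ^ 4) (shifted n s C Y)).trace ≤ (n + 1) ^ 4 * (2 * C) := by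
  rw [← cast_intTrace]
  have h : intTrace ((n + 1) ^ 4) (shifted n s C Y) ≤ (n + 1) ^ 4 * (2 * C) := by
    rw [intTrace]
    refine (Finset.sum_le_sum fun u _ => ?_ :
      _ ≤ ∑ _u ∈ Finset.range ((n + 1) ^ 4), 2 * C).trans_eq (by simp)
    rw [shifted, if_pos rfl]
    have h1 := abs_le.mp (abs_gram_le hs.le hY u u)
    have h2 : (1 : ℤ) ≤ (n + 1) ^ 4 := one_le_pow₀ (by omega)
    have h3 : 0 ≤ s + (n + 1) ^ 8 * L := (abs_nonneg _).trans (abs_gram_le hs.le hY u u)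
    nlinarith
  exact_mod_cast h

/-- The normalised weight matrix is a certificate that the moment matrix is nearly feasible. -/
theorem posSemidef_pencil_add (hs : 0 < s) (hY : ∀ v < (n + 1) ^ 8, |Y v| ≤ L)
    (hC : (n + 1) ^ 4 * (s + (n + 1) ^ 8 * L) < C) (q : ℕ) :
    (pencil (baseMat n) (coefMat n) (fun v => (Y v : ℝ) / s)
      + (2 * ((n + 1) ^ 4) ^ 2 * C / ((q + 1) * s)
        - (pairing ((n + 1) ^ 4) (gram n s Y) (weight n s C q Y) : ℝ)
          / (s * intTrace ((n + 1) ^ 4) (weight n s C q Y)))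
      • (1 : Matrix (Fin ((n + 1) ^ 4)) (Fin ((n + 1) ^ 4)) ℝ)).PosSemidef := by
  have hs' : (0 : ℝ) < s := by exact_mod_cast hs
  have hT : (0 : ℝ) < intTrace ((n + 1) ^ 4) (weight n s C q Y) := by
    exact_mod_cast intTrace_weight_pos hs hY hC q
  have hB := posDef_toMat_shifted hs hY hC
  have htrB := trace_shifted_le hs hY hC
  have : Nonempty (Fin ((n + 1) ^ 4)) := ⟨⟨0, by positivity⟩⟩
  have h := posSemidef_trace_ratio hB.posSemidef q
  have hpair := cast_pairing ((n + 1) ^ 4) (gram n s Y) (weight n s C q Y)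
  rw [cast_intTrace, toMat_weight] at hT ⊢
  rw [toMat_weight] at hpair
  rw [Fintype.card_fin] at h
  set B := toMat ((n + 1) ^ 4) (shifted n s C Y) with hBdef
  set M := pencil (baseMat n) (coefMat n) (fun v => (Y v : ℝ) / s) with hM
  have hBM : B = (C : ℝ) • (1 : Matrix (Fin ((n + 1) ^ 4)) (Fin ((n + 1) ^ 4)) ℝ) - (s : ℝ) • M := by
    rw [hBdef, toMat_shifted, toMat_gram hs]
  -- As B = C - sM, the ratio of consecutive trace powers of B translates into the pairing of the
  -- moment matrix with B^q, and the upper estimate of B into a lower estimate of M.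
  have hq1 : (B ^ (q + 1)).trace = C * (B ^ q).trace
      - pairing ((n + 1) ^ 4) (gram n s Y) (weight n s C q Y) := by
    have h1 : B * B ^ q = ((C : ℝ) • (1 : Matrix (Fin ((n + 1) ^ 4)) (Fin ((n + 1) ^ 4)) ℝ)
        - (s : ℝ) • M) * B ^ q := by rw [← hBM]
    rw [hpair, pow_succ' B q, toMat_gram hs, ← hM, h1, Matrix.sub_mul, Matrix.trace_sub, Matrix.smul_mul, Matrix.one_mul, Matrix.trace_smul,
      smul_eq_mul]
  set p : ℝ := ((pairing ((n + 1) ^ 4) (gram n s Y) (weight n s C q Y) : ℤ) : ℝ) with hp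
  -- The exact error term contains tr B; adding a nonnegative multiple of the identity replaces it
  -- by its bound (n + 1)^4 · 2C.
  have hsum := (h.smul (inv_nonneg.mpr (mul_pos hs' hT).le)).add
    (PosSemidef.one.smul (R := ℝ) (n := Fin ((n + 1) ^ 4))
      (a := (n + 1) ^ 4 / ((q + 1) * s) * ((n + 1) ^ 4 * (2 * C) - B.trace))
      (mul_nonneg (by positivity) (sub_nonneg.mpr htrB)))
  convert hsum using 1
  rw [hq1]
  ext u w
  have hBe : B u w = C * (1 : Matrix (Fin ((n + 1) ^ 4)) (Fin ((n + 1) ^ 4)) ℝ) u w - s * M u w := by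
    rw [hBM]; rfl
  simp only [Matrix.add_apply, Matrix.sub_apply, Matrix.smul_apply, smul_eq_mul, hBe]
  push_cast
  have hq0 : (q : ℝ) + 1 ≠ 0 := by positivity
  field_simp
  ring

end Step

theorem abs_div_mul_sub_le {S s T val G a e d : ℝ} (hT : 0 < T) (h : |S / s - G| ≤ T * d)
    (hup : G ≤ T * (val + e)) (hlow : T * val - T * a ≤ G) (ha : 0 ≤ a) (he : 0 ≤ e) :
    |S / (s * T) - val| ≤ a + e + d := by
  have h1 : S / (s * T) - val = (S / s - T * val) / T := by
    rw [sub_div, mul_div_cancel_left₀ _ hT.ne', div_div]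
  rw [h1, abs_div, abs_of_pos hT, div_le_iff₀ hT, abs_le]
  have h2 := abs_le.mp h
  have h3 := mul_nonneg hT.le ha
  have h4 := mul_nonneg hT.le he
  constructor <;> linarith [h2.1, h2.2]

set_option maxHeartbeats 800000 in
/-- The descent approximates the value of the relaxation. -/
theorem abs_sum_objective_sub_le {n : ℕ} (β : Quad n → ℤ) {b : ℕ → ℤ}
    (hbβ : ∀ v : Fin ((n + 1) ^ 8), (b v : ℂ) = tr (word n 8 v * quartic fun S => (β S : ℝ)))
    {R s C : ℤ} (hs : 0 < s) (hb : ∀ v, |b v| ≤ R) (hβ : ∑ S, |β S| ≤ R) {T : ℕ} (hT : 0 < T) (r : ℕ)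
    (hC : (n + 1) ^ 4 * (s + (n + 1) ^ 8 * (T * (R + R * ((n + 1) ^ 4) ^ 2))) < C) :
    |(∑ t ∈ Finset.range T, objective n b R s C (r + r) (iterates n b R s C (r + r) t) : ℤ)
      / ((s : ℝ) * T) - sos 4 (quartic fun S => (β S : ℝ))|
      ≤ s * (n + 1) ^ 8 / (2 * T) + (n + 1) ^ 8 * (R + R * ((n + 1) ^ 4) ^ 2) ^ 2 / (2 * s)
        + (n + 1) ^ 8 * (1 + T * (R + R * ((n + 1) ^ 4) ^ 2) / s)
        + R * (2 * ((n + 1) ^ 4) ^ 2 * C / ((r + r + 1) * s)) + 1 / s := by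
  have hs' : (0 : ℝ) < s := by exact_mod_cast hs
  have hT' : (0 : ℝ) < T := by exact_mod_cast hT
  have hR : 0 ≤ R := (abs_nonneg _).trans (hb 0)
  have hR' : (0 : ℝ) ≤ R := by exact_mod_cast hR
  set γ : ℤ := R + R * ((n + 1) ^ 4) ^ 2 with hγ
  have hγ0 : 0 ≤ γ := by positivity
  set it := iterates n b R s C (r + r) with hit
  set val := sos 4 (quartic fun S => (β S : ℝ)) with hval
  have hval0 : 0 ≤ val := sos_quartic_nonneg (by norm_num) _
  have hvalR : val ≤ R := (sos_quartic_le_sum (by norm_num) _).trans (by exact_mod_cast hβ)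
  have hY : ∀ t ≤ T, ∀ v < (n + 1) ^ 8, |it t v| ≤ T * γ := fun t ht v _ =>
    (abs_iterates_le hs hR hb hC r ht v).trans
      (mul_le_mul_of_nonneg_right (by exact_mod_cast ht) hγ0)
  set τ : ℕ → ℤ := fun t => intTrace ((n + 1) ^ 4) (weight n s C (r + r) (it t)) with hτ
  have hτ0 : ∀ t ≤ T, (0 : ℝ) < τ t := fun t ht => by
    exact_mod_cast intTrace_weight_pos hs (hY t ht) hC (r + r)
  have hτz : ∀ t ≤ T, 0 < τ t := fun t ht => intTrace_weight_pos hs (hY t ht) hC (r + r)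
  set y : ℕ → Fin ((n + 1) ^ 8) → ℝ := fun t v => (it t v : ℝ) / s with hy
  set X : ℕ → Matrix (Fin ((n + 1) ^ 4)) (Fin ((n + 1) ^ 4)) ℝ := fun t =>
    (τ t : ℝ)⁻¹ • toMat ((n + 1) ^ 4) (weight n s C (r + r) (it t)) with hX
  set P : ℕ → ℤ := fun t => pairing ((n + 1) ^ 4) (gram n s (it t)) (weight n s C (r + r) (it t))
    with hP
  have htrX : ∀ t, (pencil (baseMat n) (coefMat n) (y t) * X t).trace = P t / (s * τ t) := by
    intro t
    have h := cast_pairing ((n + 1) ^ 4) (gram n s (it t)) (weight n s C (r + r) (it t))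
    rw [toMat_gram hs, Matrix.smul_mul, Matrix.trace_smul, smul_eq_mul] at h
    rw [hX, Matrix.mul_smul, Matrix.trace_smul, smul_eq_mul, hP, h]
    field_simp
    rfl
  have htrK : ∀ t v, (coefMat n v * X t).trace
      = pairing ((n + 1) ^ 4) (coefEntry n v) (weight n s C (r + r) (it t)) / τ t := by
    intro t v
    rw [hX, Matrix.mul_smul, Matrix.trace_smul, smul_eq_mul, cast_pairing, div_eq_inv_mul]
    rfl
  have hneg : ∀ t ≤ T, ((pencil (baseMat n) (coefMat n) (y t) * X t).trace < 0 ↔ P t < 0) := by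
    intro t ht
    rw [htrX, div_lt_iff₀ (mul_pos hs' (hτ0 t ht)), zero_mul]
    exact_mod_cast Iff.rfl
  -- The integer penalty is the exact one rounded by at most 1. The case distinctions coincide, as
  -- the pairing and the normalised trace have the same sign.
  have hpen : ∀ t ≤ T, ∀ A : ℕ → ℕ → ℤ, |(penalty n R s C (r + r) (it t) A : ℝ)
      - (if (pencil (baseMat n) (coefMat n) (y t) * X t).trace < 0 then (R : ℝ) else 0)
        * (pairing ((n + 1) ^ 4) A (weight n s C (r + r) (it t)) / τ t)| ≤ 1 := by
    intro t ht A
    simp only [hneg t ht, penalty]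
    split_ifs with h
    · have h1 := abs_cast_ediv_sub_le
        (R * pairing ((n + 1) ^ 4) A (weight n s C (r + r) (it t))) (hτz t ht)
      push_cast at h1
      rwa [mul_div_assoc] at h1
    · simp
  have hstep : ∀ t v, (s : ℝ) * (y (t + 1) v - y t v)
      = b v + penalty n R s C (r + r) (it t) (coefEntry n v) := by
    intro t v
    simp only [hy, hit, iterates]
    push_cast
    field_simp
    ring
  set ε : ℝ := 2 * ((n + 1) ^ 4) ^ 2 * C / ((r + r + 1) * s) with hε
  have hC0 : 0 ≤ C := by
    refine le_trans ?_ hC.le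
    positivity
  have hC0' : (0 : ℝ) ≤ C := by exact_mod_cast hC0
  have hε0 : 0 ≤ ε := by positivity
  have happ : ∀ t < T, (pencil (baseMat n) (coefMat n) (y t)
      + (ε - (pencil (baseMat n) (coefMat n) (y t) * X t).trace)
        • (1 : Matrix (Fin ((n + 1) ^ 4)) (Fin ((n + 1) ^ 4)) ℝ)).PosSemidef := by
    intro t ht
    have h := posSemidef_pencil_add hs (hY t ht.le) hC (r + r)
    rw [htrX, hε]
    push_cast at h
    exact h
  -- The comparison point consists of the word values of an optimal pseudoexpectation.
  obtain ⟨z, hz1, hz, hzval⟩ := exists_optimal_wordValues _ hbβ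
  obtain ⟨hup, hlow⟩ := subgradient_converges (γ := γ) (Y := T * γ / s) hs' hε0 hval0 hvalR
    (fun y δ hδ h => sum_mul_le_of_posSemidef _ hbβ y δ hδ h) hz1 hz hzval (y := y) (X := X) (T := T)
    (fun v => by simp [hy, hit, iterates])
    (fun t ht => ⟨(τ t : ℝ)⁻¹, toMat ((n + 1) ^ 4) (shifted n s C (it t)) ^ r,
      inv_nonneg.mpr (hτ0 t ht.le).le,
      (posDef_toMat_shifted hs (hY t ht.le) hC).isHermitian.pow r, by
        rw [hX, ← pow_add, ← toMat_weight]⟩)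
    happ
    (fun t ht v => by
      rw [hstep, htrK, add_sub_add_left_eq_sub]
      exact hpen t ht.le _)
    (fun t ht v => by
      rw [hstep]
      have h1 := hb v
      have h2 := abs_penalty_le hs (hY t ht.le) hC hR r v
      have h3 := abs_add_le (b v) (penalty n R s C (r + r) (it t) (coefEntry n v))
      exact_mod_cast h3.trans (add_le_add h1 h2))
    (fun t ht v => by
      rw [hy, abs_div, abs_of_pos hs']
      refine div_le_div_of_nonneg_right ?_ hs'.le
      exact_mod_cast hY t ht.le v v.2)
  rw [Fintype.card_fin] at hlow
  set G : ℕ → ℝ := fun t => ∑ v : Fin ((n + 1) ^ 8), (b v : ℝ) * y t v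
      + (if (pencil (baseMat n) (coefMat n) (y t) * X t).trace < 0 then (R : ℝ) else 0)
        * (pencil (baseMat n) (coefMat n) (y t) * X t).trace with hG
  have hobj : ∀ t < T, |(objective n b R s C (r + r) (it t) : ℝ) / s - G t| ≤ 1 / s := by
    intro t ht
    have h1 := hpen t ht.le (gram n s (it t))
    have h2 : (objective n b R s C (r + r) (it t) : ℝ) / s - G t
        = (penalty n R s C (r + r) (it t) (gram n s (it t))
          - (if (pencil (baseMat n) (coefMat n) (y t) * X t).trace < 0 then (R : ℝ) else 0)
            * (P t / τ t)) / s := by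
      rw [hG]
      simp only [htrX]
      rw [objective]
      push_cast
      rw [← Fin.sum_univ_eq_sum_range fun v => ((b v : ℝ) * it t v), sub_div, add_div,
        Finset.sum_div, mul_comm (s : ℝ), ← div_div, mul_div_assoc _ _ (s : ℝ), hy]
      simp only [mul_div_assoc]
      ring
    rw [h2, abs_div, abs_of_pos hs']
    exact div_le_div_of_nonneg_right h1 hs'.le
  have hsum : |(∑ t ∈ Finset.range T, objective n b R s C (r + r) (it t) : ℤ) / (s : ℝ)
      - ∑ t ∈ Finset.range T, G t| ≤ T * (1 / s) := by
    push_cast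
    rw [Finset.sum_div, ← Finset.sum_sub_distrib]
    refine (Finset.abs_sum_le_sum_abs _ _).trans ?_
    refine (Finset.sum_le_sum fun t ht => hobj t (Finset.mem_range.mp ht)).trans_eq (by simp)
  have hγ' : (R : ℝ) + R * ((n + 1) ^ 4) ^ 2 = γ := by rw [hγ]; push_cast; ring
  have hγ0' : (0 : ℝ) ≤ γ := by exact_mod_cast hγ0
  rw [hγ']
  refine abs_div_mul_sub_le hT' hsum hup (le_trans (le_of_eq ?_) hlow) (by positivity)
    (mul_nonneg hR' hε0)
  push_cast
  field_simp
  ring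

end Majorana

namespace Majorana

open Cliff

/-! ### Reading the input -/

theorem exists_sort_quad {n : ℕ} (S : Quad n) : ∃ i j k l : Fin n,
    S.1.sort (· ≤ ·) = [i, j, k, l] := by
  have h : (S.1.sort (· ≤ ·)).length = 4 := by rw [Finset.length_sort, S.2]
  match hl : S.1.sort (· ≤ ·), h with
  | [i, j, k, l], _ => exact ⟨i, j, k, l, rfl⟩

/-- The word of the four indices in the code of a quadruple. -/
def quadWord (n m : ℕ) : ℕ :=
  m / n / n / n % n + 1 + (n + 1) * (m / n / n % n + 1 + (n + 1) * (m / n % n + 1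
    + (n + 1) * (m % n + 1)))

theorem code_digits {n i j k l : ℕ} (hi : i < n) (hj : j < n) (hk : k < n) (hl : l < n) {m : ℕ}
    (hm : m = ((i * n + j) * n + k) * n + l) :
    m / n / n / n % n = i ∧ m / n / n % n = j ∧ m / n % n = k ∧ m % n = l ∧ m < n ^ 4 := by
  have hn : 0 < n := by omega
  have step : ∀ x y, y < n → (x * n + y) / n = x ∧ (x * n + y) % n = y := fun x y hy => by
    constructor
    · rw [mul_comm, Nat.mul_add_div hn, Nat.div_eq_of_lt hy, add_zero]
    · rw [mul_comm, Nat.mul_add_mod, Nat.mod_eq_of_lt hy]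
  have h1 := step ((i * n + j) * n + k) l hl
  have h2 := step (i * n + j) k hk
  have h3 := step i j hj
  have bound : ∀ x y B, x < B → y < n → x * n + y < B * n := fun x y B hx hy => by
    have := Nat.mul_le_mul_right n (Nat.succ_le_of_lt hx)
    rw [Nat.succ_mul] at this
    omega
  subst hm
  rw [h1.1, h1.2, h2.1, h2.2, h3.1, h3.2, Nat.mod_eq_of_lt hi]
  refine ⟨rfl, rfl, rfl, rfl, ?_⟩
  have h4 : n ^ 4 = n * n * n * n := by ring
  rw [h4]
  exact bound _ _ _ (bound _ _ _ (bound _ _ _ hi hj) hk) hl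

theorem Quad.code_eq {n : ℕ} {S : Quad n} {i j k l : Fin n}
    (h : S.1.sort (· ≤ ·) = [i, j, k, l]) :
    S.code = (((i : ℕ) * n + j) * n + k) * n + l := by
  simp [Quad.code, h]

theorem Quad.code_lt {n : ℕ} (S : Quad n) : S.code < n ^ 4 := by
  obtain ⟨i, j, k, l, h⟩ := exists_sort_quad S
  exact (code_digits i.2 j.2 k.2 l.2 (Quad.code_eq h)).2.2.2.2

theorem Quad.code_injective (n : ℕ) : Function.Injective (Quad.code : Quad n → ℕ) := by
  intro S S' hc
  obtain ⟨i, j, k, l, h⟩ := exists_sort_quad S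
  obtain ⟨i', j', k', l', h'⟩ := exists_sort_quad S'
  have h1 := code_digits i.2 j.2 k.2 l.2 (Quad.code_eq h)
  have h2 := code_digits i'.2 j'.2 k'.2 l'.2 (Quad.code_eq h')
  rw [hc] at h1
  have e1 : i = i' := Fin.ext (h1.1.symm.trans h2.1)
  have e2 : j = j' := Fin.ext (h1.2.1.symm.trans h2.2.1)
  have e3 : k = k' := Fin.ext (h1.2.2.1.symm.trans h2.2.2.1)
  have e4 : l = l' := Fin.ext (h1.2.2.2.1.symm.trans h2.2.2.2.1)
  refine Subtype.ext ?_
  rw [← Finset.sort_toFinset (s := S.1) (· ≤ ·), ← Finset.sort_toFinset (s := S'.1) (· ≤ ·), h, h',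
    e1, e2, e3, e4]

theorem word_quadWord {n : ℕ} (S : Quad n) : word n 4 (quadWord n S.code) = basisElt S.1 := by
  obtain ⟨i, j, k, l, h⟩ := exists_sort_quad S
  obtain ⟨h1, h2, h3, h4, -⟩ := code_digits i.2 j.2 k.2 l.2 (Quad.code_eq h)
  have hlt : ∀ x : Fin n, (x : ℕ) + 1 < (n + 1) ^ 1 := fun x => by
    rw [pow_one]; have := x.2; omega
  have hone : ∀ x : Fin n, word n 1 ((x : ℕ) + 1) = χ x := fun x => by
    have hd : digit n ((x : ℕ) + 1) 0 = x + 1 := by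
      rw [digit, pow_zero, Nat.div_one, Nat.mod_eq_of_lt (by have := x.2; omega)]
    rw [word, word, one_mul, hd, letterSet_succ, χ]
  have hcons : ∀ (x : Fin n) (M e : ℕ), word n (1 + M) ((x : ℕ) + 1 + (n + 1) * e)
      = χ x * word n M e := fun x M e => by
    rw [← hone x, ← word_add (hlt x), pow_one]
  rw [← mono_eq_basisElt, Cliff.mono, h, quadWord, h1, h2, h3, h4]
  simp only [List.map_cons, List.map_nil, List.prod_cons, List.prod_nil, mul_one]
  rw [← hone l]
  exact (hcons i 3 _).trans (congrArg _ ((hcons j 2 _).trans (congrArg _ (hcons k 1 _))))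

theorem inputOf_num {n : ℕ} (a : Quad n → ℚ) (S : Quad n) :
    inputOf a (2 * S.code + 1) = (a S).num := by
  rw [inputOf, if_neg (by omega), Finset.sum_eq_single S]
  · simp
  · intro S' _ hS'
    have := (Quad.code_injective n).ne hS'
    rw [if_neg (by omega), if_neg (by omega)]
  · simp

theorem inputOf_den {n : ℕ} (a : Quad n → ℚ) (S : Quad n) :
    inputOf a (2 * S.code + 2) = (a S).den := by
  rw [inputOf, if_neg (by omega), Finset.sum_eq_single S]
  · rw [if_neg (by omega), if_pos rfl]
  · intro S' _ hS'
    have := (Quad.code_injective n).ne hS'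
    rw [if_neg (by omega), if_neg (by omega)]
  · simp

theorem inputOf_num_eq_zero {n : ℕ} (a : Quad n → ℚ) {m : ℕ} (hm : ∀ S : Quad n, S.code ≠ m) :
    inputOf a (2 * m + 1) = 0 := by
  rw [inputOf, if_neg (by omega)]
  refine Finset.sum_eq_zero fun S _ => ?_
  have := hm S
  rw [if_neg (by omega), if_neg (by omega)]

/-- The coefficients with the scale `Q`, rounded, read from the input. -/
def readCoef (Q : ℤ) (inp : ℕ → ℤ) (m : ℕ) : ℤ := Q * inp (2 * m + 1) / inp (2 * m + 2)

/-- The objective vector of the semidefinite program, read from the input. -/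
def readObj (n : ℕ) (Q : ℤ) (inp : ℕ → ℤ) (v : ℕ) : ℤ :=
  ∑ m ∈ Finset.range (n ^ 4), readCoef Q inp m * wordTr n 12 (v + (n + 1) ^ 8 * quadWord n m)

/-- The coefficients with the scale `Q`, rounded. -/
def roundCoef {n : ℕ} (Q : ℤ) (a : Quad n → ℚ) (S : Quad n) : ℤ := Q * (a S).num / (a S).den

/-- Numbers below n^4 that code no quadruple have numerator 0 in the input, so the program sums over
all of them without testing validity. -/
theorem readObj_eq {n : ℕ} (Q : ℤ) (a : Quad n → ℚ) (v : ℕ) : readObj n Q (inputOf a) v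
    = ∑ S, roundCoef Q a S * wordTr n 12 (v + (n + 1) ^ 8 * quadWord n S.code) := by
  classical
  have h1 : ∀ S, readCoef Q (inputOf a) S.code = roundCoef Q a S := fun S => by
    rw [readCoef, inputOf_num, inputOf_den, roundCoef]
  simp only [← h1]
  rw [← Finset.sum_image (s := Finset.univ) (g := (Quad.code : Quad n → ℕ))
    (f := fun m => readCoef Q (inputOf a) m * wordTr n 12 (v + (n + 1) ^ 8 * quadWord n m))
    fun S _ S' _ h => Quad.code_injective n h]
  refine (Finset.sum_subset ?_ ?_).symm
  · intro m hm
    obtain ⟨S, -, rfl⟩ := Finset.mem_image.mp hm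
    exact Finset.mem_range.mpr S.code_lt
  · intro m _ hm
    have h2 : ∀ S : Quad n, S.code ≠ m := fun S hS =>
      hm (Finset.mem_image.mpr ⟨S, Finset.mem_univ S, hS⟩)
    rw [readCoef, inputOf_num_eq_zero a h2]
    simp

theorem cast_readObj {n : ℕ} (Q : ℤ) (a : Quad n → ℚ) (v : Fin ((n + 1) ^ 8)) :
    (readObj n Q (inputOf a) v : ℂ)
      = tr (word n 8 v * quartic fun S => (roundCoef Q a S : ℝ)) := by
  rw [readObj_eq, quartic, Finset.mul_sum, map_sum, Int.cast_sum]
  refine Finset.sum_congr rfl fun S _ => ?_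
  have h : (wordTr n 12 (v + (n + 1) ^ 8 * quadWord n S.code) : ℂ)
      = tr (word n 8 v * word n 4 (quadWord n S.code)) := wordTr_add v.2 4 _
  rw [mul_smul_comm, map_smul, mono_eq_basisElt, ← word_quadWord, ← h, smul_eq_mul]
  push_cast
  rfl

theorem abs_readObj_le {n : ℕ} (Q : ℤ) (a : Quad n → ℚ) (v : ℕ) :
    |readObj n Q (inputOf a) v| ≤ ∑ S, |roundCoef Q a S| := by
  rw [readObj_eq]
  refine (Finset.abs_sum_le_sum_abs _ _).trans (Finset.sum_le_sum fun S _ => ?_)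
  rw [abs_mul]
  exact mul_le_of_le_one_right (abs_nonneg _) (abs_wordTr_le _ _ _)

theorem card_quad_le (n : ℕ) : Fintype.card (Quad n) ≤ n ^ 4 := by
  rw [card_quad]
  exact Nat.choose_le_pow n 4

theorem sum_abs_roundCoef_le {n : ℕ} {Q : ℤ} (hQ : 0 ≤ Q) (a : Quad n → ℚ) {B : ℕ}
    (ha : ∀ S, HeightLE B (a S)) : ∑ S, |roundCoef Q a S| ≤ n ^ 4 * (Q * B) := by
  have h1 : ∀ S, |roundCoef Q a S| ≤ Q * B := fun S => by
    have h := Int.natAbs_ediv_le_natAbs (Q * (a S).num) (a S).den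
    have h2 : |roundCoef Q a S| ≤ |Q * (a S).num| := by
      rw [Int.abs_eq_natAbs, Int.abs_eq_natAbs]
      exact_mod_cast h
    rw [abs_mul, abs_of_nonneg hQ] at h2
    refine h2.trans (mul_le_mul_of_nonneg_left ?_ hQ)
    rw [Int.abs_eq_natAbs]
    exact_mod_cast (ha S).1
  refine (Finset.sum_le_sum fun S _ => h1 S).trans ?_
  rw [Finset.sum_const, Finset.card_univ, nsmul_eq_mul]
  exact mul_le_mul_of_nonneg_right (by exact_mod_cast card_quad_le n) (by positivity)

theorem sos_smul {n k : ℕ} {h : Cliff n} (hh : DegLE (2 * k) h) {c : ℝ} (hc : 0 ≤ c) :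
    sos k ((c : ℂ) • h) = c * sos k h := by
  refine (isGreatest_sos k (hh.smul (c : ℂ))).unique ⟨?_, ?_⟩
  · obtain ⟨φ, hφ, hv⟩ := (isGreatest_sos k hh).1
    exact ⟨φ, hφ, by rw [map_smul, smul_eq_mul, Complex.re_ofReal_mul, hv]⟩
  · rintro _ ⟨φ, hφ, rfl⟩
    rw [map_smul, smul_eq_mul, Complex.re_ofReal_mul]
    exact mul_le_mul_of_nonneg_left (hφ.re_le_sos hh) hc

/-- Rounding moves each coefficient by at most 1 / Q and there are at most n^4 of them; homogeneity
and the ℓ¹-Lipschitz bound do the rest. -/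
theorem abs_sos_roundCoef_sub_le {n : ℕ} {Q : ℤ} (hQ : 0 < Q) (a : Quad n → ℚ) :
    |sos 4 (quartic fun S => (roundCoef Q a S : ℝ)) / Q - sos 4 (quartic fun S => (a S : ℝ))|
      ≤ n ^ 4 / Q := by
  have hQ' : (0 : ℝ) < Q := by exact_mod_cast hQ
  have hsc : (quartic fun S => (roundCoef Q a S : ℝ))
      = ((Q : ℝ) : ℂ) • quartic fun S => (roundCoef Q a S : ℝ) / Q := by
    rw [← quartic_smul]
    congr 1
    ext S
    rw [Pi.smul_apply, smul_eq_mul, mul_div_cancel₀ _ hQ'.ne']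
  rw [hsc, sos_smul ((degLE_quartic _).mono_deg (by norm_num)) hQ'.le, mul_div_cancel_left₀ _ hQ'.ne']
  have hdiff : ∑ S, |(roundCoef Q a S : ℝ) / Q - (a S : ℝ)| ≤ n ^ 4 / Q := by
    have h1 : ∀ S, |(roundCoef Q a S : ℝ) / Q - (a S : ℝ)| ≤ 1 / Q := fun S => by
      have h := abs_cast_ediv_sub_le (Q * (a S).num) (d := (a S).den)
        (by exact_mod_cast (a S).den_pos)
      have e : (roundCoef Q a S : ℝ) / Q - (a S : ℝ)
          = (((Q * (a S).num / (a S).den : ℤ) : ℝ) - ((Q * (a S).num : ℤ) : ℝ) / ((a S).den : ℤ))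
            / Q := by
        rw [roundCoef, Rat.cast_def]
        push_cast
        field_simp
      rw [e, abs_div, abs_of_pos hQ']
      exact div_le_div_of_nonneg_right h hQ'.le
    refine (Finset.sum_le_sum fun S _ => h1 S).trans ?_
    rw [Finset.sum_const, Finset.card_univ, nsmul_eq_mul, mul_one_div]
    exact div_le_div_of_nonneg_right (by exact_mod_cast card_quad_le n) hQ'.le
  have h1 := sos_quartic_le (k := 4) (by norm_num) (fun S => (roundCoef Q a S : ℝ) / Q)
    fun S => (a S : ℝ)
  have h2 := sos_quartic_le (k := 4) (by norm_num) (fun S => (a S : ℝ))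
    fun S => (roundCoef Q a S : ℝ) / Q
  simp only [abs_sub_comm (a _ : ℝ)] at h2
  rw [abs_le]
  constructor <;> linarith

end Majorana

namespace Majorana

open Cliff

/-! ### The choice of the parameters -/

/-- Here p = n + 2 and x = p^c. The terms are the initial distance, the step size, the rounding of
gradients, the eigenvalue approximation, the rounding of the objective and the rounding of the
input. The exponents make each at most x² p^33; as Q = x³ p^36 and 6 ≤ p³, the sum is at most 1 / x.
The value R = x⁴ p^40 bounds n^4 · Q · x. -/
theorem descent_error_le {p x N m : ℝ} (hp : 2 ≤ p) (hx : 1 ≤ x) (hN0 : 0 ≤ N) (hN : N ≤ p)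
    (hm0 : 0 ≤ m) (hm : m ≤ p) {Q R s T C r : ℝ} (hQ : Q = x ^ 3 * p ^ 36) (hR : R = x ^ 4 * p ^ 40)
    (hs : s = x ^ 6 * p ^ 73) (hT : T = x ^ 4 * p ^ 48) (hC : C = x ^ 8 * p ^ 111)
    (hr : r = x ^ 4 * p ^ 54) :
    (s * N ^ 8 / (2 * T) + N ^ 8 * (R + R * (N ^ 4) ^ 2) ^ 2 / (2 * s)
      + N ^ 8 * (1 + T * (R + R * (N ^ 4) ^ 2) / s)
      + R * (2 * (N ^ 4) ^ 2 * C / ((r + r + 1) * s)) + 1 / s) / Q + m ^ 4 / Q ≤ 1 / x := by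
  have hp0 : 0 < p := by linarith
  have hx0 : 0 < x := by linarith
  have hp1 : 1 ≤ p := by linarith
  have hN8 : N ^ 8 ≤ p ^ 8 := pow_le_pow_left₀ hN0 hN 8
  have hm4 : m ^ 4 ≤ p ^ 4 := pow_le_pow_left₀ hm0 hm 4
  have hx2 : 1 ≤ x ^ 2 := one_le_pow₀ hx
  have hmono : ∀ k ≤ 33, p ^ k ≤ x ^ 2 * p ^ 33 := fun k hk =>
    (pow_le_pow_right₀ hp1 hk).trans (le_mul_of_one_le_left (by positivity) hx2)
  have hγ : R + R * (N ^ 4) ^ 2 ≤ x ^ 4 * p ^ 49 := by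
    have h1 : 1 + p ^ 8 ≤ p ^ 9 := by
      have : 1 ≤ p ^ 8 := one_le_pow₀ hp1
      nlinarith
    calc R + R * (N ^ 4) ^ 2 = R * (1 + N ^ 8) := by ring
      _ ≤ R * p ^ 9 := mul_le_mul_of_nonneg_left (by linarith) (by rw [hR]; positivity)
      _ = x ^ 4 * p ^ 49 := by rw [hR]; ring
  have hγ0 : 0 ≤ R + R * (N ^ 4) ^ 2 := by rw [hR]; positivity
  have t1 : s * N ^ 8 / (2 * T) ≤ x ^ 2 * p ^ 33 := by
    rw [div_le_iff₀ (by rw [hT]; positivity)]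
    calc s * N ^ 8 ≤ s * p ^ 8 := mul_le_mul_of_nonneg_left hN8 (by rw [hs]; positivity)
      _ = x ^ 6 * p ^ 81 := by rw [hs]; ring
      _ ≤ 2 * (x ^ 6 * p ^ 81) := le_mul_of_one_le_left (by positivity) one_le_two
      _ = _ := by rw [hT]; ring
  have t2 : N ^ 8 * (R + R * (N ^ 4) ^ 2) ^ 2 / (2 * s) ≤ x ^ 2 * p ^ 33 := by
    rw [div_le_iff₀ (by rw [hs]; positivity)]
    calc N ^ 8 * (R + R * (N ^ 4) ^ 2) ^ 2 ≤ p ^ 8 * (x ^ 4 * p ^ 49) ^ 2 :=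
          mul_le_mul hN8 (pow_le_pow_left₀ hγ0 hγ 2) (sq_nonneg _) (by positivity)
      _ = x ^ 8 * p ^ 106 := by ring
      _ ≤ 2 * (x ^ 8 * p ^ 106) := le_mul_of_one_le_left (by positivity) one_le_two
      _ = _ := by rw [hs]; ring
  have t3 : N ^ 8 * (1 + T * (R + R * (N ^ 4) ^ 2) / s) ≤ x ^ 2 * p ^ 33 := by
    have h1 : T * (R + R * (N ^ 4) ^ 2) / s ≤ x ^ 2 * p ^ 24 := by
      rw [div_le_iff₀ (by rw [hs]; positivity)]
      calc T * (R + R * (N ^ 4) ^ 2) ≤ T * (x ^ 4 * p ^ 49) :=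
            mul_le_mul_of_nonneg_left hγ (by rw [hT]; positivity)
        _ = x ^ 2 * p ^ 24 * s := by rw [hT, hs]; ring
    have h2 : 1 ≤ x ^ 2 * p ^ 24 := one_le_mul_of_one_le_of_one_le hx2 (one_le_pow₀ hp1)
    calc N ^ 8 * (1 + T * (R + R * (N ^ 4) ^ 2) / s) ≤ p ^ 8 * (x ^ 2 * p ^ 24 + x ^ 2 * p ^ 24) := by
          refine mul_le_mul hN8 (add_le_add h2 h1) ?_ (by positivity)
          have : 0 ≤ T * (R + R * (N ^ 4) ^ 2) / s :=
            div_nonneg (mul_nonneg (by rw [hT]; positivity) hγ0) (by rw [hs]; positivity)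
          linarith
      _ = 2 * (x ^ 2 * p ^ 32) := by ring
      _ ≤ p * (x ^ 2 * p ^ 32) := mul_le_mul_of_nonneg_right hp (by positivity)
      _ = _ := by ring
  have t4 : R * (2 * (N ^ 4) ^ 2 * C / ((r + r + 1) * s)) ≤ x ^ 2 * p ^ 33 := by
    have h0 : 0 < (r + r + 1) * s := by rw [hr, hs]; positivity
    rw [← mul_div_assoc, div_le_iff₀ h0]
    calc R * (2 * (N ^ 4) ^ 2 * C) = 2 * R * C * N ^ 8 := by ring
      _ ≤ 2 * R * C * p ^ 8 := mul_le_mul_of_nonneg_left hN8 (by rw [hR, hC]; positivity)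
      _ = x ^ 2 * p ^ 32 * (2 * r * s) := by rw [hR, hC, hr, hs]; ring
      _ ≤ x ^ 2 * p ^ 33 * ((r + r + 1) * s) := by
        refine mul_le_mul (mul_le_mul_of_nonneg_left
          (pow_le_pow_right₀ hp1 (by norm_num)) (by positivity)) ?_ ?_ (by positivity)
        · exact mul_le_mul_of_nonneg_right (by linarith) (by rw [hs]; positivity)
        · rw [hr, hs]; positivity
  have t5 : 1 / s ≤ x ^ 2 * p ^ 33 := by
    have h1 : 1 ≤ s := by
      rw [hs]
      exact one_le_mul_of_one_le_of_one_le (one_le_pow₀ hx) (one_le_pow₀ hp1)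
    exact ((div_le_one (by linarith)).mpr h1).trans
      ((one_le_pow₀ hp1 (n := 0)).trans (hmono 0 (by norm_num)))
  have t6 : m ^ 4 ≤ x ^ 2 * p ^ 33 := hm4.trans (hmono 4 (by norm_num))
  have hQ0 : 0 < Q := by rw [hQ]; positivity
  rw [← add_div, div_le_div_iff₀ hQ0 hx0, one_mul]
  have h8 : (2 : ℝ) ^ 3 ≤ p ^ 3 := pow_le_pow_left₀ (by norm_num) hp 3
  calc _ ≤ (6 * (x ^ 2 * p ^ 33)) * x := mul_le_mul_of_nonneg_right (by linarith) hx0.le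
    _ = 6 * (x ^ 3 * p ^ 33) := by ring
    _ ≤ p ^ 3 * (x ^ 3 * p ^ 33) := mul_le_mul_of_nonneg_right (by linarith) (by positivity)
    _ = Q := by rw [hQ]; ring

/-- Since 1 + N^8 ≤ p^9, both summands in the bracket are at most x^8 p^105. The prefactor N^4 and
the factor 2 are absorbed by p^6. -/
theorem shift_bound {p x N : ℝ} (hp : 2 ≤ p) (hx : 1 ≤ x) (hN0 : 0 ≤ N) (hN : N ≤ p)
    {R s T C : ℝ} (hR : R = x ^ 4 * p ^ 40) (hs : s = x ^ 6 * p ^ 73) (hT : T = x ^ 4 * p ^ 48)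
    (hC : C = x ^ 8 * p ^ 111) :
    N ^ 4 * (s + N ^ 8 * (T * (R + R * (N ^ 4) ^ 2))) < C := by
  have hp0 : 0 < p := by linarith
  have hx0 : 0 < x := by linarith
  have hp1 : 1 ≤ p := by linarith
  have hN8 : N ^ 8 ≤ p ^ 8 := pow_le_pow_left₀ hN0 hN 8
  have hN4 : N ^ 4 ≤ p ^ 4 := pow_le_pow_left₀ hN0 hN 4
  have hγ : R + R * (N ^ 4) ^ 2 ≤ x ^ 4 * p ^ 49 := by
    have h1 : 1 + p ^ 8 ≤ p ^ 9 := by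
      have : 1 ≤ p ^ 8 := one_le_pow₀ hp1
      nlinarith
    calc R + R * (N ^ 4) ^ 2 = R * (1 + N ^ 8) := by ring
      _ ≤ R * p ^ 9 := mul_le_mul_of_nonneg_left (by linarith) (by rw [hR]; positivity)
      _ = x ^ 4 * p ^ 49 := by rw [hR]; ring
  have hγ0 : 0 ≤ R + R * (N ^ 4) ^ 2 := by rw [hR]; positivity
  have hT0 : 0 ≤ T := by rw [hT]; positivity
  have h1 : N ^ 8 * (T * (R + R * (N ^ 4) ^ 2)) ≤ x ^ 8 * p ^ 105 := by
    calc _ ≤ p ^ 8 * (T * (x ^ 4 * p ^ 49)) :=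
          mul_le_mul hN8 (mul_le_mul_of_nonneg_left hγ hT0) (by positivity) (by positivity)
      _ = _ := by rw [hT]; ring
  have h2 : s ≤ x ^ 8 * p ^ 105 := by
    rw [hs]
    exact mul_le_mul (pow_le_pow_right₀ hx (by norm_num)) (pow_le_pow_right₀ hp1 (by norm_num))
      (by positivity) (by positivity)
  calc N ^ 4 * (s + N ^ 8 * (T * (R + R * (N ^ 4) ^ 2))) ≤ p ^ 4 * (2 * (x ^ 8 * p ^ 105)) :=
        mul_le_mul hN4 (by linarith) (by rw [hs]; positivity) (by positivity)
    _ = 2 * (x ^ 8 * p ^ 109) := by ring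
    _ < p ^ 2 * (x ^ 8 * p ^ 109) :=
        mul_lt_mul_of_pos_right (by nlinarith) (by positivity)
    _ = C := by rw [hC]; ring

/-- Powers of `n + 2` with exponents that are affine in `c`. -/
@[irreducible] def powScale (k m c n : ℕ) : ℕ := (n + 2) ^ (k * c + m)

theorem powScale_eq (k m c n : ℕ) : powScale k m c n = (n + 2) ^ (k * c + m) := by rw [powScale]

theorem powScale_pos (k m c n : ℕ) : 0 < powScale k m c n := by
  rw [powScale]; exact pow_pos (Nat.succ_pos _) _

/-- The denominator of the rounded coefficients. -/
def coefScale (c n : ℕ) : ℕ := powScale 3 36 c n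

/-- A bound for the optimal value, used as the weight of the penalty. -/
def valueBound (c n : ℕ) : ℕ := powScale 4 40 c n

/-- The inverse step size. -/
def stepScale (c n : ℕ) : ℕ := powScale 6 73 c n

/-- The number of steps. -/
def stepCount (c n : ℕ) : ℕ := powScale 4 48 c n

/-- The shift that makes all matrices positive. -/
def shiftBound (c n : ℕ) : ℕ := powScale 8 111 c n

/-- Half of the exponent of the weight matrices. -/
def halfPower (c n : ℕ) : ℕ := powScale 4 54 c n

/-- The iterates for the given input. -/
def iterate (c n : ℕ) (inp : ℕ → ℤ) : ℕ → ℕ → ℤ :=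
  iterates n (readObj n (coefScale c n) inp) (valueBound c n) (stepScale c n) (shiftBound c n)
    (halfPower c n + halfPower c n)

/-- The numerator of the output. -/
def outputNum (c n : ℕ) (inp : ℕ → ℤ) : ℤ :=
  ∑ t ∈ Finset.range (stepCount c n), objective n (readObj n (coefScale c n) inp) (valueBound c n)
    (stepScale c n) (shiftBound c n) (halfPower c n + halfPower c n) (iterate c n inp t)

/-- The denominator of the output. -/
def outputDen (c n : ℕ) : ℤ := stepScale c n * stepCount c n * coefScale c n

theorem cast_powScale (k m c n : ℕ) :
    (powScale k m c n : ℝ) = (((n : ℝ) + 2) ^ c) ^ k * ((n : ℝ) + 2) ^ m := by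
  rw [powScale, Nat.cast_pow, pow_add, mul_comm k c, pow_mul, Nat.cast_add, Nat.cast_ofNat]

theorem shift_bound_int (c n : ℕ) : ((n : ℤ) + 1) ^ 4 * ((stepScale c n : ℤ) + ((n : ℤ) + 1) ^ 8
    * ((stepCount c n : ℤ) * ((valueBound c n : ℤ)
      + (valueBound c n : ℤ) * (((n : ℤ) + 1) ^ 4) ^ 2))) < (shiftBound c n : ℤ) := by
  have hp : (2 : ℝ) ≤ (n : ℝ) + 2 := by linarith [Nat.cast_nonneg (α := ℝ) n]
  have h := shift_bound (p := (n : ℝ) + 2) (x := ((n : ℝ) + 2) ^ c) (N := (n : ℝ) + 1) hp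
    (one_le_pow₀ (by linarith)) (by positivity) (by linarith) (R := (valueBound c n : ℝ))
    (s := (stepScale c n : ℝ)) (T := (stepCount c n : ℝ)) (C := (shiftBound c n : ℝ))
    (cast_powScale _ _ _ _) (cast_powScale _ _ _ _)
    (cast_powScale _ _ _ _) (cast_powScale _ _ _ _)
  exact_mod_cast h

theorem sum_abs_roundCoef_le_valueBound {c n : ℕ} {a : Quad n → ℚ}
    (ha : ∀ S, HeightLE ((n + 2) ^ c) (a S)) :
    ∑ S, |roundCoef (coefScale c n) a S| ≤ (valueBound c n : ℤ) := by
  refine (sum_abs_roundCoef_le (Int.natCast_nonneg _) a ha).trans ?_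
  have h : n ^ 4 * (coefScale c n * (n + 2) ^ c) ≤ valueBound c n := by
    calc n ^ 4 * (coefScale c n * (n + 2) ^ c) ≤ (n + 2) ^ 4 * (coefScale c n * (n + 2) ^ c) :=
          Nat.mul_le_mul_right _ (Nat.pow_le_pow_left (by omega) 4)
      _ = valueBound c n := by rw [coefScale, valueBound, powScale, powScale]; ring
  exact_mod_cast h

theorem abs_readObj_le_valueBound {c n : ℕ} {a : Quad n → ℚ}
    (ha : ∀ S, HeightLE ((n + 2) ^ c) (a S)) (v : ℕ) :
    |readObj n (coefScale c n) (inputOf a) v| ≤ (valueBound c n : ℤ) :=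
  (abs_readObj_le _ a v).trans (sum_abs_roundCoef_le_valueBound ha)

theorem stepScale_pos (c n : ℕ) : (0 : ℤ) < stepScale c n :=
  Int.natCast_pos.mpr (powScale_pos _ _ _ _)

theorem stepCount_pos (c n : ℕ) : 0 < stepCount c n := powScale_pos _ _ _ _

theorem coefScale_pos (c n : ℕ) : (0 : ℤ) < coefScale c n :=
  Int.natCast_pos.mpr (powScale_pos _ _ _ _)

theorem abs_iterate_le {c n : ℕ} {a : Quad n → ℚ} (ha : ∀ S, HeightLE ((n + 2) ^ c) (a S)) {t : ℕ}
    (ht : t ≤ stepCount c n) (v : ℕ) : |iterate c n (inputOf a) t v|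
      ≤ stepCount c n * (valueBound c n + valueBound c n * (((n : ℤ) + 1) ^ 4) ^ 2) := by
  refine (abs_iterates_le (stepScale_pos c n) (Int.natCast_nonneg _) (abs_readObj_le_valueBound ha)
    (shift_bound_int c n) _ ht v).trans ?_
  exact mul_le_mul_of_nonneg_right (by exact_mod_cast ht) (by positivity)

theorem outputDen_pos (c n : ℕ) : 0 < outputDen c n := by
  rw [outputDen]
  exact mul_pos (mul_pos (stepScale_pos c n) (by exact_mod_cast stepCount_pos c n)) (coefScale_pos c n)

theorem abs_output_sub_le {c n : ℕ} {a : Quad n → ℚ} (ha : ∀ S, HeightLE ((n + 2) ^ c) (a S)) :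
    |(outputNum c n (inputOf a) : ℝ) / outputDen c n - sos 4 (quartic fun S => (a S : ℝ))|
      ≤ 1 / ((n : ℝ) + 2) ^ c := by
  have hQ := coefScale_pos c n
  have hQ' : (0 : ℝ) < coefScale c n := by exact_mod_cast hQ
  have hp : (2 : ℝ) ≤ (n : ℝ) + 2 := by linarith [Nat.cast_nonneg (α := ℝ) n]
  have h1 := abs_sum_objective_sub_le (roundCoef (coefScale c n) a)
    (b := readObj n (coefScale c n) (inputOf a)) (cast_readObj _ a) (stepScale_pos c n)
    (abs_readObj_le_valueBound ha) (sum_abs_roundCoef_le_valueBound ha)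
    (T := stepCount c n) (stepCount_pos c n) (halfPower c n) (shift_bound_int c n)
  have h2 := abs_sos_roundCoef_sub_le hQ a
  have h3 := descent_error_le (p := (n : ℝ) + 2) (x := ((n : ℝ) + 2) ^ c) (N := (n : ℝ) + 1)
    (m := (n : ℝ)) hp (one_le_pow₀ (by linarith)) (by positivity) (by linarith) (by positivity)
    (by linarith) (Q := (coefScale c n : ℝ)) (R := (valueBound c n : ℝ))
    (s := (stepScale c n : ℝ)) (T := (stepCount c n : ℝ)) (C := (shiftBound c n : ℝ))
    (r := (halfPower c n : ℝ)) (cast_powScale _ _ _ _)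
    (cast_powScale _ _ _ _) (cast_powScale _ _ _ _)
    (cast_powScale _ _ _ _) (cast_powScale _ _ _ _)
    (cast_powScale _ _ _ _)
  simp only [Int.cast_natCast] at h1 h2
  refine le_trans ?_ h3
  have e : (outputNum c n (inputOf a) : ℝ) / outputDen c n - sos 4 (quartic fun S => (a S : ℝ))
      = ((outputNum c n (inputOf a) : ℝ) / ((stepScale c n : ℝ) * (stepCount c n : ℝ))
        - sos 4 (quartic fun S => (roundCoef (coefScale c n) a S : ℝ))) / (coefScale c n : ℝ)
        + (sos 4 (quartic fun S => (roundCoef (coefScale c n) a S : ℝ)) / (coefScale c n : ℝ)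
          - sos 4 (quartic fun S => (a S : ℝ))) := by
    rw [outputDen, sub_div, div_div]
    simp only [Int.cast_mul, Int.cast_natCast]
    abel
  rw [e]
  refine (abs_add_le _ _).trans (add_le_add ?_ h2)
  rw [abs_div, abs_of_pos hQ']
  exact div_le_div_of_nonneg_right h1 hQ'.le

end Majorana

namespace Majorana

/-! ### The descent runs in polynomial time -/

section PolyTime

variable {Ω : Type} {Γ : Ctx Ω}

theorem PTN.lift {a : Ω → ℕ} (ha : PTN Γ a) {Ω' : Type} {Γ' : Ctx Ω'} {h : Ω' → Ω}
    (e : Ext Γ Γ' h) : PTN Γ' fun ω => a (h ω) := PT.lift ha e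

theorem PT.ite_nat_lt {x y : Ω → ℕ} {f g : Ω → ℤ} (hx : PTN Γ x) (hy : PTN Γ y) (hf : PT Γ f)
    (hg : PT Γ g) : PT Γ fun ω => if x ω < y ω then f ω else g ω :=
  (PT.ite_lt hx hy hf hg).congr fun ω => by simp only [Nat.cast_lt]

theorem PT.ite_nat_eq {x y : Ω → ℕ} {f g : Ω → ℤ} (hx : PTN Γ x) (hy : PTN Γ y) (hf : PT Γ f)
    (hg : PT Γ g) : PT Γ fun ω => if x ω = y ω then f ω else g ω :=
  (PT.ite_eq hx hy hf hg).congr fun ω => by simp only [Nat.cast_inj]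

theorem PolyBdd.of_lt {D j : Ω → ℕ} (hD : PolyBdd Γ.sz D) (hj : ∀ ω, j ω < D ω) :
    PolyBdd Γ.sz j := hD.mono fun ω => (hj ω).le

variable {n : Ω → ℕ}

theorem PTN.digit {c p : Ω → ℕ} (hn : PTN Γ n) (hc : PTN Γ c) (hp : PTN Γ p)
    (hpb : PolyBdd Γ.sz p) : PTN Γ fun ω => digit (n ω) (c ω) (p ω) :=
  (hc.div ((hn.add (PTN.const 1)).pow hp hpb)).mod (hn.add (PTN.const 1))

theorem PT.wordTr (L : ℕ) {c : Ω → ℕ} (hn : PTN Γ n) (hnb : PolyBdd Γ.sz n) (hc : PTN Γ c) :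
    PT Γ fun ω => wordTr (n ω) L (c ω) := by
  have hL : PolyBdd Γ.sz fun _ => L := PolyBdd.const Γ.two_le L
  refine PT.mul (PT.prod (cnt := fun _ => L) (PTN.const L) hL fun Ω' Γ' h e q hq hqL => ?_)
    (PT.prod hn hnb fun Ω' Γ' h e j hj hjn => ?_)
  · have hqb := PolyBdd.of_lt (e.polyBdd hL) hqL
    refine PT.prod hq hqb fun Ω'' Γ'' h' e' p hp hpq => ?_
    have hn' := (hn.lift e).lift e'
    have hc' := (hc.lift e).lift e'
    have hdq := PTN.digit hn' hc' (hq.lift e') (e'.polyBdd hqb)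
    have hdp := PTN.digit hn' hc' hp (PolyBdd.of_lt (e'.polyBdd hqb) hpq)
    exact PT.ite_nat_lt (PTN.const 0) hdq
      (PT.ite_nat_lt hdq hdp (PT.const (-1)) (PT.const 1)) (PT.const 1)
  · refine PT.ite_pos (PT.prod (cnt := fun _ => L) (PTN.const L) (e.polyBdd hL)
      fun Ω'' Γ'' h' e' p hp hpL => ?_) (PT.const 1) (PT.const 0)
    exact PT.ite_nat_eq (PTN.digit ((hn.lift e).lift e') ((hc.lift e).lift e') hp
      (PolyBdd.of_lt (e'.polyBdd (e.polyBdd hL)) hpL)) ((hj.lift e').add (PTN.const 1))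
      (PT.const (-1)) (PT.const 1)

theorem PTN.succ_pow (hn : PTN Γ n) (k : ℕ) : PTN Γ fun ω => (n ω + 1) ^ k :=
  (hn.add (PTN.const 1)).pow_const k

theorem PolyBdd.succ_pow (hnb : PolyBdd Γ.sz n) (k : ℕ) : PolyBdd Γ.sz fun ω => (n ω + 1) ^ k :=
  (hnb.add Γ.two_le (PolyBdd.const Γ.two_le 1)).pow k

theorem PT.starSgn {u : Ω → ℕ} (hn : PTN Γ n) (hnb : PolyBdd Γ.sz n) (hu : PTN Γ u) :
    PT Γ fun ω => starSgn (n ω) (u ω) :=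
  PT.wordTr 8 hn hnb (hu.add ((PTN.succ_pow hn 4).mul hu))

theorem PT.isObs {v : Ω → ℕ} (hn : PTN Γ n) (hnb : PolyBdd Γ.sz n) (hv : PTN Γ v) :
    PT Γ fun ω => isObs (n ω) (v ω) :=
  PT.ite_eq (PT.wordTr 8 hn hnb hv) (PT.const 0)
    (PT.ite_eq (PT.wordTr 16 hn hnb (hv.add ((PTN.succ_pow hn 8).mul hv))) (PT.const 1)
      (PT.const 1) (PT.const 0)) (PT.const 0)

theorem PT.baseEntry {u w : Ω → ℕ} (hn : PTN Γ n) (hnb : PolyBdd Γ.sz n) (hu : PTN Γ u)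
    (hw : PTN Γ w) : PT Γ fun ω => baseEntry (n ω) (u ω) (w ω) :=
  (PT.starSgn hn hnb hu).mul (PT.wordTr 8 hn hnb (hu.add ((PTN.succ_pow hn 4).mul hw)))

theorem PT.coefEntry {v u w : Ω → ℕ} (hn : PTN Γ n) (hnb : PolyBdd Γ.sz n) (hv : PTN Γ v)
    (hu : PTN Γ u) (hw : PTN Γ w) : PT Γ fun ω => coefEntry (n ω) (v ω) (u ω) (w ω) :=
  (PT.isObs hn hnb hv).mul ((PT.starSgn hn hnb hu).mul (PT.wordTr 16 hn hnb
    (hv.add ((PTN.succ_pow hn 8).mul (hu.add ((PTN.succ_pow hn 4).mul hw))))))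

theorem PTN.quadWord {m : Ω → ℕ} (hn : PTN Γ n) (hm : PTN Γ m) :
    PTN Γ fun ω => quadWord (n ω) (m ω) := by
  have h1 := PTN.const (Γ := Γ) 1
  have hN := hn.add h1
  exact ((((hm.div hn).div hn).div hn).mod hn).add h1 |>.add (hN.mul
    ((((hm.div hn).div hn).mod hn).add h1 |>.add (hN.mul
      (((hm.div hn).mod hn).add h1 |>.add (hN.mul ((hm.mod hn).add h1))))))

theorem PTF.readObj {D : Ω → ℕ} {Q : Ω → ℤ} (hn : PTN Γ n) (hnb : PolyBdd Γ.sz n) (hQ : PT Γ Q) :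
    PTF Γ D fun ω v => readObj (n ω) (Q ω) (Γ.inp ω) v := by
  intro Ω' Γ' h e v hv _
  refine PT.sum ((hn.lift e).pow_const 4) ((e.polyBdd hnb).pow 4) fun Ω'' Γ'' h' e' m hm _ => ?_
  have hread : ∀ k, PT Γ'' fun ω => Γ.inp (h (h' ω)) (2 * m ω + k) := fun k =>
    (PT.read (((PTN.const 2).mul hm).add (PTN.const k))).congr fun ω => by
      rw [(e.trans e').inp_eq, Int.toNat_natCast]
  have hcoef : PT Γ'' fun ω => readCoef (Q (h (h' ω))) (Γ.inp (h (h' ω))) (m ω) :=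
    (((hQ.lift e).lift e').mul (hread 1)).div (hread 2)
  exact hcoef.mul (PT.wordTr 12 ((hn.lift e).lift e') (e'.polyBdd (e.polyBdd hnb))
    ((hv.lift e').add ((PTN.succ_pow ((hn.lift e).lift e') 8).mul
      (PTN.quadWord ((hn.lift e).lift e') hm))))

variable {s C : Ω → ℤ} {Y : Ω → ℕ → ℤ}

theorem PT.gram {u w : Ω → ℕ} (hn : PTN Γ n) (hnb : PolyBdd Γ.sz n) (hs : PT Γ s)
    (hY : PTF Γ (fun ω => (n ω + 1) ^ 8) Y) (hu : PTN Γ u) (hw : PTN Γ w) :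
    PT Γ fun ω => gram (n ω) (s ω) (Y ω) (u ω) (w ω) :=
  (hs.mul (PT.baseEntry hn hnb hu hw)).add
    (PT.sum (PTN.succ_pow hn 8) (hnb.succ_pow 8) fun _ Γ' h e v hv hvD =>
      (hY _ Γ' h e v hv hvD).mul
        (PT.coefEntry (hn.lift e) (e.polyBdd hnb) hv (hu.lift e) (hw.lift e)))

theorem PT.shifted {u w : Ω → ℕ} (hn : PTN Γ n) (hnb : PolyBdd Γ.sz n) (hs : PT Γ s)
    (hC : PT Γ C) (hY : PTF Γ (fun ω => (n ω + 1) ^ 8) Y) (hu : PTN Γ u) (hw : PTN Γ w) :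
    PT Γ fun ω => shifted (n ω) (s ω) (C ω) (Y ω) (u ω) (w ω) :=
  (PT.ite_nat_eq hu hw hC (PT.const 0)).sub (PT.gram hn hnb hs hY hu hw)

/-- A polynomial exponent gives entries with polynomially many bits, so the power may be computed by
repeated multiplication. -/
theorem abs_intPow_le {W : ℕ} {A : ℕ → ℕ → ℤ} {M : ℤ} (hA : ∀ u w, |A u w| ≤ M) (i u w : ℕ) :
    |intPow W A i u w| ≤ (W * M) ^ i := by
  induction i generalizing w with
  | zero =>
    rw [intPow, pow_zero]
    split_ifs <;> simp
  | succ i ih =>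
    rw [intPow]
    refine (Finset.abs_sum_le_sum_abs _ _).trans ?_
    refine (Finset.sum_le_sum fun x _ => ?_ :
      _ ≤ ∑ _x ∈ Finset.range W, (W * M) ^ i * M).trans_eq ?_
    · rw [abs_mul]
      exact mul_le_mul (ih x) (hA x w) (abs_nonneg _) ((abs_nonneg _).trans (ih x))
    · rw [Finset.sum_const, Finset.card_range, nsmul_eq_mul]
      ring

/-- The entries of the weight matrix, as a vector. -/
theorem PTF.weight {q : Ω → ℕ} {M : Ω → ℤ} (hn : PTN Γ n) (hnb : PolyBdd Γ.sz n) (hs : PT Γ s)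
    (hC : PT Γ C) (hY : PTF Γ (fun ω => (n ω + 1) ^ 8) Y) (hq : PTN Γ q) (hqb : PolyBdd Γ.sz q)
    (hM : PT Γ M) (hbd : ∀ ω u w, |shifted (n ω) (s ω) (C ω) (Y ω) u w| ≤ M ω) :
    PTF Γ (fun ω => (n ω + 1) ^ 4 * (n ω + 1) ^ 4) fun ω i =>
      weight (n ω) (s ω) (C ω) (q ω) (Y ω) (i / (n ω + 1) ^ 4) (i % (n ω + 1) ^ 4) := by
  have hW := PTN.succ_pow hn 4
  have hWb := hnb.succ_pow 4
  have hM0 : ∀ ω, 0 ≤ M ω := fun ω => (abs_nonneg _).trans (hbd ω 0 0)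
  refine PTF.iter (Y := fun ω t i => intPow ((n ω + 1) ^ 4) (shifted (n ω) (s ω) (C ω) (Y ω)) t
    (i / (n ω + 1) ^ 4) (i % (n ω + 1) ^ 4))
    (H := fun ω => ((((n ω + 1) ^ 4 : ℕ) : ℤ) * M ω + 1) ^ q ω + 1) hq hqb (hW.mul hW) (hWb.mul hWb)
    (((((PT.mul hW hM).add (PT.const 1))).pow hq hqb).add (PT.const 1)) (fun ω t ht i _ => ?_) ?_ ?_
  · have h1 := abs_intPow_le (W := (n ω + 1) ^ 4) (hbd ω) t (i / (n ω + 1) ^ 4)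
      (i % (n ω + 1) ^ 4)
    have h2 : 0 ≤ (((n ω + 1) ^ 4 : ℕ) : ℤ) * M ω := mul_nonneg (Int.natCast_nonneg _) (hM0 ω)
    have h3 : ((((n ω + 1) ^ 4 : ℕ) : ℤ) * M ω) ^ t
        ≤ ((((n ω + 1) ^ 4 : ℕ) : ℤ) * M ω + 1) ^ q ω :=
      (pow_le_pow_left₀ h2 (by linarith) t).trans (pow_le_pow_right₀ (by linarith) ht)
    have h4 := abs_le.mp (h1.trans h3)
    constructor <;> linarith [h4.1, h4.2]
  · intro Ω' Γ' h e j hj _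
    exact PT.ite_nat_eq (hj.div (hW.lift e)) (hj.mod (hW.lift e)) (PT.const 1) (PT.const 0)
  · intro Ω' Γ' h e t ht htq hvec Ω'' Γ'' h' e' j hj hjD
    have hW'' := (hW.lift e).lift e'
    refine PT.sum hW'' (e'.polyBdd (e.polyBdd hWb)) fun Ω₃ Γ₃ h₃ e₃ x hx hxW => ?_
    have hW₃ := hW''.lift e₃
    have hj₃ := hj.lift e₃
    refine PT.mul ?_ (PT.shifted (((hn.lift e).lift e').lift e₃)
      (e₃.polyBdd (e'.polyBdd (e.polyBdd hnb))) (((hs.lift e).lift e').lift e₃)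
      (((hC.lift e).lift e').lift e₃) (((hY.lift e).lift e').lift e₃) hx (hj₃.mod hW₃))
    -- Entry (u, x) of the previous power is stored at index u W + x, where u is the row of j and W
    -- = (n + 1)^4.
    refine (hvec _ Γ₃ _ (e'.trans e₃) _ (((hj₃.div hW₃).mul hW₃).add hx) fun ω => ?_).congr
      fun ω => ?_
    · have h1 := Nat.div_lt_of_lt_mul (hjD (h₃ ω))
      have h2 := hxW ω
      beta_reduce at h1 h2 ⊢
      calc _ < j (h₃ ω) / (n (h (h' (h₃ ω))) + 1) ^ 4 * (n (h (h' (h₃ ω))) + 1) ^ 4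
            + (n (h (h' (h₃ ω))) + 1) ^ 4 := Nat.add_lt_add_left h2 _
        _ = (j (h₃ ω) / (n (h (h' (h₃ ω))) + 1) ^ 4 + 1) * (n (h (h' (h₃ ω))) + 1) ^ 4 := by ring
        _ ≤ _ := Nat.mul_le_mul_right _ h1
    · have h2 := hxW ω
      have h0 : 0 < (n (h (h' (h₃ ω))) + 1) ^ 4 := by positivity
      beta_reduce at h2 ⊢
      rw [Nat.add_comm (_ * _) (x ω), Nat.add_mul_div_right _ _ h0, Nat.div_eq_of_lt h2, zero_add,
        Nat.add_mul_mod_self_right, Nat.mod_eq_of_lt h2]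

end PolyTime

end Majorana

namespace Majorana

/-! ### Polynomial-time evaluation of the penalty, the objective and the iterates -/

section PolyTime

variable {Ω : Type} {Γ : Ctx Ω} {n q : Ω → ℕ} {R s C L : Ω → ℤ} {b Y : Ω → ℕ → ℤ}

/-- Computability of a family of matrices. -/
def PTM (Γ : Ctx Ω) (A : Ω → ℕ → ℕ → ℤ) : Prop :=
  ∀ (Ω' : Type) (Γ' : Ctx Ω') (h : Ω' → Ω), Ext Γ Γ' h → ∀ u w : Ω' → ℕ, PTN Γ' u → PTN Γ' w →
    PT Γ' fun ω => A (h ω) (u ω) (w ω)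

/-- The hypotheses under which weight matrices are computable. -/
structure PTDescent (Γ : Ctx Ω) (n q : Ω → ℕ) (R s C L : Ω → ℤ) : Prop where
  n_ptn : PTN Γ n
  n_bdd : PolyBdd Γ.sz n
  q_ptn : PTN Γ q
  q_bdd : PolyBdd Γ.sz q
  R_pt : PT Γ R
  s_pt : PT Γ s
  C_pt : PT Γ C
  L_pt : PT Γ L
  s_nonneg : ∀ ω, 0 ≤ s ω
  C_nonneg : ∀ ω, 0 ≤ C ω

theorem PTDescent.lift (hP : PTDescent Γ n q R s C L) {Ω' : Type} {Γ' : Ctx Ω'} {h : Ω' → Ω}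
    (e : Ext Γ Γ' h) : PTDescent Γ' (fun ω => n (h ω)) (fun ω => q (h ω)) (fun ω => R (h ω))
      (fun ω => s (h ω)) (fun ω => C (h ω)) fun ω => L (h ω) :=
  ⟨hP.n_ptn.lift e, e.polyBdd hP.n_bdd, hP.q_ptn.lift e, e.polyBdd hP.q_bdd, hP.R_pt.lift e,
    hP.s_pt.lift e, hP.C_pt.lift e, hP.L_pt.lift e, fun _ => hP.s_nonneg _, fun _ => hP.C_nonneg _⟩

theorem PTDescent.ptf_weight (hP : PTDescent Γ n q R s C L)
    (hY : PTF Γ (fun ω => (n ω + 1) ^ 8) Y) (hL : ∀ ω, ∀ v < (n ω + 1) ^ 8, |Y ω v| ≤ L ω) :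
    PTF Γ (fun ω => (n ω + 1) ^ 4 * (n ω + 1) ^ 4) fun ω i =>
      weight (n ω) (s ω) (C ω) (q ω) (Y ω) (i / (n ω + 1) ^ 4) (i % (n ω + 1) ^ 4) := by
  refine PTF.weight (M := fun ω => C ω + (s ω + (((n ω + 1) ^ 8 : ℕ) : ℤ) * L ω)) hP.n_ptn hP.n_bdd
    hP.s_pt hP.C_pt hY hP.q_ptn hP.q_bdd
    (hP.C_pt.add (hP.s_pt.add (PT.mul (PTN.succ_pow hP.n_ptn 8) hP.L_pt))) fun ω u w => ?_
  rw [shifted]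
  refine (abs_sub _ _).trans (add_le_add ?_ ?_)
  · split_ifs
    · rw [abs_of_nonneg (hP.C_nonneg ω)]
    · rw [abs_zero]; exact hP.C_nonneg ω
  · exact_mod_cast abs_gram_le (hP.s_nonneg ω) (hL ω) u w

theorem PTDescent.pt_pairing (hP : PTDescent Γ n q R s C L)
    (hY : PTF Γ (fun ω => (n ω + 1) ^ 8) Y) (hL : ∀ ω, ∀ v < (n ω + 1) ^ 8, |Y ω v| ≤ L ω)
    {A : Ω → ℕ → ℕ → ℤ} (hA : PTM Γ A) :
    PT Γ fun ω => pairing ((n ω + 1) ^ 4) (A ω) (weight (n ω) (s ω) (C ω) (q ω) (Y ω)) := by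
  have hX := hP.ptf_weight hY hL
  have hW := PTN.succ_pow hP.n_ptn 4
  have hWb := hP.n_bdd.succ_pow 4
  refine PT.sum hW hWb fun Ω' Γ' h e u hu huW => ?_
  refine PT.sum (hW.lift e) (e.polyBdd hWb) fun Ω'' Γ'' h' e' w hw hwW => ?_
  have hW'' := (hW.lift e).lift e'
  have hu' := hu.lift e'
  refine PT.mul (hA _ Γ'' _ (e.trans e') _ _ hu' hw) ?_
  refine (hX _ Γ'' _ (e.trans e') _ ((hw.mul hW'').add hu') fun ω => ?_).congr fun ω => ?_
  · have h1 := hwW ω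
    have h2 := huW (h' ω)
    beta_reduce at h1 h2 ⊢
    calc _ < w ω * (n (h (h' ω)) + 1) ^ 4 + (n (h (h' ω)) + 1) ^ 4 := Nat.add_lt_add_left h2 _
      _ = (w ω + 1) * (n (h (h' ω)) + 1) ^ 4 := by ring
      _ ≤ _ := Nat.mul_le_mul_right _ h1
  · have h2 := huW (h' ω)
    have h0 : 0 < (n (h (h' ω)) + 1) ^ 4 := by positivity
    beta_reduce at h2 ⊢
    rw [Nat.add_comm (_ * _) (u (h' ω)), Nat.add_mul_div_right _ _ h0, Nat.div_eq_of_lt h2,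
      zero_add, Nat.add_mul_mod_self_right, Nat.mod_eq_of_lt h2]

theorem PTDescent.pt_intTrace (hP : PTDescent Γ n q R s C L)
    (hY : PTF Γ (fun ω => (n ω + 1) ^ 8) Y) (hL : ∀ ω, ∀ v < (n ω + 1) ^ 8, |Y ω v| ≤ L ω) :
    PT Γ fun ω => intTrace ((n ω + 1) ^ 4) (weight (n ω) (s ω) (C ω) (q ω) (Y ω)) := by
  have h := hP.pt_pairing hY hL (A := fun _ u w => if u = w then 1 else 0)
    fun _ Γ' h e u w hu hw => PT.ite_nat_eq hu hw (PT.const 1) (PT.const 0)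
  refine h.congr fun ω => ?_
  refine Finset.sum_congr rfl fun u hu => ?_
  rw [Finset.sum_eq_single u]
  · simp
  · intro w _ hw
    beta_reduce
    rw [if_neg hw.symm, zero_mul]
  · exact fun h => absurd hu h

theorem PTDescent.ptm_gram (hP : PTDescent Γ n q R s C L) (hY : PTF Γ (fun ω => (n ω + 1) ^ 8) Y) :
    PTM Γ fun ω => gram (n ω) (s ω) (Y ω) := fun _ _ _ e _ _ hu hw =>
  PT.gram (hP.n_ptn.lift e) (e.polyBdd hP.n_bdd) (hP.s_pt.lift e) (hY.lift e) hu hw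

theorem PTDescent.pt_penalty (hP : PTDescent Γ n q R s C L)
    (hY : PTF Γ (fun ω => (n ω + 1) ^ 8) Y) (hL : ∀ ω, ∀ v < (n ω + 1) ^ 8, |Y ω v| ≤ L ω)
    {A : Ω → ℕ → ℕ → ℤ} (hA : PTM Γ A) :
    PT Γ fun ω => penalty (n ω) (R ω) (s ω) (C ω) (q ω) (Y ω) (A ω) :=
  PT.ite_lt (hP.pt_pairing hY hL (hP.ptm_gram hY)) (PT.const 0)
    ((hP.R_pt.mul (hP.pt_pairing hY hL hA)).div (hP.pt_intTrace hY hL)) (PT.const 0)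

theorem PTDescent.pt_objective (hP : PTDescent Γ n q R s C L)
    (hb : PTF Γ (fun ω => (n ω + 1) ^ 8) b) (hY : PTF Γ (fun ω => (n ω + 1) ^ 8) Y)
    (hL : ∀ ω, ∀ v < (n ω + 1) ^ 8, |Y ω v| ≤ L ω) :
    PT Γ fun ω => objective (n ω) (b ω) (R ω) (s ω) (C ω) (q ω) (Y ω) :=
  (PT.sum (PTN.succ_pow hP.n_ptn 8) (hP.n_bdd.succ_pow 8) fun _ Γ' h e v hv hvD =>
    (hb _ Γ' h e v hv hvD).mul (hY _ Γ' h e v hv hvD)).add (hP.pt_penalty hY hL (hP.ptm_gram hY))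

/-- The a priori bound L on all iterates fixes the digit base in which the vector is stored between
steps. -/
theorem PTDescent.ptf_iterates (hP : PTDescent Γ n q R s C L)
    (hb : PTF Γ (fun ω => (n ω + 1) ^ 8) b) {t : Ω → ℕ} (ht : PTN Γ t) (htb : PolyBdd Γ.sz t)
    (hL : ∀ ω, ∀ i ≤ t ω, ∀ v,
      |iterates (n ω) (b ω) (R ω) (s ω) (C ω) (q ω) i v| ≤ L ω) :
    PTF Γ (fun ω => (n ω + 1) ^ 8)
      fun ω => iterates (n ω) (b ω) (R ω) (s ω) (C ω) (q ω) (t ω) := by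
  refine PTF.iter (Y := fun ω => iterates (n ω) (b ω) (R ω) (s ω) (C ω) (q ω))
    (H := fun ω => L ω + 1) ht htb (PTN.succ_pow hP.n_ptn 8) (hP.n_bdd.succ_pow 8)
    (hP.L_pt.add (PT.const 1)) (fun ω i hi v _ => ?_) ?_ ?_
  · have h := abs_le.mp (hL ω i hi v)
    constructor <;> linarith [h.1, h.2]
  · intro Ω' Γ' h e j hj _
    exact PT.const 0
  · intro Ω' Γ' h e i hi hit hvec Ω'' Γ'' h' e' v hv hvD
    refine (hvec _ Γ'' h' e' v hv hvD).add ((hb _ Γ'' _ (e.trans e') v hv hvD).add ?_)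
    refine ((hP.lift e).lift e').pt_penalty (hvec.lift e') (fun ω v _ => hL _ _ (hit _).le v)
      fun _ Γ₃ h₃ e₃ u w hu hw => ?_
    exact PT.coefEntry (((hP.lift e).lift e').lift e₃).n_ptn (((hP.lift e).lift e').lift e₃).n_bdd
      (hv.lift e₃) hu hw

end PolyTime

/-! ### The program -/

/-- Inputs with coefficients of logarithmic size. -/
def BoundedInput (c : ℕ) : Type :=
  {x : (n : ℕ) × (Quad n → ℚ) // ∀ S, HeightLE ((x.1 + 2) ^ c) (x.2 S)}

theorem abs_inputOf_le {c n : ℕ} {a : Quad n → ℚ} (ha : ∀ S, HeightLE ((n + 2) ^ c) (a S)) (m : ℕ) :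
    |inputOf a m| ≤ (n + 2) ^ (c + 4) := by
  have hp : (1 : ℤ) ≤ n + 2 := by omega
  rw [inputOf]
  split_ifs with h
  · rw [abs_of_nonneg (Int.natCast_nonneg n)]
    exact le_trans (by omega) (le_self_pow₀ hp (by omega))
  · refine (Finset.abs_sum_le_sum_abs _ _).trans ?_
    refine (Finset.sum_le_sum fun S _ => ?_ :
      _ ≤ ∑ _S : Quad n, ((n : ℤ) + 2) ^ c).trans ?_
    · have h1 := (ha S).1
      have h2 := (ha S).2
      split_ifs
      · rw [Int.abs_eq_natAbs]; exact_mod_cast h1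
      · rw [abs_of_nonneg (Int.natCast_nonneg _)]; exact_mod_cast h2
      · rw [abs_zero]; positivity
    · rw [Finset.sum_const, Finset.card_univ, nsmul_eq_mul, pow_add, mul_comm]
      refine mul_le_mul_of_nonneg_left ?_ (by positivity)
      calc ((Fintype.card (Quad n) : ℕ) : ℤ) ≤ ((n ^ 4 : ℕ) : ℤ) := by exact_mod_cast card_quad_le n
        _ ≤ _ := by push_cast; exact pow_le_pow_left₀ (by positivity) (by omega) 4

theorem bits_le_of_abs_le {z : ℤ} {m : ℕ} (h : |z| ≤ m) : bits z ≤ m + 1 := by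
  refine (bits_mono (y := (m : ℤ)) ?_).trans (bits_natCast_le m)
  rw [Int.abs_eq_natAbs] at h
  rw [Int.natAbs_natCast]
  exact_mod_cast h

/-- The situation of a program that has only access to the input. -/
def inputCtx (c : ℕ) : Ctx (BoundedInput c) where
  sz x := x.1.1 + 2
  two_le x := by omega
  inp x := inputOf x.1.2
  inp_bdd := by
    refine ⟨c + 5, fun x m => ?_⟩
    have h := bits_le_of_abs_le (m := (x.1.1 + 2) ^ (c + 4))
      (by exact_mod_cast abs_inputOf_le x.2 m)
    refine h.trans ?_
    have h1 : 1 ≤ (x.1.1 + 2) ^ (c + 4) := Nat.one_le_pow _ _ (by omega)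
    rw [pow_succ (x.1.1 + 2) (c + 4)]
    nlinarith
  Idx := Empty
  var i := i.elim
  var_bdd i := i.elim

theorem ptn_size (c : ℕ) : PTN (inputCtx c) fun x => x.1.1 :=
  (PT.read (Γ := inputCtx c) (PT.const 0)).congr fun _ => rfl

theorem polyBdd_size (c : ℕ) : PolyBdd (inputCtx c).sz fun x => x.1.1 :=
  ⟨1, fun x => by rw [pow_one]; exact Nat.le_add_right _ 2⟩

theorem ptn_powScale (k m c : ℕ) : PTN (inputCtx c) fun x => powScale k m c x.1.1 :=
  (((ptn_size c).add (PTN.const 2)).pow_const (k * c + m)).congr fun x =>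
    congrArg _ (powScale_eq k m c x.1.1).symm

theorem polyBdd_powScale (k m c : ℕ) : PolyBdd (inputCtx c).sz fun x => powScale k m c x.1.1 :=
  ⟨k * c + m, fun x => (powScale_eq k m c x.1.1).le⟩

theorem pt_outputDen (c : ℕ) : PT (inputCtx c) fun x => outputDen c x.1.1 :=
  PT.mul (PT.mul (ptn_powScale _ _ c) (ptn_powScale _ _ c)) (ptn_powScale _ _ c)

theorem pt_outputNum (c : ℕ) : PT (inputCtx c) fun x => outputNum c x.1.1 (inputOf x.1.2) := by
  have hn := ptn_size c
  have hnb := polyBdd_size c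
  have hR : PTN (inputCtx c) fun x => valueBound c x.1.1 := ptn_powScale _ _ c
  have hT : PTN (inputCtx c) fun x => stepCount c x.1.1 := ptn_powScale _ _ c
  have hTb : PolyBdd (inputCtx c).sz fun x => stepCount c x.1.1 := polyBdd_powScale _ _ c
  have hr : PTN (inputCtx c) fun x => halfPower c x.1.1 := ptn_powScale _ _ c
  have hrb : PolyBdd (inputCtx c).sz fun x => halfPower c x.1.1 := polyBdd_powScale _ _ c
  have hP : PTDescent (inputCtx c) (fun x => x.1.1) (fun x => halfPower c x.1.1 + halfPower c x.1.1)
      (fun x => (valueBound c x.1.1 : ℤ)) (fun x => (stepScale c x.1.1 : ℤ))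
      (fun x => (shiftBound c x.1.1 : ℤ)) fun x => (stepCount c x.1.1 : ℤ)
        * ((valueBound c x.1.1 : ℤ) + (valueBound c x.1.1 : ℤ) * (((x.1.1 : ℤ) + 1) ^ 4) ^ 2) :=
    { n_ptn := hn
      n_bdd := hnb
      q_ptn := hr.add hr
      q_bdd := hrb.add (inputCtx c).two_le hrb
      R_pt := hR
      s_pt := ptn_powScale _ _ c
      C_pt := ptn_powScale _ _ c
      L_pt := PT.mul hT (PT.add hR (PT.mul hR
        (PT.pow_const (PT.pow_const (PT.add hn (PT.const 1)) 4) 2)))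
      s_nonneg := fun _ => Int.natCast_nonneg _
      C_nonneg := fun _ => Int.natCast_nonneg _ }
  have hb : PTF (inputCtx c) (fun x => (x.1.1 + 1) ^ 8)
      fun x => readObj x.1.1 (coefScale c x.1.1) (inputOf x.1.2) :=
    PTF.readObj hn hnb (ptn_powScale _ _ c)
  refine PT.sum hT hTb fun Ω' Γ' h e t ht htT => ?_
  have hY : PTF Γ' (fun ω => ((h ω).1.1 + 1) ^ 8)
      fun ω => iterate c (h ω).1.1 (inputOf (h ω).1.2) (t ω) :=
    (hP.lift e).ptf_iterates (hb.lift e) ht (PolyBdd.of_lt (e.polyBdd hTb) htT)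
      fun ω i hi v => abs_iterate_le (h ω).2 (hi.trans (htT ω).le) v
  exact (hP.lift e).pt_objective (hb.lift e) hY fun ω v _ => abs_iterate_le (h ω).2 (htT ω).le v

theorem sosPolyTime_four : SOSPolyTime 4 := by
  intro c
  -- The numerator goes to register 0. The second program writes to register 1 and preserves
  -- everything below it.
  obtain ⟨p, k, hp⟩ := (pt_outputNum c).2 Empty.elim 0 fun i => i.elim
  obtain ⟨q, l, hq⟩ := (pt_outputDen c).2 Empty.elim 1 fun i => i.elim
  refine ⟨.seq p q, k + l + 1, fun n a ha => ?_⟩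
  obtain ⟨t₁, s₁, a1, a2, -, a4⟩ := hp ⟨⟨n, a⟩, ha⟩ (fun _ => 0) fun i => i.elim
  obtain ⟨t₂, s₂, b1, b2, b3, b4⟩ := hq ⟨⟨n, a⟩, ha⟩ s₁ fun i => i.elim
  refine ⟨_, s₂, Run.seq a1 b1, ?_, ?_, ?_⟩
  · have h4 : t₁ ≤ (n + 2) ^ k := a4
    have h5 : t₂ ≤ (n + 2) ^ l := b4
    have h6 : (n + 2) ^ k ≤ (n + 2) ^ (k + l) := Nat.pow_le_pow_right (by omega) (by omega)
    have h7 : (n + 2) ^ l ≤ (n + 2) ^ (k + l) := Nat.pow_le_pow_right (by omega) (by omega)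
    calc t₁ + t₂ ≤ (n + 2) ^ (k + l) * 2 := by omega
      _ ≤ (n + 2) ^ (k + l) * (n + 2) := Nat.mul_le_mul_left _ (by omega)
      _ = _ := (pow_succ _ _).symm
  · rw [b2]; exact outputDen_pos c n
  · rw [b2, b3 0 Nat.one_pos, a2]
    exact abs_output_sub_le ha

end Majorana

theorem theorem1 :
    -- the relaxation is a maximum, and always certifies an upper bound on the optimum
    (∀ (n k : ℕ) (h : Majorana.Cliff n), star h = h → Majorana.Cliff.DegLE (2 * k) h →
      IsGreatest (Majorana.Cliff.stateValues h) (Majorana.Cliff.opt h) ∧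
      IsGreatest (Majorana.Cliff.pseudoValues k h) (Majorana.Cliff.sos k h) ∧
      Majorana.Cliff.opt h ≤ Majorana.Cliff.sos k h) ∧
    -- the degree-8 relaxation is solvable in deterministic polynomial time
    Majorana.SOSPolyTime 4 ∧
    -- bound on the expectation of the degree-8 relaxation
    (∀ n : ℕ, 12 ≤ n →
      Integrable (fun J : Majorana.Quad n → ℝ => Majorana.Cliff.sos 4 (Majorana.sykH J))
        (Majorana.sykLaw n) ∧
      ∫ J : Majorana.Quad n → ℝ, Majorana.Cliff.sos 4 (Majorana.sykH J) ∂(Majorana.sykLaw n)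
        ≤ √(1 + √6) * √(n : ℝ)) ∧
    -- the same bound with high probability
    Tendsto (fun n : ℕ => Majorana.sykLaw n
        {J | Majorana.Cliff.sos 4 (Majorana.sykH J) ≤ √(1 + √6) * √(n : ℝ)}) atTop (𝓝 1) ∧
    -- the degree-6 relaxation, up to a constant, with high probability
    (∃ C : ℝ, Tendsto (fun n : ℕ => Majorana.sykLaw n
        {J | Majorana.Cliff.sos 3 (Majorana.sykH J) ≤ C * √(n : ℝ)}) atTop (𝓝 1)) := by
  -- The explicit constant already holds at degree 6, so it also serves as the constant C.
  refine ⟨fun n k h _ hh => ⟨Majorana.Cliff.isGreatest_opt h, Majorana.Cliff.isGreatest_sos k hh,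
    Majorana.Cliff.opt_le_sos k hh⟩, Majorana.sosPolyTime_four, fun n hn =>
    ⟨Majorana.integrable_sos_sykH (by norm_num), Majorana.integral_sos_four_le hn⟩,
    Majorana.tendsto_sos_four_le, √(1 + √6), Majorana.tendsto_sos_three_le⟩
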